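/- Let $n\ge 2$ and let $M$ be a compact (Hausdorff) smooth $n$-dimensional manifold with smooth boundary $\partial M$, every connected component of which meets $\partial M$ (for example, $M$ connected with $\partial M\neq\emptyset$; the boundary itself need not be connected). Let $g_0$ be a smooth Riemannian metric on $M$ that is static: there is a smooth function $f:M\to\mathbb{R}$ with $f>0$ in $M\setminus\partial M$, $f=0$ on $\partial M$, and $$f\,\mathrm{Ric}_{g_0}-\nabla^2_{g_0}f+(\Delta_{g_0}f)\,g_0=0\quad\text{in } M\setminus\partial M .$$ Let $g=\mu g_0$, with $\mu$ a positive smooth function on $M$, be a metric in the conformal class $[g_0]$ such that $g=g_0$ at every point of $\partial M$. If the scalar curvatures satisfy $R_g\ge R_{g_0}$ on $M$, then $g=g_0$ on $M$. -/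

import Mathlib

open scoped Manifold ContDiff

noncomputable section

namespace ConformalStatic

/-! ### Riemannian geometry in local coordinates

All derivatives are taken within the closed half-space `range (𝓡∂ n)`, so that the formulas make
sense (as one-sided derivatives) at boundary points too. -/

/-- Partial derivative `∂ᵢ F` of a real function of the coordinates `y`, taken within the closed
half-space. -/
def pderiv {n : ℕ} [NeZero n] (i : Fin n) (F : EuclideanSpace ℝ (Fin n) → ℝ)
    (y : EuclideanSpace ℝ (Fin n)) : ℝ :=
  fderivWithin ℝ F (Set.range (𝓡∂ n)) y (EuclideanSpace.single i 1)

/-- Christoffel symbols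
`Γᵏᵢⱼ = ½ ∑ₗ Gᵏˡ (∂ᵢ Gⱼₗ + ∂ⱼ Gᵢₗ - ∂ₗ Gᵢⱼ)` of the coordinate metric `G`. -/
def christoffel {n : ℕ} [NeZero n] (G : EuclideanSpace ℝ (Fin n) → Matrix (Fin n) (Fin n) ℝ)
    (k i j : Fin n) (y : EuclideanSpace ℝ (Fin n)) : ℝ :=
  (1 / 2) * ∑ l, (G y)⁻¹ k l *
    (pderiv i (fun z => G z j l) y + pderiv j (fun z => G z i l) y - pderiv l (fun z => G z i j) y)

/-- Components of the Ricci tensor,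
`Ricᵢⱼ = ∑ₖ (∂ₖ Γᵏᵢⱼ - ∂ⱼ Γᵏᵢₖ) + ∑ₖₗ (Γᵏₖₗ Γˡᵢⱼ - Γᵏⱼₗ Γˡᵢₖ)`
(with this sign convention the round sphere has positive Ricci curvature). -/
def ricciCoord {n : ℕ} [NeZero n] (G : EuclideanSpace ℝ (Fin n) → Matrix (Fin n) (Fin n) ℝ)
    (i j : Fin n) (y : EuclideanSpace ℝ (Fin n)) : ℝ :=
  (∑ k, (pderiv k (christoffel G k i j) y - pderiv j (christoffel G k i k) y)) +
    ∑ k, ∑ l, (christoffel G k k l y * christoffel G l i j y -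
      christoffel G k j l y * christoffel G l i k y)

/-- Components of the Hessian (second covariant derivative) of a function `F` of the coordinates,
`(∇²F)ᵢⱼ = ∂ᵢ ∂ⱼ F - ∑ₖ Γᵏᵢⱼ ∂ₖ F`. -/
def hessianCoord {n : ℕ} [NeZero n] (G : EuclideanSpace ℝ (Fin n) → Matrix (Fin n) (Fin n) ℝ)
    (F : EuclideanSpace ℝ (Fin n) → ℝ) (i j : Fin n) (y : EuclideanSpace ℝ (Fin n)) : ℝ :=
  pderiv i (pderiv j F) y - ∑ k, christoffel G k i j y * pderiv k F y

/-! ### Riemannian manifolds with boundary -/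

/-- A smooth Riemannian metric on a smooth manifold with boundary `M`. -/
abbrev Metric (n : ℕ) [NeZero n] (M : Type*) [TopologicalSpace M]
    [ChartedSpace (EuclideanHalfSpace n) M] [IsManifold (𝓡∂ n) ∞ M] :=
  Bundle.ContMDiffRiemannianMetric (𝓡∂ n) ∞ (EuclideanSpace ℝ (Fin n))
    (fun x : M => TangentSpace (𝓡∂ n) x)

variable {n : ℕ} [NeZero n] {M : Type*} [TopologicalSpace M]
  [ChartedSpace (EuclideanHalfSpace n) M] [IsManifold (𝓡∂ n) ∞ M]

/-- The coordinate vector field `∂ᵢ` of the preferred chart around `x₀`, at the point with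
coordinates `y`. -/
def coordVector (x₀ : M) (i : Fin n) (y : EuclideanSpace ℝ (Fin n)) :
    TangentSpace (𝓡∂ n) ((extChartAt (𝓡∂ n) x₀).symm y) :=
  mfderivWithin 𝓘(ℝ, EuclideanSpace ℝ (Fin n)) (𝓡∂ n) (extChartAt (𝓡∂ n) x₀).symm
    (Set.range (𝓡∂ n)) y (EuclideanSpace.single i (1 : ℝ) : EuclideanSpace ℝ (Fin n))

/-- The matrix `Gᵢⱼ = g(∂ᵢ, ∂ⱼ)` of the metric `g` in the preferred chart around `x₀`. -/
def metricCoord (g : Metric n M) (x₀ : M) (y : EuclideanSpace ℝ (Fin n)) :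
    Matrix (Fin n) (Fin n) ℝ :=
  Matrix.of fun i j =>
    g.inner ((extChartAt (𝓡∂ n) x₀).symm y) (coordVector x₀ i y) (coordVector x₀ j y)

/-- The `i`-th component of a tangent vector at `x` in the coordinate basis of the preferred chart
at `x`. (Mathlib's `TangentSpace (𝓡∂ n) x` is the model space `ℝⁿ`, a tangent vector at `x` being
represented by its coordinates in that very chart.) -/
def comp {x : M} (v : TangentSpace (𝓡∂ n) x) (i : Fin n) : ℝ :=
  (show EuclideanSpace ℝ (Fin n) from v) i

/-- The Ricci tensor of `g` at `x`. -/
def ricci (g : Metric n M) (x : M) (v w : TangentSpace (𝓡∂ n) x) : ℝ :=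
  ∑ i, ∑ j, ricciCoord (metricCoord g x) i j (extChartAt (𝓡∂ n) x x) * comp v i * comp w j

/-- The scalar curvature of `g` at `x`: the `g`-trace of the Ricci tensor. -/
def scalarCurvature (g : Metric n M) (x : M) : ℝ :=
  ∑ i, ∑ j, (metricCoord g x (extChartAt (𝓡∂ n) x x))⁻¹ i j *
    ricciCoord (metricCoord g x) i j (extChartAt (𝓡∂ n) x x)

/-- The Hessian `∇²f` of a function `f : M → ℝ` with respect to `g` at `x`. -/
def hessian (g : Metric n M) (f : M → ℝ) (x : M) (v w : TangentSpace (𝓡∂ n) x) : ℝ :=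
  ∑ i, ∑ j, hessianCoord (metricCoord g x) (f ∘ (extChartAt (𝓡∂ n) x).symm) i j
    (extChartAt (𝓡∂ n) x x) * comp v i * comp w j

/-- The Laplacian `Δf` of a function `f : M → ℝ` with respect to `g` at `x`: the `g`-trace of the
Hessian. -/
def laplacian (g : Metric n M) (f : M → ℝ) (x : M) : ℝ :=
  ∑ i, ∑ j, (metricCoord g x (extChartAt (𝓡∂ n) x x))⁻¹ i j *
    hessianCoord (metricCoord g x) (f ∘ (extChartAt (𝓡∂ n) x).symm) i j (extChartAt (𝓡∂ n) x x)

/-- `g` is static: there is a smooth function `f` on `M`, positive in the interior and zero on the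
boundary, with `f Ric - ∇²f + (Δf) g = 0` in the interior. -/
def IsStatic (g : Metric n M) : Prop :=
  ∃ f : M → ℝ, ContMDiff (𝓡∂ n) 𝓘(ℝ, ℝ) ∞ f ∧
    (∀ x ∈ (𝓡∂ n).interior M, 0 < f x) ∧
    (∀ x ∈ (𝓡∂ n).boundary M, f x = 0) ∧
    ∀ x ∈ (𝓡∂ n).interior M, ∀ v w : TangentSpace (𝓡∂ n) x,
      f x * ricci g x v w - hessian g f x v w + laplacian g f x * g.inner x v w = 0

/-- The conformal class `[g₀]`: all metrics `μ g₀` with `μ` a positive smooth function on `M`. -/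
def conformalClass (g₀ : Metric n M) : Set (Metric n M) :=
  {g | ∃ μ : M → ℝ, ContMDiff (𝓡∂ n) 𝓘(ℝ, ℝ) ∞ μ ∧ (∀ x, 0 < μ x) ∧
    ∀ x, g.inner x = μ x • g₀.inner x}

end ConformalStatic

end

/-! Write `g = e^φ g₀` with `φ = log μ`, so `φ = 0` on the boundary. The conformal formula reads
`e^φ R_g = R₀ - (n-1) Δφ - (n-1)(n-2)/4 |∇φ|²`, where `R₀` and all operators refer to `g₀`. With
`R_g ≥ R₀` and `n ≥ 2` it gives `Δφ ≤ L (1 - e^φ)`, where `L = R₀/(n-1)`. The trace of the static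
equation says that the potential solves `Δf + L f = 0`. Being positive inside and zero on the
boundary, `f` plays the role of a first Dirichlet eigenfunction against which `φ` is compared.

Two facts about static metrics are needed. The divergence of the static equation, with the
contracted Bianchi identity and the Ricci identity, gives `f dR₀ = 0`, so `R₀` is locally constant
inside. It is positive: where `R₀ ≤ 0` the potential is subharmonic, and the strong maximum
principle would make it constant on a component, although it vanishes on the boundary of that
component (`IsPotential.scalarCurvature_pos`). Moreover `∇f ≠ 0` on the boundary, since `f` solves a
linear second order system and zero Cauchy data at one boundary point would force `f = 0` along a
segment into the interior (`exists_pderiv_ne_zero`).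

As `1 - e^φ ≤ -φ`, one has `Δφ + L φ ≤ 0`. On every clopen set meeting the interior, `φ ≥ q f` for
some constant `q`, with equality at an interior point `z` (`IsPotential.exists_touching`). The
minimum of `φ/f` cannot escape to the boundary because `1 - B f²` is a strict supersolution there,
which is where `∇f ≠ 0` enters. At `z` the Laplacian of `φ - q f` is nonnegative, which gives `1 -
e^φ + φ ≥ 0`, hence `φ(z) = 0`, `q = 0` and `φ ≥ 0`. Now `φ` is nonnegative and superharmonic, so
its interior zero set is open and has clopen closure. A point left outside this closure would yield
a further touching point, that is, a zero of `φ` outside it. Hence `φ = 0`.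

The local geometry is established in coordinates. The transformation laws of Christoffel symbols,
curvature and Hessian make every scalar quantity independent of the chart at interior points, and
the pointwise identities are then verified at the centre of normal coordinates. -/

open scoped Manifold ContDiff
noncomputable section
namespace ConformalStatic
open Filter Topology

/-! ### Calculus of partial derivatives in the closed half-space -/

section Calculus

variable {n : ℕ} [NeZero n]

/-- The closed half-space, as a subset of the Euclidean space. -/
abbrev HS (n : ℕ) [NeZero n] : Set (EuclideanSpace ℝ (Fin n)) := Set.range (𝓡∂ n)

/-- The `i`-th vector of the standard basis. -/
abbrev bv {n : ℕ} (i : Fin n) : EuclideanSpace ℝ (Fin n) := EuclideanSpace.single i (1 : ℝ)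

/-- Smoothness at a point, within the closed half-space. -/
abbrev Smooth {F : Type*} [NormedAddCommGroup F] [NormedSpace ℝ F]
    (f : EuclideanSpace ℝ (Fin n) → F) (y : EuclideanSpace ℝ (Fin n)) : Prop :=
  ContDiffWithinAt ℝ ∞ f (HS n) y

lemma mem_HS {y : EuclideanSpace ℝ (Fin n)} : y ∈ HS n ↔ 0 ≤ y 0 := by
  rw [HS, range_modelWithCornersEuclideanHalfSpace]; rfl

lemma mem_interior_HS {y : EuclideanSpace ℝ (Fin n)} : y ∈ interior (HS n) ↔ 0 < y 0 := by
  rw [HS, interior_range_modelWithCornersEuclideanHalfSpace]; rfl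

lemma uniqueDiffOn_HS : UniqueDiffOn ℝ (HS n) := (𝓡∂ n).uniqueDiffOn

variable {y : EuclideanSpace ℝ (Fin n)} {F K : EuclideanSpace ℝ (Fin n) → ℝ}

lemma nhdsWithin_HS (hy : y ∈ interior (HS n)) : 𝓝[HS n] y = 𝓝 y :=
  nhdsWithin_eq_nhds.2 (mem_interior_iff_mem_nhds.1 hy)

lemma Smooth.diff {F' : Type*} [NormedAddCommGroup F'] [NormedSpace ℝ F']
    {f : EuclideanSpace ℝ (Fin n) → F'} (h : Smooth f y) :
    DifferentiableWithinAt ℝ f (HS n) y :=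
  ContDiffWithinAt.differentiableWithinAt h (by simp)

lemma Smooth.eventually_diff {F' : Type*} [NormedAddCommGroup F'] [NormedSpace ℝ F']
    {f : EuclideanSpace ℝ (Fin n) → F'} (hy : y ∈ HS n) (h : Smooth f y) :
    ∀ᶠ z in 𝓝[HS n] y, DifferentiableWithinAt ℝ f (HS n) z := by
  have h1 : ContDiffWithinAt ℝ 1 f (HS n) y := ContDiffWithinAt.of_le h (by norm_cast)
  have := h1.eventually (by simp)
  rw [Set.insert_eq_of_mem hy] at this
  exact this.mono fun z hz => hz.differentiableWithinAt (by simp)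

lemma Smooth.pderiv (hy : y ∈ HS n) (h : Smooth F y) (i : Fin n) : Smooth (pderiv i F) y :=
  ContDiffWithinAt.fderivWithin_right_apply h contDiffWithinAt_const uniqueDiffOn_HS (by simp) hy

lemma pderiv_congr {i : Fin n} (hy : y ∈ HS n) (h : F =ᶠ[𝓝[HS n] y] K) :
    pderiv i F y = pderiv i K y := by
  unfold pderiv
  rw [h.fderivWithin_eq_of_mem hy]

lemma pderiv_eventuallyEq {i : Fin n} (h : F =ᶠ[𝓝[HS n] y] K) :
    pderiv i F =ᶠ[𝓝[HS n] y] pderiv i K := by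
  filter_upwards [eventually_eventually_nhdsWithin.2 h, self_mem_nhdsWithin] with z hz hz'
  exact pderiv_congr hz' hz

lemma pderiv_const {i : Fin n} (c : ℝ) : pderiv i (fun _ => c) y = 0 := by
  simp [pderiv]

lemma pderiv_add {i : Fin n} (hy : y ∈ HS n) (hF : DifferentiableWithinAt ℝ F (HS n) y)
    (hK : DifferentiableWithinAt ℝ K (HS n) y) :
    pderiv i (fun z => F z + K z) y = pderiv i F y + pderiv i K y := by
  unfold pderiv; rw [fderivWithin_fun_add (uniqueDiffOn_HS y hy) hF hK]; rfl

lemma pderiv_sub {i : Fin n} (hy : y ∈ HS n) (hF : DifferentiableWithinAt ℝ F (HS n) y)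
    (hK : DifferentiableWithinAt ℝ K (HS n) y) :
    pderiv i (fun z => F z - K z) y = pderiv i F y - pderiv i K y := by
  unfold pderiv; rw [fderivWithin_fun_sub (uniqueDiffOn_HS y hy) hF hK]; rfl

lemma pderiv_mul {i : Fin n} (hy : y ∈ HS n) (hF : DifferentiableWithinAt ℝ F (HS n) y)
    (hK : DifferentiableWithinAt ℝ K (HS n) y) :
    pderiv i (fun z => F z * K z) y = F y * pderiv i K y + pderiv i F y * K y := by
  unfold pderiv; rw [fderivWithin_fun_mul (uniqueDiffOn_HS y hy) hF hK]
  simp only [add_apply, smul_apply, smul_eq_mul]; ring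

lemma pderiv_const_mul {i : Fin n} (hy : y ∈ HS n) (c : ℝ)
    (hF : DifferentiableWithinAt ℝ F (HS n) y) :
    pderiv i (fun z => c * F z) y = c * pderiv i F y := by
  rw [pderiv_mul hy (differentiableWithinAt_const c) hF, pderiv_const]; ring

lemma pderiv_sum {ι : Type*} [Fintype ι] {i : Fin n} {A : ι → EuclideanSpace ℝ (Fin n) → ℝ}
    (hy : y ∈ HS n) (hA : ∀ k, DifferentiableWithinAt ℝ (A k) (HS n) y) :
    pderiv i (fun z => ∑ k, A k z) y = ∑ k, pderiv i (A k) y := by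
  unfold pderiv; rw [fderivWithin_fun_sum (uniqueDiffOn_HS y hy) fun k _ => hA k]
  simp only [sum_apply]

lemma pderiv_eq_fderiv {i : Fin n} (hy : y ∈ interior (HS n)) :
    pderiv i F y = fderiv ℝ F y (bv i) := by
  unfold pderiv
  rw [fderivWithin_of_mem_nhds (mem_interior_iff_mem_nhds.1 hy)]

/-- Symmetry survives at boundary points because the half-space is contained in the closure of its
interior. Order two is the useful hypothesis: smoothness of order `∞` at one point yields only
finite orders at nearby points. -/
lemma pderiv_comm_of_two {i j : Fin n} (hy : y ∈ HS n) (h : ContDiffWithinAt ℝ 2 F (HS n) y) :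
    pderiv i (pderiv j F) y = pderiv j (pderiv i F) y := by
  have h1 : DifferentiableWithinAt ℝ (fderivWithin ℝ F (HS n)) (HS n) y :=
    (ContDiffWithinAt.fderivWithin_right (m := 1) h uniqueDiffOn_HS
      (by norm_num) hy).differentiableWithinAt (by simp)
  have key : ∀ a b : Fin n, ConformalStatic.pderiv a (ConformalStatic.pderiv b F) y =
      fderivWithin ℝ (fderivWithin ℝ F (HS n)) (HS n) y (bv a) (bv b) := by
    intro a b
    change fderivWithin ℝ (fun z => fderivWithin ℝ F (HS n) z (bv b)) (HS n) y (bv a) = _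
    rw [fderivWithin_clm_apply (uniqueDiffOn_HS y hy) h1 (differentiableWithinAt_const _)]
    simp
  rw [key, key]
  refine (ContDiffWithinAt.isSymmSndFDerivWithinAt h (by simp) uniqueDiffOn_HS ?_ hy) _ _
  have hc := (𝓡∂ n).convex_range.closure_interior_eq_closure_of_nonempty_interior
    (𝓡∂ n).nonempty_interior
  rw [hc]
  exact subset_closure hy

lemma pderiv_comm {i j : Fin n} (hy : y ∈ HS n) (h : Smooth F y) :
    pderiv i (pderiv j F) y = pderiv j (pderiv i F) y :=
  pderiv_comm_of_two hy (ContDiffWithinAt.of_le h (by norm_cast))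

lemma Smooth.mul (hF : Smooth F y) (hK : Smooth K y) : Smooth (fun z => F z * K z) y :=
  ContDiffWithinAt.mul hF hK

lemma Smooth.add (hF : Smooth F y) (hK : Smooth K y) : Smooth (fun z => F z + K z) y :=
  ContDiffWithinAt.add hF hK

lemma Smooth.sub (hF : Smooth F y) (hK : Smooth K y) : Smooth (fun z => F z - K z) y :=
  ContDiffWithinAt.sub hF hK

lemma Smooth.const (c : ℝ) : Smooth (fun _ : EuclideanSpace ℝ (Fin n) => c) y :=
  contDiffWithinAt_const

lemma Smooth.sum {ι : Type*} [Fintype ι] {A : ι → EuclideanSpace ℝ (Fin n) → ℝ}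
    (hA : ∀ k, Smooth (A k) y) : Smooth (fun z => ∑ k, A k z) y :=
  ContDiffWithinAt.sum fun k _ => hA k

lemma Smooth.det {A : EuclideanSpace ℝ (Fin n) → Matrix (Fin n) (Fin n) ℝ}
    (hA : ∀ i j, Smooth (fun z => A z i j) y) : Smooth (fun z => (A z).det) y := by
  simp only [Matrix.det_apply]
  refine Smooth.sum fun σ => ?_
  exact ContDiffWithinAt.const_smul _ (contDiffWithinAt_prod fun i _ => hA _ _)

/-- Cramer's rule: the entries of the inverse are quotients of determinants. -/
lemma Smooth.inv_entry {A : EuclideanSpace ℝ (Fin n) → Matrix (Fin n) (Fin n) ℝ}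
    (hA : ∀ i j, Smooth (fun z => A z i j) y) (hdet : (A y).det ≠ 0) (i j : Fin n) :
    Smooth (fun z => (A z)⁻¹ i j) y := by
  simp only [Matrix.inv_def, Matrix.smul_apply, smul_eq_mul, Ring.inverse_eq_inv',
    Matrix.adjugate_apply]
  refine Smooth.mul ((Smooth.det hA).inv hdet) (Smooth.det fun a b => ?_)
  by_cases h : a = j
  · subst h; simpa using Smooth.const _
  · simpa [Matrix.updateRow_ne h] using hA a b

/-- `G` is a smooth Riemannian metric in a neighbourhood of `y` in the half-space. -/
def MetricAt (G : EuclideanSpace ℝ (Fin n) → Matrix (Fin n) (Fin n) ℝ)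
    (y : EuclideanSpace ℝ (Fin n)) : Prop :=
  y ∈ HS n ∧ ∀ᶠ z in 𝓝[HS n] y, (∀ i j, Smooth (fun w => G w i j) z) ∧ (G z).PosDef

variable {G : EuclideanSpace ℝ (Fin n) → Matrix (Fin n) (Fin n) ℝ}

lemma MetricAt.eventually (h : MetricAt G y) : ∀ᶠ z in 𝓝[HS n] y, MetricAt G z := by
  filter_upwards [eventually_eventually_nhdsWithin.2 h.2, self_mem_nhdsWithin] with z hz hz'
  exact ⟨hz', hz⟩

lemma MetricAt.smooth (h : MetricAt G y) (i j : Fin n) : Smooth (fun w => G w i j) y :=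
  (h.2.self_of_nhdsWithin h.1).1 i j

lemma MetricAt.posDef (h : MetricAt G y) : (G y).PosDef :=
  (h.2.self_of_nhdsWithin h.1).2

lemma MetricAt.symm (h : MetricAt G y) (i j : Fin n) : G y i j = G y j i := by
  simpa using (h.posDef.isHermitian.apply i j).symm

lemma MetricAt.symm_eventually (h : MetricAt G y) (i j : Fin n) :
    (fun z => G z i j) =ᶠ[𝓝[HS n] y] fun z => G z j i :=
  h.eventually.mono fun _ hz => hz.symm i j

lemma MetricAt.inv_smooth (h : MetricAt G y) (i j : Fin n) : Smooth (fun w => (G w)⁻¹ i j) y :=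
  Smooth.inv_entry h.smooth h.posDef.det_pos.ne' i j

lemma MetricAt.christoffel_smooth (h : MetricAt G y) (k i j : Fin n) :
    Smooth (christoffel G k i j) y := by
  unfold christoffel
  refine Smooth.mul (Smooth.const _) (Smooth.sum fun l => (h.inv_smooth k l).mul ?_)
  exact (((h.smooth j l).pderiv h.1 i).add ((h.smooth i l).pderiv h.1 j)).sub
    ((h.smooth i j).pderiv h.1 l)

lemma MetricAt.ricciCoord_smooth (h : MetricAt G y) (i j : Fin n) :
    Smooth (ricciCoord G i j) y := by
  have hc := h.christoffel_smooth
  unfold ricciCoord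
  exact (Smooth.sum fun k => ((hc _ _ _).pderiv h.1 k).sub ((hc _ _ _).pderiv h.1 j)).add
    (Smooth.sum fun k => Smooth.sum fun l => ((hc _ _ _).mul (hc _ _ _)).sub
      ((hc _ _ _).mul (hc _ _ _)))

lemma MetricAt.hessianCoord_smooth (h : MetricAt G y) (hF : Smooth F y) (i j : Fin n) :
    Smooth (hessianCoord G F i j) y := by
  unfold hessianCoord
  exact ((hF.pderiv h.1 j).pderiv h.1 i).sub
    (Smooth.sum fun k => (h.christoffel_smooth k i j).mul (hF.pderiv h.1 k))

/-- The trace of a matrix `B` with respect to the coordinate metric `G`. -/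
def trG (G : Matrix (Fin n) (Fin n) ℝ) (B : Fin n → Fin n → ℝ) : ℝ :=
  ∑ i, ∑ j, G⁻¹ i j * B i j

/-- Coordinate scalar curvature. -/
def scalCoord (G : EuclideanSpace ℝ (Fin n) → Matrix (Fin n) (Fin n) ℝ)
    (y : EuclideanSpace ℝ (Fin n)) : ℝ := trG (G y) fun i j => ricciCoord G i j y

/-- Coordinate Laplacian. -/
def lapCoord (G : EuclideanSpace ℝ (Fin n) → Matrix (Fin n) (Fin n) ℝ)
    (F : EuclideanSpace ℝ (Fin n) → ℝ) (y : EuclideanSpace ℝ (Fin n)) : ℝ :=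
  trG (G y) fun i j => hessianCoord G F i j y

/-- Coordinate expression of `|∇F|²`. -/
def gradSqCoord (G : EuclideanSpace ℝ (Fin n) → Matrix (Fin n) (Fin n) ℝ)
    (F : EuclideanSpace ℝ (Fin n) → ℝ) (y : EuclideanSpace ℝ (Fin n)) : ℝ :=
  trG (G y) fun i j => pderiv i F y * pderiv j F y

lemma MetricAt.trG_smooth (h : MetricAt G y) {B : Fin n → Fin n → EuclideanSpace ℝ (Fin n) → ℝ}
    (hB : ∀ i j, Smooth (B i j) y) : Smooth (fun z => trG (G z) fun i j => B i j z) y :=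
  Smooth.sum fun i => Smooth.sum fun j => (h.inv_smooth i j).mul (hB i j)

lemma MetricAt.scalCoord_smooth (h : MetricAt G y) : Smooth (scalCoord G) y :=
  h.trG_smooth fun i j => h.ricciCoord_smooth i j

lemma MetricAt.lapCoord_smooth (h : MetricAt G y) (hF : Smooth F y) : Smooth (lapCoord G F) y :=
  h.trG_smooth fun i j => h.hessianCoord_smooth hF i j

lemma MetricAt.gradSqCoord_smooth (h : MetricAt G y) (hF : Smooth F y) :
    Smooth (gradSqCoord G F) y :=
  h.trG_smooth fun i j => (hF.pderiv h.1 i).mul (hF.pderiv h.1 j)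

lemma pderiv_metric_symm (h : MetricAt G y) (s i j : Fin n) :
    pderiv s (fun z => G z i j) y = pderiv s (fun z => G z j i) y :=
  pderiv_congr h.1 (h.symm_eventually i j)

/-- The Christoffel symbols of the first kind. -/
lemma MetricAt.sum_mul_christoffel (h : MetricAt G y) (m i j : Fin n) :
    ∑ k, G y m k * christoffel G k i j y = (1 / 2) *
      (pderiv i (fun z => G z j m) y + pderiv j (fun z => G z i m) y -
        pderiv m (fun z => G z i j) y) := by
  have hu : IsUnit (G y).det := h.posDef.det_pos.ne'.isUnit
  unfold christoffel
  set A : Fin n → ℝ := fun l => pderiv i (fun z => G z j l) y + pderiv j (fun z => G z i l) y -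
    pderiv l (fun z => G z i j) y with hA
  have h1 : ∑ k, G y m k * ((1 / 2) * ∑ l, (G y)⁻¹ k l * A l) =
      (1 / 2) * (G y).mulVec ((G y)⁻¹.mulVec A) m := by
    simp only [Matrix.mulVec, dotProduct, Finset.mul_sum]
    refine Finset.sum_congr rfl fun k _ => Finset.sum_congr rfl fun l _ => by ring
  change ∑ k, G y m k * ((1 / 2) * ∑ l, (G y)⁻¹ k l * A l) = (1 / 2) * A m
  rw [h1, Matrix.mulVec_mulVec, Matrix.mul_nonsing_inv _ hu, Matrix.one_mulVec]

end Calculus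

end ConformalStatic
end

open scoped Manifold ContDiff
noncomputable section
namespace ConformalStatic
open Filter Topology

/-! ### Coordinate changes -/

section Invariance

variable {n : ℕ}

/-- Euclidean space. -/
abbrev Eu (n : ℕ) : Type := EuclideanSpace ℝ (Fin n)

/-- Applied one variable at a time, this reduces multilinear identities to basis vectors without
bundling either side. -/
lemma linear_ext {V : Type*} [AddCommGroup V] [Module ℝ V] {f g : EuclideanSpace ℝ (Fin n) → V}
    (hf : IsLinearMap ℝ f) (hg : IsLinearMap ℝ g) (h : ∀ i, f (bv i) = g (bv i)) (x) :
    f x = g x := by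
  have : hf.mk' f = hg.mk' g :=
    (EuclideanSpace.basisFun (Fin n) ℝ).toBasis.ext fun i => by simpa using h i
  exact LinearMap.congr_fun this x

/-- The bilinear form with matrix `A`. -/
def bil (A : Matrix (Fin n) (Fin n) ℝ) : Eu n →L[ℝ] Eu n →L[ℝ] ℝ :=
  ∑ i, ∑ j, A i j • (EuclideanSpace.proj i : Eu n →L[ℝ] ℝ).smulRight
    (EuclideanSpace.proj j : Eu n →L[ℝ] ℝ)

lemma bil_apply (A : Matrix (Fin n) (Fin n) ℝ) (u v : Eu n) :
    bil A u v = ∑ i, ∑ j, A i j * u i * v j := by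
  simp [bil, sum_apply, mul_assoc]

lemma bil_bv (A : Matrix (Fin n) (Fin n) ℝ) (i j : Fin n) : bil A (bv i) (bv j) = A i j := by
  simp [bil_apply]

lemma bil_symm {A : Matrix (Fin n) (Fin n) ℝ} (hA : ∀ i j, A i j = A j i) (u v : Eu n) :
    bil A u v = bil A v u := by
  rw [bil_apply, bil_apply, Finset.sum_comm]
  exact Finset.sum_congr rfl fun i _ => Finset.sum_congr rfl fun j _ => by rw [hA]; ring

lemma bil_dotProduct (A : Matrix (Fin n) (Fin n) ℝ) (u v : Eu n) :
    bil A u v = dotProduct (u : Fin n → ℝ) (A.mulVec v) := by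
  rw [bil_apply]
  simp only [dotProduct, Matrix.mulVec, Finset.mul_sum]
  exact Finset.sum_congr rfl fun i _ => Finset.sum_congr rfl fun j _ => by ring

lemma bil_pos {A : Matrix (Fin n) (Fin n) ℝ} (hA : A.PosDef) {u : Eu n} (hu : u ≠ 0) :
    0 < bil A u u := by
  rw [bil_dotProduct]
  have := hA.dotProduct_mulVec_pos (x := (u : Fin n → ℝ)) (fun h => hu (by ext i; exact congrFun h i))
  simpa using this

lemma bil_nondeg {A : Matrix (Fin n) (Fin n) ℝ} (hA : A.PosDef) {u v : Eu n}
    (h : ∀ w, bil A u w = bil A v w) : u = v := by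
  by_contra hne
  have := bil_pos hA (sub_ne_zero.2 hne)
  have h2 := h (u - v)
  rw [map_sub (bil A), sub_apply] at this
  linarith

variable [NeZero n]

/-- The Christoffel symbols as a bilinear map. -/
def gam (G : Eu n → Matrix (Fin n) (Fin n) ℝ) (y : Eu n) : Eu n →L[ℝ] Eu n →L[ℝ] Eu n :=
  ∑ k, ∑ i, ∑ j, christoffel G k i j y • (EuclideanSpace.proj i : Eu n →L[ℝ] ℝ).smulRight
    ((EuclideanSpace.proj j : Eu n →L[ℝ] ℝ).smulRight (bv k))

lemma gam_apply (G : Eu n → Matrix (Fin n) (Fin n) ℝ) (y u v : Eu n) (k : Fin n) :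
    gam G y u v k = ∑ i, ∑ j, christoffel G k i j y * u i * v j := by
  simp [gam, sum_apply, mul_assoc, Pi.single_apply]

lemma gam_bv (G : Eu n → Matrix (Fin n) (Fin n) ℝ) (y : Eu n) (i j k : Fin n) :
    gam G y (bv i) (bv j) k = christoffel G k i j y := by
  simp [gam_apply]

variable {y : Eu n} {G G' : Eu n → Matrix (Fin n) (Fin n) ℝ} {T : Eu n → Eu n}

lemma Smooth.contDiffAt {V : Type*} [NormedAddCommGroup V] [NormedSpace ℝ V] {f : Eu n → V}
    (h : Smooth f y) (hy : y ∈ interior (HS n)) : ContDiffAt ℝ ∞ f y :=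
  ContDiffWithinAt.contDiffAt h (mem_interior_iff_mem_nhds.1 hy)

lemma MetricAt.bil_contDiffAt (h : MetricAt G y) (hy : y ∈ interior (HS n)) :
    ContDiffAt ℝ ∞ (fun z => bil (G z)) y := by
  unfold bil
  exact ContDiffAt.sum fun i _ => ContDiffAt.sum fun j _ =>
    (ContinuousLinearMap.toSpanSingleton ℝ _).contDiff.contDiffAt.comp y
      ((h.smooth i j).contDiffAt hy)

lemma MetricAt.gam_contDiffAt (h : MetricAt G y) (hy : y ∈ interior (HS n)) :
    ContDiffAt ℝ ∞ (gam G) y := by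
  unfold gam
  exact ContDiffAt.sum fun k _ => ContDiffAt.sum fun i _ => ContDiffAt.sum fun j _ =>
    (ContinuousLinearMap.toSpanSingleton ℝ _).contDiff.contDiffAt.comp y
      ((h.christoffel_smooth k i j).contDiffAt hy)

lemma ContDiffAt.diffAt {V W : Type*} [NormedAddCommGroup V] [NormedSpace ℝ V]
    [NormedAddCommGroup W] [NormedSpace ℝ W] {f : V → W} {x : V} (h : ContDiffAt ℝ ∞ f x) :
    DifferentiableAt ℝ f x := h.differentiableAt (by simp)

lemma fderiv_bil_bv (h : MetricAt G y) (hy : y ∈ interior (HS n)) (s i j : Fin n) :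
    fderiv ℝ (fun z => bil (G z)) y (bv s) (bv i) (bv j) = pderiv s (fun z => G z i j) y := by
  rw [pderiv_eq_fderiv hy]
  have h1 : (fun z => G z i j) = fun z => bil (G z) (bv i) (bv j) := by
    funext z; rw [bil_bv]
  have hd := ContDiffAt.diffAt (h.bil_contDiffAt hy)
  rw [h1, fderiv_clm_apply (hd.clm_apply (by fun_prop)) (by fun_prop),
    fderiv_clm_apply hd (by fun_prop)]
  simp

lemma fderiv_gam_bv (h : MetricAt G y) (hy : y ∈ interior (HS n)) (s i j k : Fin n) :
    fderiv ℝ (gam G) y (bv s) (bv i) (bv j) k = pderiv s (christoffel G k i j) y := by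
  rw [pderiv_eq_fderiv hy]
  have h1 : christoffel G k i j = fun z => (EuclideanSpace.proj k : Eu n →L[ℝ] ℝ)
      (gam G z (bv i) (bv j)) := by
    funext z; exact (gam_bv G z i j k).symm
  have hd := ContDiffAt.diffAt (h.gam_contDiffAt hy)
  have hd2 : DifferentiableAt ℝ (fun z => gam G z (bv i) (bv j)) y :=
    (hd.clm_apply (by fun_prop)).clm_apply (by fun_prop)
  have := ((EuclideanSpace.proj k : Eu n →L[ℝ] ℝ).hasFDerivAt.comp y hd2.hasFDerivAt).fderiv
  rw [h1]
  change _ = (fderiv ℝ ((EuclideanSpace.proj k : Eu n →L[ℝ] ℝ) ∘ fun z => gam G z (bv i) (bv j)) y) _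
  rw [this, fderiv_clm_apply (hd.clm_apply (by fun_prop)) (by fun_prop),
    fderiv_clm_apply hd (by fun_prop)]
  simp

/-- The Koszul formula. -/
lemma koszul (h : MetricAt G y) (hy : y ∈ interior (HS n)) (u v w : Eu n) :
    2 * bil (G y) (gam G y u v) w = fderiv ℝ (fun z => bil (G z)) y u v w +
      fderiv ℝ (fun z => bil (G z)) y v u w - fderiv ℝ (fun z => bil (G z)) y w u v := by
  -- Both sides are linear in `u`, `v` and `w`; on basis vectors the identity is the formula for the
  -- Christoffel symbols of the first kind.
  refine linear_ext (f := fun u => 2 * bil (G y) (gam G y u v) w)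
    (g := fun u => fderiv ℝ (fun z => bil (G z)) y u v w +
      fderiv ℝ (fun z => bil (G z)) y v u w - fderiv ℝ (fun z => bil (G z)) y w u v) ?_ ?_ ?_ u
  · constructor <;> intros <;> simp <;> ring
  · constructor <;> intros <;> simp <;> ring
  intro i
  refine linear_ext (f := fun v => 2 * bil (G y) (gam G y (bv i) v) w)
    (g := fun v => fderiv ℝ (fun z => bil (G z)) y (bv i) v w +
      fderiv ℝ (fun z => bil (G z)) y v (bv i) w -
      fderiv ℝ (fun z => bil (G z)) y w (bv i) v) ?_ ?_ ?_ v
  · constructor <;> intros <;> simp <;> ring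
  · constructor <;> intros <;> simp <;> ring
  intro j
  refine linear_ext (f := fun w => 2 * bil (G y) (gam G y (bv i) (bv j)) w)
    (g := fun w => fderiv ℝ (fun z => bil (G z)) y (bv i) (bv j) w +
      fderiv ℝ (fun z => bil (G z)) y (bv j) (bv i) w -
      fderiv ℝ (fun z => bil (G z)) y w (bv i) (bv j)) ?_ ?_ ?_ w
  · constructor <;> intros <;> simp <;> ring
  · constructor <;> intros <;> simp <;> ring
  intro m
  simp only [fderiv_bil_bv h hy]
  have h1 : bil (G y) (gam G y (bv i) (bv j)) (bv m) =
      ∑ k, G y m k * christoffel G k i j y := by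
    rw [bil_apply]
    refine Finset.sum_congr rfl fun k _ => ?_
    rw [gam_bv]
    simp [Pi.single_apply, h.symm k m]
  rw [h1, h.sum_mul_christoffel]
  ring

lemma christoffel_symm (h : MetricAt G y) (k i j : Fin n) :
    christoffel G k i j y = christoffel G k j i y := by
  unfold christoffel
  congr 1
  refine Finset.sum_congr rfl fun l _ => ?_
  rw [pderiv_metric_symm h l i j]
  ring

lemma gam_symm (h : MetricAt G y) (u v : Eu n) : gam G y u v = gam G y v u := by
  ext k
  rw [gam_apply, gam_apply, Finset.sum_comm]
  exact Finset.sum_congr rfl fun i _ => Finset.sum_congr rfl fun j _ => by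
    rw [christoffel_symm h]; ring

/-- Near `y`, the coordinate metric `G` is the pull-back of `G'` under the smooth map `T`. -/
def Pullback (T : Eu n → Eu n) (G G' : Eu n → Matrix (Fin n) (Fin n) ℝ) (y : Eu n) : Prop :=
  ∀ᶠ z in 𝓝 y, z ∈ interior (HS n) ∧ T z ∈ interior (HS n) ∧ ContDiffAt ℝ ∞ T z ∧
    MetricAt G z ∧ MetricAt G' (T z) ∧
    ∀ u v, bil (G z) u v = bil (G' (T z)) (fderiv ℝ T z u) (fderiv ℝ T z v)

namespace Pullback

variable (h : Pullback T G G' y)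
include h

lemma eventually : ∀ᶠ z in 𝓝 y, Pullback T G G' z := eventually_eventually_nhds.2 h
lemma mem : y ∈ interior (HS n) := h.self_of_nhds.1
lemma mem' : T y ∈ interior (HS n) := h.self_of_nhds.2.1
lemma contDiffAt : ContDiffAt ℝ ∞ T y := h.self_of_nhds.2.2.1
lemma metric : MetricAt G y := h.self_of_nhds.2.2.2.1
lemma metric' : MetricAt G' (T y) := h.self_of_nhds.2.2.2.2.1
lemma eq (u v : Eu n) : bil (G y) u v = bil (G' (T y)) (fderiv ℝ T y u) (fderiv ℝ T y v) :=
  h.self_of_nhds.2.2.2.2.2 u v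

/-- A linear map that pulls a form back to a positive definite one has no kernel, so `T` need not be
assumed a diffeomorphism. -/
lemma injective : Function.Injective (fderiv ℝ T y) := by
  rw [injective_iff_map_eq_zero]
  intro u hu
  by_contra hne
  have := bil_pos h.metric.posDef hne
  rw [h.eq, hu] at this
  simp at this

/-- The differential of the coordinate change, as a linear equivalence. -/
def equiv : Eu n ≃ₗ[ℝ] Eu n := LinearEquiv.ofInjectiveEndo (fderiv ℝ T y).toLinearMap h.injective

lemma surjective : Function.Surjective (fderiv ℝ T y) := h.equiv.surjective

lemma fderiv_contDiffAt : ContDiffAt ℝ ∞ (fderiv ℝ T) y :=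
  h.contDiffAt.fderiv_right (by simp)

lemma second_symm (u v : Eu n) :
    fderiv ℝ (fderiv ℝ T) y u v = fderiv ℝ (fderiv ℝ T) y v u :=
  (h.contDiffAt.isSymmSndFDerivAt (by simp; exact WithTop.coe_le_coe.2 le_top)) u v

lemma fderiv_bil (u v w : Eu n) : fderiv ℝ (fun z => bil (G z)) y w u v =
    fderiv ℝ (fun z => bil (G' z)) (T y) (fderiv ℝ T y w) (fderiv ℝ T y u) (fderiv ℝ T y v) +
    bil (G' (T y)) (fderiv ℝ (fderiv ℝ T) y w u) (fderiv ℝ T y v) +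
    bil (G' (T y)) (fderiv ℝ T y u) (fderiv ℝ (fderiv ℝ T) y w v) := by
  have hd := ContDiffAt.diffAt (h.metric.bil_contDiffAt h.mem)
  have hd' := ContDiffAt.diffAt (h.metric'.bil_contDiffAt h.mem')
  have hT := ContDiffAt.diffAt h.contDiffAt
  have hT2 := ContDiffAt.diffAt h.fderiv_contDiffAt
  have e1 : (fun z => bil (G z) u v) =ᶠ[𝓝 y]
      fun z => bil (G' (T z)) (fderiv ℝ T z u) (fderiv ℝ T z v) :=
    h.eventually.mono fun z hz => hz.eq u v
  have e2 := (e1.fderiv_eq (𝕜 := ℝ))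
  have hc : HasFDerivAt (fun z => bil (G' (T z)))
      ((fderiv ℝ (fun z => bil (G' z)) (T y)).comp (fderiv ℝ T y)) y :=
    HasFDerivAt.comp y hd'.hasFDerivAt hT.hasFDerivAt
  have l1 : fderiv ℝ (fun z => bil (G z) u v) y w = fderiv ℝ (fun z => bil (G z)) y w u v := by
    rw [fderiv_clm_apply (hd.clm_apply (by fun_prop)) (by fun_prop),
      fderiv_clm_apply hd (by fun_prop)]
    simp
  rw [← l1, e2]
  have hu : DifferentiableAt ℝ (fun z => fderiv ℝ T z u) y := hT2.clm_apply (by fun_prop)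
  have hv : DifferentiableAt ℝ (fun z => fderiv ℝ T z v) y := hT2.clm_apply (by fun_prop)
  rw [fderiv_clm_apply (hc.differentiableAt.clm_apply hu) hv,
    fderiv_clm_apply hc.differentiableAt hu, hc.fderiv,
    fderiv_clm_apply hT2 (by fun_prop), fderiv_clm_apply hT2 (by fun_prop)]
  simp
  ring

/-- Differentiating the pull-back relation and inserting it in the Koszul formula leaves, by
symmetry of the second derivative of `T`, a single second-derivative term on top of the Koszul
formula for `G'`. Non-degeneracy of `G'` removes the test vector. -/
lemma gam_law (u v : Eu n) : fderiv ℝ T y (gam G y u v) =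
    fderiv ℝ (fderiv ℝ T) y u v + gam G' (T y) (fderiv ℝ T y u) (fderiv ℝ T y v) := by
  refine bil_nondeg h.metric'.posDef fun w' => ?_
  obtain ⟨w, rfl⟩ := h.surjective w'
  have k1 := koszul h.metric h.mem u v w
  have k2 := koszul h.metric' h.mem' (fderiv ℝ T y u) (fderiv ℝ T y v) (fderiv ℝ T y w)
  rw [h.fderiv_bil, h.fderiv_bil, h.fderiv_bil, h.eq] at k1
  rw [map_add, add_apply]
  have hs := bil_symm h.metric'.symm
  rw [h.second_symm v u, h.second_symm w u, h.second_symm w v] at k1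
  rw [hs (fderiv ℝ T y u) (fderiv ℝ (fderiv ℝ T) y v w),
    hs (fderiv ℝ T y v) (fderiv ℝ (fderiv ℝ T) y u w)] at k1
  linarith

end Pullback

/-- The curvature operator `R(s, v) u`. -/
def curv (G : Eu n → Matrix (Fin n) (Fin n) ℝ) (y s v u : Eu n) : Eu n :=
  fderiv ℝ (gam G) y s u v - fderiv ℝ (gam G) y v u s + gam G y s (gam G y u v) -
    gam G y v (gam G y u s)

/-- Differentiate `gam_law` and antisymmetrise. The third derivatives of `T` cancel by symmetry, and
the terms with second derivatives cancel against those produced by applying `gam_law` to the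
quadratic part of the curvature. -/
lemma Pullback.curv_law (h : Pullback T G G' y) (s v u : Eu n) :
    fderiv ℝ T y (curv G y s v u) =
      curv G' (T y) (fderiv ℝ T y s) (fderiv ℝ T y v) (fderiv ℝ T y u) := by
  have hg := ContDiffAt.diffAt (h.metric.gam_contDiffAt h.mem)
  have hg' := ContDiffAt.diffAt (h.metric'.gam_contDiffAt h.mem')
  have hT := ContDiffAt.diffAt h.contDiffAt
  have hT2 := ContDiffAt.diffAt h.fderiv_contDiffAt
  have hT3 : DifferentiableAt ℝ (fderiv ℝ (fderiv ℝ T)) y :=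
    ContDiffAt.diffAt (h.fderiv_contDiffAt.fderiv_right (by simp))
  have hc : HasFDerivAt (fun z => gam G' (T z))
      ((fderiv ℝ (gam G') (T y)).comp (fderiv ℝ T y)) y :=
    HasFDerivAt.comp y hg'.hasFDerivAt hT.hasFDerivAt
  have hu : ∀ u, DifferentiableAt ℝ (fun z => fderiv ℝ T z u) y :=
    fun u => hT2.clm_apply (by fun_prop)
  have key : ∀ s u v : Eu n,
      fderiv ℝ (fderiv ℝ T) y s (gam G y u v) + fderiv ℝ T y (fderiv ℝ (gam G) y s u v) =
      fderiv ℝ (fderiv ℝ (fderiv ℝ T)) y s u v +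
      fderiv ℝ (gam G') (T y) (fderiv ℝ T y s) (fderiv ℝ T y u) (fderiv ℝ T y v) +
      gam G' (T y) (fderiv ℝ (fderiv ℝ T) y s u) (fderiv ℝ T y v) +
      gam G' (T y) (fderiv ℝ T y u) (fderiv ℝ (fderiv ℝ T) y s v) := by
    intro s u v
    have e1 : (fun z => fderiv ℝ T z (gam G z u v)) =ᶠ[𝓝 y]
        fun z => fderiv ℝ (fderiv ℝ T) z u v + gam G' (T z) (fderiv ℝ T z u) (fderiv ℝ T z v) :=
      h.eventually.mono fun z hz => hz.gam_law u v
    have e2 := DFunLike.congr_fun (e1.fderiv_eq (𝕜 := ℝ)) s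
    have a1 : DifferentiableAt ℝ (fun z => gam G z u) y := hg.clm_apply (by fun_prop)
    have a2 : DifferentiableAt ℝ (fun z => fderiv ℝ (fderiv ℝ T) z u) y :=
      hT3.clm_apply (by fun_prop)
    have a3 : DifferentiableAt ℝ (fun z => gam G' (T z) (fderiv ℝ T z u)) y :=
      hc.differentiableAt.clm_apply (hu u)
    rw [fderiv_clm_apply hT2 (a1.clm_apply (by fun_prop)), fderiv_clm_apply a1 (by fun_prop),
      fderiv_clm_apply hg (by fun_prop),
      fderiv_fun_add (a2.clm_apply (by fun_prop)) (a3.clm_apply (hu v)),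
      fderiv_clm_apply a2 (by fun_prop), fderiv_clm_apply hT3 (by fun_prop),
      fderiv_clm_apply a3 (hu v), fderiv_clm_apply hc.differentiableAt (hu u), hc.fderiv,
      fderiv_clm_apply hT2 (by fun_prop), fderiv_clm_apply hT2 (by fun_prop)] at e2
    simp at e2
    linear_combination (norm := module) e2
  -- The third derivative is symmetric in its first two slots as a second derivative of `fderiv ℝ
  -- T`, and in its last two by differentiating `second_symm`.
  have third : fderiv ℝ (fderiv ℝ (fderiv ℝ T)) y s u v =
      fderiv ℝ (fderiv ℝ (fderiv ℝ T)) y v u s := by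
    have sym1 : ∀ a b c, fderiv ℝ (fderiv ℝ (fderiv ℝ T)) y a b c =
        fderiv ℝ (fderiv ℝ (fderiv ℝ T)) y b a c := fun a b c => by
      rw [(h.fderiv_contDiffAt.isSymmSndFDerivAt
        (by simp; exact WithTop.coe_le_coe.2 le_top)) a b]
    have sym2 : ∀ a b c, fderiv ℝ (fderiv ℝ (fderiv ℝ T)) y a b c =
        fderiv ℝ (fderiv ℝ (fderiv ℝ T)) y a c b := fun a b c => by
      have e1 : (fun z => fderiv ℝ (fderiv ℝ T) z b c) =ᶠ[𝓝 y]
          fun z => fderiv ℝ (fderiv ℝ T) z c b := h.eventually.mono fun z hz => hz.second_symm b c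
      have e2 := DFunLike.congr_fun (e1.fderiv_eq (𝕜 := ℝ)) a
      have a2 : ∀ u, DifferentiableAt ℝ (fun z => fderiv ℝ (fderiv ℝ T) z u) y :=
        fun u => hT3.clm_apply (by fun_prop)
      rw [fderiv_clm_apply (a2 b) (by fun_prop), fderiv_clm_apply hT3 (by fun_prop),
        fderiv_clm_apply (a2 c) (by fun_prop), fderiv_clm_apply hT3 (by fun_prop)] at e2
      simpa using e2
    rw [sym2 s u v, sym1 s v u, sym2 v s u]
  have k1 := key s u v
  have k2 := key v u s
  have l1 := h.gam_law s (gam G y u v)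
  have l2 := h.gam_law v (gam G y u s)
  rw [h.gam_law u v, map_add] at l1
  rw [h.gam_law u s, map_add] at l2
  have c1 := gam_symm h.metric' (fderiv ℝ (fderiv ℝ T) y s u) (fderiv ℝ T y v)
  have c2 := gam_symm h.metric' (fderiv ℝ (fderiv ℝ T) y v u) (fderiv ℝ T y s)
  rw [h.second_symm u v] at l1
  rw [h.second_symm u s] at l2
  rw [h.second_symm s v, c1] at k1
  rw [c2] at k2
  unfold curv
  simp only [map_sub, map_add]
  linear_combination (norm := module) k1 - k2 + l1 - l2 + third

end Invariance

end ConformalStatic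
end

open scoped Manifold ContDiff
noncomputable section
namespace ConformalStatic
open Filter Topology

/-! ### Tensoriality of the Ricci curvature, the Hessian and their traces -/

section TensorLaws

variable {n : ℕ}

/-- With `J` the matrix of `L`, both forms change by the congruence `C = Jᵀ C' J`. Then `A⁻ᵀ B` is
conjugate to `A'⁻ᵀ B'`; invertibility of `J` is forced by `det A ≠ 0`. -/
lemma trG_congr_pullback {A A' : Matrix (Fin n) (Fin n) ℝ} {B B' : Fin n → Fin n → ℝ}
    (hA : A.det ≠ 0) (L : Eu n →ₗ[ℝ] Eu n)
    (h1 : ∀ u v, bil A u v = bil A' (L u) (L v))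
    (h2 : ∀ u v, bil (Matrix.of B) u v = bil (Matrix.of B') (L u) (L v)) :
    trG A B = trG A' B' := by
  set J : Matrix (Fin n) (Fin n) ℝ := Matrix.of fun a i => L (bv i) a with hJ
  have key : ∀ C C' : Matrix (Fin n) (Fin n) ℝ, (∀ u v, bil C u v = bil C' (L u) (L v)) →
      C = J.transpose * C' * J := by
    intro C C' hC
    ext i j
    rw [← bil_bv C i j, hC, bil_dotProduct, Matrix.mul_assoc, Matrix.mul_apply, dotProduct]
    refine Finset.sum_congr rfl fun a _ => ?_
    simp [hJ, Matrix.mul_apply, Matrix.mulVec, dotProduct]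
  have eA := key A A' h1
  have eB := key (Matrix.of B) (Matrix.of B') h2
  have hdet := congrArg Matrix.det eA
  rw [Matrix.det_mul, Matrix.det_mul, Matrix.det_transpose] at hdet
  have hJu : IsUnit J.det := by
    refine isUnit_iff_ne_zero.2 fun h0 => hA ?_
    rw [hdet, h0]; ring
  have htr : ∀ (C : Matrix (Fin n) (Fin n) ℝ) (D : Fin n → Fin n → ℝ), trG C D =
      (C⁻¹.transpose * Matrix.of D).trace := by
    intro C D
    simp only [trG, Matrix.trace, Matrix.diag_apply, Matrix.mul_apply, Matrix.transpose_apply,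
      Matrix.of_apply]
    exact Finset.sum_comm
  rw [htr, htr, eB, eA, Matrix.mul_inv_rev, Matrix.mul_inv_rev, Matrix.transpose_mul,
    Matrix.transpose_mul, ← Matrix.transpose_nonsing_inv, Matrix.transpose_transpose]
  have hJt : IsUnit J.transpose.det := by rwa [Matrix.det_transpose]
  have : J⁻¹ * A'⁻¹.transpose * J⁻¹.transpose * (J.transpose * Matrix.of B' * J) =
      J⁻¹ * (A'⁻¹.transpose * Matrix.of B') * J := by
    rw [Matrix.transpose_nonsing_inv J]
    simp only [Matrix.mul_assoc]
    rw [Matrix.nonsing_inv_mul_cancel_left _ _ hJt]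
  rw [this, Matrix.trace_mul_comm, ← Matrix.mul_assoc, Matrix.mul_nonsing_inv _ hJu,
    Matrix.one_mul]

variable [NeZero n] {y : Eu n} {G G' : Eu n → Matrix (Fin n) (Fin n) ℝ} {T : Eu n → Eu n}
  {F F' : Eu n → ℝ}

/-- Exhibits the Ricci tensor as the trace of the endomorphism `s ↦ R(s, v) u`, the form in which
its invariance is visible. -/
lemma ricciCoord_eq (h : MetricAt G y) (hy : y ∈ interior (HS n)) (i j : Fin n) :
    ricciCoord G i j y = ∑ k, curv G y (bv k) (bv j) (bv i) k := by
  have h1 : ∀ a i j k, gam G y (bv a) (gam G y (bv i) (bv j)) k =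
      ∑ l, christoffel G k a l y * christoffel G l i j y := by
    intro a i j k
    rw [gam_apply, Finset.sum_eq_single a]
    · refine Finset.sum_congr rfl fun l _ => ?_
      rw [gam_bv]; simp
    · intro b _ hb
      simp [hb.symm, Pi.single_apply, hb]
    · simp
  unfold ricciCoord curv
  rw [← Finset.sum_add_distrib]
  refine Finset.sum_congr rfl fun k _ => ?_
  simp only [PiLp.add_apply, PiLp.sub_apply]
  rw [fderiv_gam_bv h hy, fderiv_gam_bv h hy, h1, h1, Finset.sum_sub_distrib]
  ring

lemma bil_ricci (h : MetricAt G y) (hy : y ∈ interior (HS n)) (u v : Eu n) :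
    bil (Matrix.of fun i j => ricciCoord G i j y) u v = ∑ k, curv G y (bv k) v u k := by
  have e1 : ∀ s v u u', curv G y s v (u + u') = curv G y s v u + curv G y s v u' := by
    intros; simp only [curv, map_add, add_apply]; abel
  have e2 : ∀ s v u (c : ℝ), curv G y s v (c • u) = c • curv G y s v u := by
    intros; simp only [curv, map_smul, smul_apply, smul_sub, smul_add]
  have e3 : ∀ s v v' u, curv G y s (v + v') u = curv G y s v u + curv G y s v' u := by
    intros; simp only [curv, map_add, add_apply]; abel
  have e4 : ∀ s v u (c : ℝ), curv G y s (c • v) u = c • curv G y s v u := by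
    intros; simp only [curv, map_smul, smul_apply, smul_sub, smul_add]
  refine linear_ext (f := fun u => bil (Matrix.of fun i j => ricciCoord G i j y) u v)
    (g := fun u => ∑ k, curv G y (bv k) v u k) ?_ ?_ ?_ u
  · constructor <;> intros <;> simp
  · constructor <;> intros <;> simp [e1, e2, Finset.sum_add_distrib, Finset.mul_sum]
  intro i
  refine linear_ext (f := fun v => bil (Matrix.of fun i j => ricciCoord G i j y) (bv i) v)
    (g := fun v => ∑ k, curv G y (bv k) v (bv i) k) ?_ ?_ ?_ v
  · constructor <;> intros <;> simp
  · constructor <;> intros <;> simp [e3, e4, Finset.sum_add_distrib, Finset.mul_sum]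
  intro j
  rw [bil_bv, ← ricciCoord_eq h hy]; rfl

lemma trace_eq_sum (L : Eu n →ₗ[ℝ] Eu n) : LinearMap.trace ℝ _ L = ∑ k, L (bv k) k := by
  rw [LinearMap.trace_eq_matrix_trace ℝ (EuclideanSpace.basisFun (Fin n) ℝ).toBasis]
  simp [Matrix.trace, LinearMap.toMatrix_apply]

/-- The curvature operator as a linear map in its first argument. -/
def curvL (G : Eu n → Matrix (Fin n) (Fin n) ℝ) (y v u : Eu n) : Eu n →ₗ[ℝ] Eu n where
  toFun s := curv G y s v u
  map_add' a b := by simp only [curv, map_add, add_apply]; abel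
  map_smul' c a := by simp only [curv, map_smul, smul_apply, smul_sub, smul_add, RingHom.id_apply]

namespace Pullback

/-- By `curv_law` the two curvature endomorphisms are conjugate under the differential of `T`, and
conjugate endomorphisms have the same trace. -/
lemma ricci_law (h : Pullback T G G' y) (u v : Eu n) :
    bil (Matrix.of fun i j => ricciCoord G i j y) u v =
      bil (Matrix.of fun i j => ricciCoord G' i j (T y)) (fderiv ℝ T y u) (fderiv ℝ T y v) := by
  rw [bil_ricci h.metric h.mem, bil_ricci h.metric' h.mem']
  have h1 := trace_eq_sum (curvL G y v u)
  have h2 := trace_eq_sum (curvL G' (T y) (fderiv ℝ T y v) (fderiv ℝ T y u))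
  have h3 : h.equiv.conj (curvL G y v u) =
      curvL G' (T y) (fderiv ℝ T y v) (fderiv ℝ T y u) := by
    refine LinearMap.ext fun s' => ?_
    obtain ⟨s, rfl⟩ := h.equiv.surjective s'
    rw [LinearEquiv.conj_apply_apply, LinearEquiv.symm_apply_apply]
    exact h.curv_law s v u
  rw [← h3, LinearMap.trace_conj', h3] at h2
  exact h1.symm.trans h2

lemma scal_law (h : Pullback T G G' y) : scalCoord G y = scalCoord G' (T y) :=
  trG_congr_pullback h.metric.posDef.det_pos.ne' (fderiv ℝ T y).toLinearMap
    (fun u v => h.eq u v) fun u v => h.ricci_law u v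

end Pullback

lemma bil_hessian (hF : Smooth F y) (hy : y ∈ interior (HS n)) (u v : Eu n) :
    bil (Matrix.of fun i j => hessianCoord G F i j y) u v =
      fderiv ℝ (fderiv ℝ F) y u v - fderiv ℝ F y (gam G y u v) := by
  have hF' := hF.contDiffAt hy
  have hF2 : DifferentiableAt ℝ (fderiv ℝ F) y :=
    ContDiffAt.diffAt (hF'.fderiv_right (by simp))
  refine linear_ext (f := fun u => bil (Matrix.of fun i j => hessianCoord G F i j y) u v)
    (g := fun u => fderiv ℝ (fderiv ℝ F) y u v - fderiv ℝ F y (gam G y u v)) ?_ ?_ ?_ u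
  · constructor <;> intros <;> simp
  · constructor <;> intros <;> simp <;> ring
  intro i
  refine linear_ext (f := fun v => bil (Matrix.of fun i j => hessianCoord G F i j y) (bv i) v)
    (g := fun v => fderiv ℝ (fderiv ℝ F) y (bv i) v - fderiv ℝ F y (gam G y (bv i) v)) ?_ ?_ ?_ v
  · constructor <;> intros <;> simp
  · constructor <;> intros <;> simp <;> ring
  intro j
  rw [bil_bv, Matrix.of_apply]
  unfold hessianCoord
  congr 1
  · have e : pderiv j F =ᶠ[𝓝[HS n] y] fun z => fderiv ℝ F z (bv j) := by
      rw [nhdsWithin_HS hy]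
      filter_upwards [isOpen_interior.mem_nhds hy] with z hz
      exact pderiv_eq_fderiv hz
    rw [pderiv_congr (interior_subset hy) e, pderiv_eq_fderiv hy,
      fderiv_clm_apply hF2 (by fun_prop)]
    simp
  · have e : gam G y (bv i) (bv j) = ∑ k, christoffel G k i j y • bv k := by
      ext m
      simp [gam_bv, Pi.single_apply]
    rw [e, map_sum]
    refine Finset.sum_congr rfl fun k _ => ?_
    rw [map_smul, pderiv_eq_fderiv hy, smul_eq_mul]

namespace Pullback

variable (h : Pullback T G G' y) (hF' : Smooth F' (T y)) (hF : F =ᶠ[𝓝 y] F' ∘ T)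
include h hF' hF

lemma smooth_comp : Smooth F y :=
  (((hF'.contDiffAt h.mem').comp y h.contDiffAt).congr_of_eventuallyEq hF).contDiffWithinAt

lemma fderiv_comp (u : Eu n) : fderiv ℝ F y u = fderiv ℝ F' (T y) (fderiv ℝ T y u) := by
  rw [hF.fderiv_eq (𝕜 := ℝ), _root_.fderiv_comp y (ContDiffAt.diffAt (hF'.contDiffAt h.mem'))
    (ContDiffAt.diffAt h.contDiffAt)]
  rfl

/-- The second derivative of `T` produced by the chain rule cancels the inhomogeneous term of
`gam_law`. -/
lemma hessian_law (u v : Eu n) :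
    bil (Matrix.of fun i j => hessianCoord G F i j y) u v =
      bil (Matrix.of fun i j => hessianCoord G' F' i j (T y))
        (fderiv ℝ T y u) (fderiv ℝ T y v) := by
  rw [bil_hessian (h.smooth_comp hF' hF) h.mem, bil_hessian hF' h.mem',
    h.fderiv_comp hF' hF, h.gam_law, map_add]
  have hF1 := hF'.contDiffAt h.mem'
  have hT := ContDiffAt.diffAt h.contDiffAt
  have hT2 := ContDiffAt.diffAt h.fderiv_contDiffAt
  have hF2 : DifferentiableAt ℝ (fderiv ℝ F') (T y) :=
    ContDiffAt.diffAt (hF1.fderiv_right (by simp))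
  have hc : HasFDerivAt (fun z => fderiv ℝ F' (T z))
      ((fderiv ℝ (fderiv ℝ F') (T y)).comp (fderiv ℝ T y)) y :=
    HasFDerivAt.comp y hF2.hasFDerivAt hT.hasFDerivAt
  have hF1e : ∀ᶠ z in 𝓝 (T y), DifferentiableAt ℝ F' z := by
    have h1 : ContDiffAt ℝ 1 F' (T y) := hF1.of_le (by norm_cast)
    exact (h1.eventually (by simp)).mono fun z hz => hz.differentiableAt (by simp)
  have e : (fun z => fderiv ℝ F z v) =ᶠ[𝓝 y] fun z => fderiv ℝ F' (T z) (fderiv ℝ T z v) := by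
    filter_upwards [hF.eventuallyEq_nhds, h.eventually,
      hT.continuousAt.eventually hF1e] with z hz hz' hz''
    rw [hz.fderiv_eq (𝕜 := ℝ), _root_.fderiv_comp z hz'' (ContDiffAt.diffAt hz'.contDiffAt)]
    rfl
  have e2 := DFunLike.congr_fun (e.fderiv_eq (𝕜 := ℝ)) u
  have hFF : DifferentiableAt ℝ (fderiv ℝ F) y :=
    ContDiffAt.diffAt (((h.smooth_comp hF' hF).contDiffAt h.mem).fderiv_right (by simp))
  rw [fderiv_clm_apply hFF (by fun_prop),
    fderiv_clm_apply hc.differentiableAt (hT2.clm_apply (by fun_prop)), hc.fderiv,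
    fderiv_clm_apply hT2 (by fun_prop)] at e2
  simp at e2
  rw [e2]
  ring

lemma lap_law : lapCoord G F y = lapCoord G' F' (T y) :=
  trG_congr_pullback h.metric.posDef.det_pos.ne' (fderiv ℝ T y).toLinearMap
    (fun u v => h.eq u v) fun u v => h.hessian_law hF' hF u v

lemma gradSq_law : gradSqCoord G F y = gradSqCoord G' F' (T y) := by
  refine trG_congr_pullback h.metric.posDef.det_pos.ne' (fderiv ℝ T y).toLinearMap
    (fun u v => h.eq u v) fun u v => ?_
  have key : ∀ (K : Eu n → ℝ) (z : Eu n), z ∈ interior (HS n) → ∀ u v : Eu n,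
      bil (Matrix.of fun i j => pderiv i K z * pderiv j K z) u v =
        fderiv ℝ K z u * fderiv ℝ K z v := by
    intro K z hz u v
    have hu : ∀ u : Eu n, fderiv ℝ K z u = ∑ i, u i * pderiv i K z := by
      intro u
      refine linear_ext (f := fun u => fderiv ℝ K z u) (g := fun u => ∑ i, u i * pderiv i K z)
        ?_ ?_ ?_ u
      · constructor <;> intros <;> simp
      · constructor <;> intros <;>
          simp [add_mul, Finset.sum_add_distrib, Finset.mul_sum, mul_assoc]
      · intro i
        simp [Pi.single_apply, pderiv_eq_fderiv hz]
    rw [hu, hu, Finset.sum_mul_sum, bil_apply]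
    exact Finset.sum_congr rfl fun i _ => Finset.sum_congr rfl fun j _ => by
      simp only [Matrix.of_apply]; ring
  rw [key F y h.mem, key F' (T y) h.mem', h.fderiv_comp hF' hF, h.fderiv_comp hF' hF]
  rfl

end Pullback

end TensorLaws

end ConformalStatic
end

open scoped Manifold ContDiff
noncomputable section
namespace ConformalStatic
open Filter Topology

/-! ### Orthonormal frames of a positive definite form -/

section Frames

variable {n : ℕ}

/-- A positive definite form has an orthonormal frame. -/
lemma exists_orthonormal_frame {A : Matrix (Fin n) (Fin n) ℝ} (hA : A.PosDef) :
    ∃ L : Eu n →L[ℝ] Eu n, ∀ u v, bil A (L u) (L v) = bil 1 u v := by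
  have hH : A.IsHermitian := hA.isHermitian
  set b := hH.eigenvectorBasis
  set l := hH.eigenvalues
  have hl : ∀ i, 0 < l i := hA.eigenvalues_pos
  -- The frame consists of the eigenvectors of `A`, divided by the square roots of their
  -- eigenvalues.
  refine ⟨∑ i, (EuclideanSpace.proj i : Eu n →L[ℝ] ℝ).smulRight ((Real.sqrt (l i))⁻¹ • b i), ?_⟩
  set L : Eu n →L[ℝ] Eu n :=
    ∑ i, (EuclideanSpace.proj i : Eu n →L[ℝ] ℝ).smulRight ((Real.sqrt (l i))⁻¹ • b i) with hL
  have hLb : ∀ i, L (bv i) = (Real.sqrt (l i))⁻¹ • b i := by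
    intro i
    simp [hL, sum_apply, Pi.single_apply]
  intro u v
  refine linear_ext (f := fun u => bil A (L u) (L v)) (g := fun u => bil 1 u v) ?_ ?_ ?_ u
  · constructor <;> intros <;> simp
  · constructor <;> intros <;> simp
  intro i
  refine linear_ext (f := fun v => bil A (L (bv i)) (L v)) (g := fun v => bil 1 (bv i) v)
    ?_ ?_ ?_ v
  · constructor <;> intros <;> simp
  · constructor <;> intros <;> simp
  intro j
  rw [bil_bv, hLb, hLb, map_smul, map_smul, smul_apply, bil_dotProduct]
  have h1 : A.mulVec (b j) = l j • (b j : Fin n → ℝ) := hH.mulVec_eigenvectorBasis j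
  have h2 : dotProduct (b i : Fin n → ℝ) (b j) = if i = j then 1 else 0 := by
    have := (orthonormal_iff_ite.1 b.orthonormal) j i
    rw [EuclideanSpace.inner_eq_star_dotProduct] at this
    simpa [eq_comm] using this
  rw [h1, dotProduct_smul, h2, Matrix.one_apply]
  split_ifs with hij
  · subst hij
    have := Real.mul_self_sqrt (hl i).le
    have hs := Real.sqrt_pos.2 (hl i)
    simp only [smul_eq_mul]
    field_simp
    nlinarith
  · simp

lemma trG_one (B : Fin n → Fin n → ℝ) : trG 1 B = ∑ i, B i i := by
  simp [trG, Matrix.one_apply]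

lemma exists_trG_eq_sum {A : Matrix (Fin n) (Fin n) ℝ} (hA : A.PosDef) :
    ∃ L : Eu n →L[ℝ] Eu n, (∀ u v, bil A (L u) (L v) = bil 1 u v) ∧
      ∀ B : Fin n → Fin n → ℝ,
        trG A B = ∑ i, bil (Matrix.of B) (L (bv i)) (L (bv i)) := by
  obtain ⟨L, hL⟩ := exists_orthonormal_frame hA
  refine ⟨L, hL, fun B => ?_⟩
  rw [← trG_one fun i j => bil (Matrix.of B) (L (bv i)) (L (bv j))]
  symm
  refine trG_congr_pullback (by simp) L.toLinearMap (fun u v => (hL u v).symm) fun u v => ?_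
  refine linear_ext (f := fun u => bil (Matrix.of fun i j => bil (Matrix.of B)
    (L (bv i)) (L (bv j))) u v) (g := fun u => bil (Matrix.of B) (L u) (L v)) ?_ ?_ ?_ u
  · constructor <;> intros <;> simp
  · constructor <;> intros <;> simp
  intro i
  refine linear_ext (f := fun v => bil (Matrix.of fun i j => bil (Matrix.of B)
    (L (bv i)) (L (bv j))) (bv i) v) (g := fun v => bil (Matrix.of B) (L (bv i)) (L v)) ?_ ?_ ?_ v
  · constructor <;> intros <;> simp
  · constructor <;> intros <;> simp
  intro j
  rw [bil_bv]; rfl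

lemma trG_nonneg {A : Matrix (Fin n) (Fin n) ℝ} (hA : A.PosDef) {B : Fin n → Fin n → ℝ}
    (hB : ∀ u, 0 ≤ bil (Matrix.of B) u u) : 0 ≤ trG A B := by
  obtain ⟨L, -, hL⟩ := exists_trG_eq_sum hA
  rw [hL]
  exact Finset.sum_nonneg fun i _ => hB _

end Frames

/-! ### Normal coordinates to first order -/

section NormalCoordinates

variable {n : ℕ} [NeZero n]

/-- The pull-back of a coordinate metric. -/
def pullMetric (T : Eu n → Eu n) (G : Eu n → Matrix (Fin n) (Fin n) ℝ) (z : Eu n) :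
    Matrix (Fin n) (Fin n) ℝ :=
  Matrix.of fun i j => bil (G (T z)) (fderiv ℝ T z (bv i)) (fderiv ℝ T z (bv j))

lemma bil_pullMetric (T : Eu n → Eu n) (G : Eu n → Matrix (Fin n) (Fin n) ℝ) (z u v : Eu n) :
    bil (pullMetric T G z) u v = bil (G (T z)) (fderiv ℝ T z u) (fderiv ℝ T z v) := by
  refine linear_ext (f := fun u => bil (pullMetric T G z) u v)
    (g := fun u => bil (G (T z)) (fderiv ℝ T z u) (fderiv ℝ T z v)) ?_ ?_ ?_ u
  · constructor <;> intros <;> simp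
  · constructor <;> intros <;> simp
  intro i
  refine linear_ext (f := fun v => bil (pullMetric T G z) (bv i) v)
    (g := fun v => bil (G (T z)) (fderiv ℝ T z (bv i)) (fderiv ℝ T z v)) ?_ ?_ ?_ v
  · constructor <;> intros <;> simp
  · constructor <;> intros <;> simp
  intro j
  rw [bil_bv]; rfl

lemma pullback_pullMetric {T : Eu n → Eu n} {G : Eu n → Matrix (Fin n) (Fin n) ℝ} {p : Eu n}
    (hp : p ∈ interior (HS n)) (hTp : T p ∈ interior (HS n)) (hG : MetricAt G (T p))
    (hT : ContDiff ℝ ∞ T) (hinj : Function.Injective (fderiv ℝ T p)) :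
    Pullback T (pullMetric T G) G p := by
  have hTc : Continuous T := hT.continuous
  have h1 : ∀ᶠ z in 𝓝 p, z ∈ interior (HS n) := isOpen_interior.mem_nhds hp
  have h2 : ∀ᶠ z in 𝓝 p, T z ∈ interior (HS n) :=
    hTc.continuousAt.eventually (isOpen_interior.mem_nhds hTp)
  have h3 : ∀ᶠ z in 𝓝 p, MetricAt G (T z) := by
    have := hG.eventually
    rw [nhdsWithin_HS hTp] at this
    exact hTc.continuousAt.eventually this
  have h4 : ∀ᶠ z in 𝓝 p, Function.Injective (fderiv ℝ T z) := by
    -- Invertible operators form an open set, so the differential stays injective near `p`.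
    let e : Eu n ≃L[ℝ] Eu n :=
      (LinearEquiv.ofInjectiveEndo (fderiv ℝ T p).toLinearMap hinj).toContinuousLinearEquiv
    have he : (e : Eu n →L[ℝ] Eu n) = fderiv ℝ T p := by ext u; rfl
    have hn := ContinuousLinearEquiv.nhds e
    rw [he] at hn
    have hc : Continuous (fderiv ℝ T) := hT.continuous_fderiv (by simp)
    filter_upwards [hc.continuousAt.eventually hn] with z hz
    obtain ⟨e', he'⟩ := hz
    rw [← he']
    exact e'.injective
  have h5 : ∀ᶠ z in 𝓝 p, (∀ i j, Smooth (fun w => pullMetric T G w i j) z) ∧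
      (pullMetric T G z).PosDef := by
    filter_upwards [h2, h3, h4] with z hz2 hz3 hz4
    constructor
    · intro i j
      have hb := (hz3.bil_contDiffAt hz2).comp z hT.contDiffAt
      have hd : ContDiffAt ℝ ∞ (fderiv ℝ T) z := (hT.contDiffAt).fderiv_right (by simp)
      exact ((hb.clm_apply (hd.clm_apply contDiffAt_const)).clm_apply
        (hd.clm_apply contDiffAt_const)).contDiffWithinAt
    · refine Matrix.PosDef.of_dotProduct_mulVec_pos ?_ ?_
      · ext i j
        simp only [pullMetric, Matrix.conjTranspose_apply, Matrix.of_apply, star_trivial]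
        exact bil_symm hz3.symm _ _
      · intro x hx
        have hb := bil_dotProduct (pullMetric T G z) (WithLp.toLp 2 x) (WithLp.toLp 2 x)
        rw [bil_pullMetric] at hb
        simp only [star_trivial]
        rw [← hb]
        refine bil_pos hz3.posDef fun h0 => hx ?_
        have := hz4 (h0.trans (map_zero _).symm)
        simpa using this
  filter_upwards [h1, h2, h3, h5, eventually_eventually_nhds.2 h5] with z hz1 hz2 hz3 hz4 hz5
  refine ⟨hz1, hz2, hT.contDiffAt, ⟨interior_subset hz1, ?_⟩, hz3,
    fun u v => bil_pullMetric T G z u v⟩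
  rw [nhdsWithin_HS hz1]
  exact hz5

lemma exists_normal_coordinates {G : Eu n → Matrix (Fin n) (Fin n) ℝ} {p : Eu n}
    (h : MetricAt G p) (hp : p ∈ interior (HS n)) :
    ∃ (T : Eu n → Eu n) (G' : Eu n → Matrix (Fin n) (Fin n) ℝ), T p = p ∧ ContDiff ℝ ∞ T ∧
      Pullback T G' G p ∧ G' p = 1 ∧ ∀ s i j, pderiv s (fun z => G' z i j) p = 0 := by
  obtain ⟨L, hL⟩ := exists_orthonormal_frame h.posDef
  set Γ := gam G p with hΓ
  -- `L` makes the metric the identity at `p`. The quadratic term has second derivative `-Γ(L u, L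
  -- v)`, exactly what `gam_law` requires for the new Christoffel symbols to vanish at `p`; no
  -- exponential map is needed.
  let T : Eu n → Eu n := fun y => p + L (y - p) - (1 / 2 : ℝ) • Γ (L (y - p)) (L (y - p))
  have hT : ContDiff ℝ ∞ T := by
    have h1 : ContDiff ℝ ∞ fun y : Eu n => L (y - p) := by fun_prop
    exact (contDiff_const.add h1).sub
      (((Γ.contDiff.comp h1).clm_apply h1).const_smul (1 / 2 : ℝ))
  have hd : ∀ y, HasFDerivAt T (L - (Γ (L (y - p))).comp L) y := by
    intro y
    have h1 : HasFDerivAt (fun y : Eu n => L (y - p)) L y := by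
      have h0 := L.hasFDerivAt.comp y ((hasFDerivAt_id y).sub_const p)
      rwa [ContinuousLinearMap.comp_id] at h0
    have h2 : HasFDerivAt (fun y : Eu n => Γ (L (y - p))) (Γ.comp L) y :=
      Γ.hasFDerivAt.comp y h1
    have h3 := ((h1.const_add p).sub ((h2.clm_apply h1).const_smul (1 / 2 : ℝ)))
    refine h3.congr_fderiv ?_
    ext1 u
    have hs : Γ (L u) (L (y - p)) = Γ (L (y - p)) (L u) := gam_symm h _ _
    simp [-map_sub, hs, ← two_smul ℝ, smul_smul]
  have hfd : fderiv ℝ T = fun y => L - (Γ (L (y - p))).comp L := funext fun y => (hd y).fderiv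
  have hTp : T p = p := by simp [T]
  have hLp : fderiv ℝ T p = L := by rw [hfd]; simp
  have hinj : Function.Injective (fderiv ℝ T p) := by
    rw [hLp, injective_iff_map_eq_zero]
    intro u hu
    by_contra hne
    have h1 := bil_pos (Matrix.PosDef.one (n := Fin n) (R := ℝ)) hne
    rw [← hL, hu] at h1
    simp at h1
  have hpb : Pullback T (pullMetric T G) G p :=
    pullback_pullMetric hp (by rwa [hTp]) (by rwa [hTp]) hT hinj
  have hsec : ∀ u v, fderiv ℝ (fderiv ℝ T) p u v = - Γ (L u) (L v) := by
    intro u v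
    have h1 : (fun z => fderiv ℝ T z v) = fun z => L v - Γ (L (z - p)) (L v) := by
      rw [hfd]; rfl
    have h2 : fderiv ℝ (fun z => fderiv ℝ T z v) p u = fderiv ℝ (fderiv ℝ T) p u v := by
      rw [fderiv_clm_apply (ContDiffAt.diffAt hpb.fderiv_contDiffAt) (by fun_prop)]
      simp
    rw [← h2, h1]
    have h3 : HasFDerivAt (fun z : Eu n => L (z - p)) L p := by
      have h0 := L.hasFDerivAt.comp p ((hasFDerivAt_id p).sub_const p)
      rwa [ContinuousLinearMap.comp_id] at h0
    have h4 := ((Γ.hasFDerivAt.comp p h3).clm_apply (hasFDerivAt_const (L v) p)).const_sub (L v)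
    have h5 := DFunLike.congr_fun h4.fderiv u
    refine h5.trans ?_
    simp
  have hgam : ∀ u v, gam (pullMetric T G) p u v = 0 := by
    intro u v
    have h1 := hpb.gam_law u v
    rw [hsec, hTp, hLp, ← hΓ, neg_add_cancel, ← hLp] at h1
    exact hinj (h1.trans (map_zero _).symm)
  refine ⟨T, pullMetric T G, hTp, hT, hpb, ?_, ?_⟩
  · ext i j
    rw [← bil_bv (1 : Matrix (Fin n) (Fin n) ℝ) i j, ← hL]
    simp only [pullMetric, Matrix.of_apply, hTp, hLp]
  · intro s i j
    -- With vanishing Christoffel symbols, the sum of the two Koszul identities obtained by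
    -- exchanging `i` and `j` is twice the wanted derivative.
    have k1 := koszul hpb.metric hp (bv s) (bv i) (bv j)
    have k2 := koszul hpb.metric hp (bv s) (bv j) (bv i)
    simp only [fderiv_bil_bv hpb.metric hp] at k1 k2
    rw [hgam] at k1 k2
    have e1 := pderiv_metric_symm hpb.metric s i j
    have e2 := pderiv_metric_symm hpb.metric i s j
    have e3 := pderiv_metric_symm hpb.metric j s i
    simp only [map_zero, zero_apply, mul_zero] at k1 k2
    linarith

end NormalCoordinates

end ConformalStatic
end

open scoped Manifold ContDiff
noncomputable section
namespace ConformalStatic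
open Filter Topology

/-! ### Curvature identities at the centre of normal coordinates -/

section NormalPoint

variable {n : ℕ} [NeZero n]

/-- `p` is the centre of normal coordinates for `G`. -/
structure NormalAt (G : Eu n → Matrix (Fin n) (Fin n) ℝ) (p : Eu n) : Prop where
  metric : MetricAt G p
  one : G p = 1
  deriv : ∀ s i j, pderiv s (fun z => G z i j) p = 0

namespace NormalAt

variable {G : Eu n → Matrix (Fin n) (Fin n) ℝ} {p : Eu n} (h : NormalAt G p)
include h

lemma mem : p ∈ HS n := h.metric.1

lemma christoffel_eq_zero (k i j : Fin n) : christoffel G k i j p = 0 := by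
  simp [christoffel, h.deriv]

/-- Lowering an index is invisible to first derivatives at the centre. Derivatives of the
Christoffel symbols can thus be read off from the symbols of the first kind, without differentiating
the inverse metric. -/
lemma pderiv_sum_mul {X : Fin n → Eu n → ℝ} (hX : ∀ k, Smooth (X k) p) (s m : Fin n) :
    pderiv s (fun z => ∑ k, G z m k * X k z) p = pderiv s (X m) p := by
  rw [pderiv_sum h.mem fun k => ((h.metric.smooth m k).mul (hX k)).diff]
  have : ∀ k, pderiv s (fun z => G z m k * X k z) p =
      (1 : Matrix (Fin n) (Fin n) ℝ) m k * pderiv s (X k) p := by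
    intro k
    rw [pderiv_mul h.mem (h.metric.smooth m k).diff (hX k).diff, h.deriv, h.one]
    ring
  simp [this, Matrix.one_apply]

/-- At second order the second derivatives of the metric enter, multiplied by `X k p`; hence the
vanishing hypothesis, which Christoffel symbols satisfy. -/
lemma pderiv_pderiv_sum_mul {X : Fin n → Eu n → ℝ} (hX : ∀ k, Smooth (X k) p)
    (hX0 : ∀ k, X k p = 0) (s t m : Fin n) :
    pderiv s (pderiv t fun z => ∑ k, G z m k * X k z) p = pderiv s (pderiv t (X m)) p := by
  have hG := h.metric.smooth
  have e : pderiv t (fun z => ∑ k, G z m k * X k z) =ᶠ[𝓝[HS n] p]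
      fun z => ∑ k, (G z m k * pderiv t (X k) z + pderiv t (fun w => G w m k) z * X k z) := by
    have h1 : ∀ᶠ z in 𝓝[HS n] p, ∀ k, DifferentiableWithinAt ℝ (X k) (HS n) z :=
      eventually_all.2 fun k => (hX k).eventually_diff h.mem
    have h2 : ∀ᶠ z in 𝓝[HS n] p, ∀ k, DifferentiableWithinAt ℝ (fun w => G w m k) (HS n) z :=
      eventually_all.2 fun k => (hG m k).eventually_diff h.mem
    filter_upwards [h1, h2, self_mem_nhdsWithin] with z hz1 hz2 hz
    rw [pderiv_sum hz fun k => (hz2 k).fun_mul (hz1 k)]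
    exact Finset.sum_congr rfl fun k _ => pderiv_mul hz (hz2 k) (hz1 k)
  rw [pderiv_congr h.mem e, pderiv_sum h.mem fun k =>
    (((hG m k).mul ((hX k).pderiv h.mem t)).add (((hG m k).pderiv h.mem t).mul (hX k))).diff]
  have : ∀ k, pderiv s (fun z => G z m k * pderiv t (X k) z +
      pderiv t (fun w => G w m k) z * X k z) p =
      (1 : Matrix (Fin n) (Fin n) ℝ) m k * pderiv s (pderiv t (X k)) p := by
    intro k
    rw [pderiv_add h.mem ((hG m k).mul ((hX k).pderiv h.mem t)).diff
        (((hG m k).pderiv h.mem t).mul (hX k)).diff,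
      pderiv_mul h.mem (hG m k).diff ((hX k).pderiv h.mem t).diff,
      pderiv_mul h.mem ((hG m k).pderiv h.mem t).diff (hX k).diff, h.deriv, h.deriv, h.one, hX0]
    ring
  simp [this, Matrix.one_apply]

lemma pderiv_inv (s i j : Fin n) : pderiv s (fun z => (G z)⁻¹ i j) p = 0 := by
  rw [← h.pderiv_sum_mul (X := fun k z => (G z)⁻¹ k j) (fun k => h.metric.inv_smooth k j)]
  have e : (fun z => ∑ k, G z i k * (G z)⁻¹ k j) =ᶠ[𝓝[HS n] p]
      fun _ => (1 : Matrix (Fin n) (Fin n) ℝ) i j := by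
    filter_upwards [h.metric.eventually] with z hz
    rw [← Matrix.mul_apply, Matrix.mul_nonsing_inv _ hz.posDef.det_pos.ne'.isUnit]
  rw [pderiv_congr h.mem e, pderiv_const]

lemma pderiv_trG {B : Fin n → Fin n → Eu n → ℝ} (hB : ∀ i j, Smooth (B i j) p) (s : Fin n) :
    pderiv s (fun z => trG (G z) fun i j => B i j z) p = ∑ i, pderiv s (B i i) p := by
  unfold trG
  have hI := h.metric.inv_smooth
  rw [pderiv_sum h.mem fun i => (Smooth.sum fun j => (hI i j).mul (hB i j)).diff]
  refine Finset.sum_congr rfl fun i _ => ?_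
  rw [pderiv_sum h.mem fun j => ((hI i j).mul (hB i j)).diff]
  have : ∀ j, pderiv s (fun z => (G z)⁻¹ i j * B i j z) p =
      (1 : Matrix (Fin n) (Fin n) ℝ) i j * pderiv s (B i j) p := by
    intro j
    rw [pderiv_mul h.mem (hI i j).diff (hB i j).diff, h.pderiv_inv, h.one, inv_one]
    ring
  simp [this, Matrix.one_apply]

lemma trG_eq (B : Fin n → Fin n → ℝ) : trG (G p) B = ∑ i, B i i := by
  rw [h.one, trG_one]

lemma pderiv_christoffel (s m i j : Fin n) :
    pderiv s (christoffel G m i j) p = (1 / 2) *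
      (pderiv s (pderiv i fun z => G z j m) p + pderiv s (pderiv j fun z => G z i m) p -
        pderiv s (pderiv m fun z => G z i j) p) := by
  have hG := fun i j t => (h.metric.smooth i j).pderiv h.mem t
  rw [← h.pderiv_sum_mul (X := fun k z => christoffel G k i j z)
    (fun k => h.metric.christoffel_smooth k i j)]
  rw [pderiv_congr h.mem (h.metric.eventually.mono fun z hz => hz.sum_mul_christoffel m i j),
    pderiv_const_mul h.mem _ (((hG _ _ _).add (hG _ _ _)).sub (hG _ _ _)).diff,
    pderiv_sub h.mem ((hG _ _ _).add (hG _ _ _)).diff (hG _ _ _).diff,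
    pderiv_add h.mem (hG _ _ _).diff (hG _ _ _).diff]

lemma pderiv_pderiv_christoffel (s t m i j : Fin n) :
    pderiv s (pderiv t (christoffel G m i j)) p = (1 / 2) *
      (pderiv s (pderiv t (pderiv i fun z => G z j m)) p +
        pderiv s (pderiv t (pderiv j fun z => G z i m)) p -
        pderiv s (pderiv t (pderiv m fun z => G z i j)) p) := by
  have hG := fun i j t => (h.metric.smooth i j).pderiv h.mem t
  have hG2 := fun i j t s => ((h.metric.smooth i j).pderiv h.mem t).pderiv h.mem s
  rw [← h.pderiv_pderiv_sum_mul (X := fun k z => christoffel G k i j z)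
    (fun k => h.metric.christoffel_smooth k i j) (fun k => h.christoffel_eq_zero k i j)]
  have e : (pderiv t fun z => ∑ k, G z m k * christoffel G k i j z) =ᶠ[𝓝[HS n] p]
      fun z => (1 / 2) * (pderiv t (pderiv i fun z => G z j m) z +
        pderiv t (pderiv j fun z => G z i m) z - pderiv t (pderiv m fun z => G z i j) z) := by
    refine (pderiv_eventuallyEq
      (h.metric.eventually.mono fun z hz => hz.sum_mul_christoffel m i j)).trans ?_
    filter_upwards [h.metric.eventually] with z hz
    have hG := fun i j t => (hz.smooth i j).pderiv hz.1 t
    rw [pderiv_const_mul hz.1 _ (((hG _ _ _).add (hG _ _ _)).sub (hG _ _ _)).diff,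
      pderiv_sub hz.1 ((hG _ _ _).add (hG _ _ _)).diff (hG _ _ _).diff,
      pderiv_add hz.1 (hG _ _ _).diff (hG _ _ _).diff]
  rw [pderiv_congr h.mem e,
    pderiv_const_mul h.mem _ (((hG2 _ _ _ _).add (hG2 _ _ _ _)).sub (hG2 _ _ _ _)).diff,
    pderiv_sub h.mem ((hG2 _ _ _ _).add (hG2 _ _ _ _)).diff (hG2 _ _ _ _).diff,
    pderiv_add h.mem (hG2 _ _ _ _).diff (hG2 _ _ _ _).diff]

lemma ricci_eq (i j : Fin n) : ricciCoord G i j p =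
    ∑ k, (pderiv k (christoffel G k i j) p - pderiv j (christoffel G k i k) p) := by
  simp [ricciCoord, h.christoffel_eq_zero]

/-- The part of the Ricci tensor quadratic in the Christoffel symbols vanishes to second order at
the centre. -/
lemma pderiv_ricci (s i j : Fin n) : pderiv s (ricciCoord G i j) p =
    ∑ k, (pderiv s (pderiv k (christoffel G k i j)) p -
      pderiv s (pderiv j (christoffel G k i k)) p) := by
  have hc := h.metric.christoffel_smooth
  have hc1 := fun k i j t => (hc k i j).pderiv h.mem t
  have hq : ∀ k l, Smooth (fun y => christoffel G k k l y * christoffel G l i j y -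
      christoffel G k j l y * christoffel G l i k y) p := fun k l =>
    ((hc _ _ _).mul (hc _ _ _)).sub ((hc _ _ _).mul (hc _ _ _))
  unfold ricciCoord
  rw [pderiv_add h.mem (Smooth.sum fun k => (hc1 _ _ _ _).sub (hc1 _ _ _ _)).diff
      (Smooth.sum fun k => Smooth.sum fun l => hq k l).diff,
    pderiv_sum h.mem fun k => ((hc1 _ _ _ _).sub (hc1 _ _ _ _)).diff,
    pderiv_sum h.mem fun k => (Smooth.sum fun l => hq k l).diff]
  have e1 : ∀ k, pderiv s (fun y => ∑ l, (christoffel G k k l y * christoffel G l i j y -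
      christoffel G k j l y * christoffel G l i k y)) p = 0 := by
    intro k
    rw [pderiv_sum h.mem fun l => (hq k l).diff]
    refine Finset.sum_eq_zero fun l _ => ?_
    rw [pderiv_sub h.mem ((hc _ _ _).mul (hc _ _ _)).diff ((hc _ _ _).mul (hc _ _ _)).diff,
      pderiv_mul h.mem (hc _ _ _).diff (hc _ _ _).diff,
      pderiv_mul h.mem (hc _ _ _).diff (hc _ _ _).diff]
    simp [h.christoffel_eq_zero]
  simp only [e1, Finset.sum_const_zero, add_zero]
  exact Finset.sum_congr rfl fun k _ => pderiv_sub h.mem (hc1 _ _ _ _).diff (hc1 _ _ _ _).diff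

lemma pderiv_hessian {F : Eu n → ℝ} (hF : Smooth F p) (s i j : Fin n) :
    pderiv s (hessianCoord G F i j) p = pderiv s (pderiv i (pderiv j F)) p -
      ∑ k, pderiv s (christoffel G k i j) p * pderiv k F p := by
  have hc := h.metric.christoffel_smooth
  have hF1 := fun k => hF.pderiv h.mem k
  unfold hessianCoord
  rw [pderiv_sub h.mem ((hF1 j).pderiv h.mem i).diff
    (Smooth.sum fun k => (hc k i j).mul (hF1 k)).diff,
    pderiv_sum h.mem fun k => ((hc k i j).mul (hF1 k)).diff]
  congr 1
  refine Finset.sum_congr rfl fun k _ => ?_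
  rw [pderiv_mul h.mem (hc k i j).diff (hF1 k).diff, h.christoffel_eq_zero]
  ring

lemma second_symm (a b i j : Fin n) :
    pderiv a (pderiv b fun z => G z i j) p = pderiv b (pderiv a fun z => G z i j) p :=
  pderiv_comm h.mem (h.metric.smooth i j)

lemma second_symm' (a b i j : Fin n) :
    pderiv a (pderiv b fun z => G z i j) p = pderiv a (pderiv b fun z => G z j i) p :=
  pderiv_congr h.mem (pderiv_eventuallyEq (h.metric.symm_eventually i j))

/-- The contracted second Bianchi identity. -/
lemma bianchi (j : Fin n) : 2 * ∑ i, pderiv i (ricciCoord G i j) p =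
    pderiv j (scalCoord G) p := by
  unfold scalCoord
  rw [h.pderiv_trG fun i j => h.metric.ricciCoord_smooth i j]
  simp only [h.pderiv_ricci, h.pderiv_pderiv_christoffel]
  -- Both sides are sums of third derivatives of the metric, symmetric in the three derivative
  -- indices and in the two metric indices. The identity then follows by permuting and renaming
  -- indices.
  set D : Fin n → Fin n → Fin n → Fin n → Fin n → ℝ := fun a b c i j =>
    pderiv a (pderiv b (pderiv c fun z => G z i j)) p with hD
  have s12 : ∀ a b c i j, D a b c i j = D b a c i j := fun a b c i j =>
    pderiv_comm h.mem ((h.metric.smooth i j).pderiv h.mem c)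
  have s23 : ∀ a b c i j, D a b c i j = D a c b i j := fun a b c i j =>
    pderiv_congr h.mem (h.metric.eventually.mono fun z hz => pderiv_comm hz.1 (hz.smooth i j))
  have sij : ∀ a b c i j, D a b c i j = D a b c j i := fun a b c i j =>
    pderiv_congr h.mem (pderiv_eventuallyEq (pderiv_eventuallyEq (h.metric.symm_eventually i j)))
  change 2 * ∑ i, ∑ k, ((1 / 2) * (D i k i j k + D i k j i k - D i k k i j) -
      (1 / 2) * (D i j i k k + D i j k i k - D i j k i k)) =
    ∑ i, ∑ k, ((1 / 2) * (D j k i i k + D j k i i k - D j k k i i) -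
      (1 / 2) * (D j i i k k + D j i k i k - D j i k i k))
  have e1 : ∑ i, ∑ k, D i k i j k = ∑ i, ∑ k, D i k k i j := by
    rw [Finset.sum_comm]
    exact Finset.sum_congr rfl fun i _ => Finset.sum_congr rfl fun k _ => by
      rw [s12, sij]
  have e2 : ∑ i, ∑ k, D j k k i i = ∑ i, ∑ k, D j i i k k := Finset.sum_comm
  have e3 : ∑ i, ∑ k, D i k j i k = ∑ i, ∑ k, D j k i i k :=
    Finset.sum_congr rfl fun i _ => Finset.sum_congr rfl fun k _ => by
      rw [s23, s12, s23]
  have e4 : ∑ i, ∑ k, D i j i k k = ∑ i, ∑ k, D j i i k k :=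
    Finset.sum_congr rfl fun i _ => Finset.sum_congr rfl fun k _ => s12 _ _ _ _ _
  simp only [Finset.sum_sub_distrib, Finset.sum_add_distrib, ← Finset.mul_sum, e1, e3, e4, e2]
  ring

/-- The scalar curvature of a static metric is locally constant. -/
lemma pderiv_scalCoord_eq_zero {F : Eu n → ℝ} (hF : Smooth F p) (hFp : F p ≠ 0)
    (hst : ∀ᶠ z in 𝓝[HS n] p, ∀ i j, F z * ricciCoord G i j z - hessianCoord G F i j z +
      lapCoord G F z * G z i j = 0) (j : Fin n) :
    pderiv j (scalCoord G) p = 0 := by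
  have hr := h.metric.ricciCoord_smooth
  have hh := h.metric.hessianCoord_smooth hF
  have hl := h.metric.lapCoord_smooth hF
  have hG := h.metric.smooth
  have d1 : ∀ s i j, pderiv s F p * ricciCoord G i j p + F p * pderiv s (ricciCoord G i j) p -
      pderiv s (hessianCoord G F i j) p +
      pderiv s (lapCoord G F) p * (1 : Matrix (Fin n) (Fin n) ℝ) i j = 0 := by
    intro s i j
    have e : (fun z => F z * ricciCoord G i j z - hessianCoord G F i j z +
      lapCoord G F z * G z i j) =ᶠ[𝓝[HS n] p] fun _ => 0 := hst.mono fun z hz => hz i j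
    have e2 := pderiv_congr (i := s) h.mem e
    rw [pderiv_const, pderiv_add h.mem ((hF.mul (hr i j)).sub (hh i j)).diff
        (hl.mul (hG i j)).diff, pderiv_sub h.mem (hF.mul (hr i j)).diff (hh i j).diff,
      pderiv_mul h.mem hF.diff (hr i j).diff, pderiv_mul h.mem hl.diff (hG i j).diff,
      h.deriv, h.one] at e2
    linarith
  have d2 : pderiv j (lapCoord G F) p = ∑ i, pderiv j (hessianCoord G F i i) p :=
    h.pderiv_trG (fun i j => hh i j) j
  -- This is the divergence of the static equation.
  have d3 := Finset.sum_eq_zero fun i (_ : i ∈ Finset.univ) => d1 i i j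
  rw [Finset.sum_add_distrib, Finset.sum_sub_distrib, Finset.sum_add_distrib,
    ← Finset.mul_sum] at d3
  have d4 : ∑ i, pderiv i (lapCoord G F) p * (1 : Matrix (Fin n) (Fin n) ℝ) i j =
      pderiv j (lapCoord G F) p := by simp [Matrix.one_apply]
  -- The Ricci identity `div ∇²F = d(ΔF) + Ric(∇F, ·)`. Subtracted from `d3` it leaves `F div Ric =
  -- 0`, and the Bianchi identity turns this into `F dR = 0`.
  have d5 : ∑ i, pderiv i F p * ricciCoord G i j p - ∑ i, pderiv i (hessianCoord G F i j) p +
      ∑ i, pderiv j (hessianCoord G F i i) p = 0 := by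
    have t : ∀ i, pderiv i (pderiv i (pderiv j F)) p = pderiv j (pderiv i (pderiv i F)) p := by
      intro i
      rw [pderiv_congr h.mem (K := pderiv j (pderiv i F)), pderiv_comm h.mem (hF.pderiv h.mem i)]
      have h1 : ContDiffWithinAt ℝ 3 F (HS n) p := ContDiffWithinAt.of_le hF (by norm_cast)
      have h2 := h1.eventually (by simp)
      rw [Set.insert_eq_of_mem h.mem] at h2
      filter_upwards [h2, self_mem_nhdsWithin] with z hz hz'
      exact pderiv_comm_of_two hz' (hz.of_le (by norm_num))
    have r : ∑ i, pderiv i F p * ricciCoord G i j p =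
        ∑ i, ∑ k, (pderiv i (christoffel G i k j) p - pderiv j (christoffel G i k i) p) *
          pderiv k F p := by
      rw [Finset.sum_comm]
      refine Finset.sum_congr rfl fun i _ => ?_
      rw [h.ricci_eq, Finset.mul_sum]
      exact Finset.sum_congr rfl fun k _ => by ring
    rw [r, ← Finset.sum_sub_distrib, ← Finset.sum_add_distrib]
    refine Finset.sum_eq_zero fun i _ => ?_
    rw [h.pderiv_hessian hF, h.pderiv_hessian hF, t i]
    have : ∑ k, ((pderiv i (christoffel G i k j) p - pderiv j (christoffel G i k i) p) *
          pderiv k F p + pderiv i (christoffel G k i j) p * pderiv k F p -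
          pderiv j (christoffel G k i i) p * pderiv k F p) = 0 := by
      refine Finset.sum_eq_zero fun k _ => ?_
      simp only [h.pderiv_christoffel]
      rw [h.second_symm j i i k, h.second_symm' i k j i, h.second_symm' i j k i,
        h.second_symm' i i k j, h.second_symm' j i k i, h.second_symm j i i k]
      ring
    rw [Finset.sum_sub_distrib, Finset.sum_add_distrib] at this
    linarith
  have d6 := h.bianchi j
  rw [d4, d2] at d3
  have d7 : F p * pderiv j (scalCoord G) p = 0 := by
    rw [← d6]; linarith
  exact (mul_eq_zero.1 d7).resolve_left hFp

end NormalAt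

end NormalPoint

end ConformalStatic
end

open scoped Manifold ContDiff
noncomputable section
namespace ConformalStatic
open Filter Topology

/-! ### Conformal changes and the static equation in coordinates -/

section Conformal

variable {n : ℕ} [NeZero n]

/-- At a normal point of `G`, the Christoffel symbols of `e^φ G` have the form `C` with `a = ∂φ`.
The sum is the trace of the quadratic part of their Ricci tensor, the source of the gradient term in
the conformal formula. -/
lemma sum_ite_quadratic (a : Fin n → ℝ) (C : Fin n → Fin n → Fin n → ℝ)
    (hC : ∀ k i j, C k i j = (1 / 2) * ((if j = k then 1 else 0) * a i +
      (if i = k then 1 else 0) * a j - (if i = j then 1 else 0) * a k)) :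
    ∑ i, ∑ k, ∑ l, (C k k l * C l i i - C k i l * C l i k) =
      -((n - 1) * (n - 2) / 4) * ∑ i, a i * a i := by
  have c1 : ∀ l, ∑ k, C k k l = n / 2 * a l := by
    intro l
    simp only [hC, ← Finset.mul_sum, Finset.sum_add_distrib, Finset.sum_sub_distrib]
    simp
    ring
  have c2 : ∀ l, ∑ i, C l i i = (2 - n) / 2 * a l := by
    intro l
    simp only [hC, ← Finset.mul_sum, Finset.sum_add_distrib, Finset.sum_sub_distrib]
    simp
    ring
  have t1 : ∑ i, ∑ k, ∑ l, C k k l * C l i i = ∑ l, (∑ k, C k k l) * ∑ i, C l i i := by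
    simp only [Finset.sum_mul_sum]
    rw [Finset.sum_comm]
    rw [Finset.sum_congr rfl fun k _ => Finset.sum_comm]
    rw [Finset.sum_comm]
  have t2 : ∑ i, ∑ k, ∑ l, C k i l * C l i k = (2 - n) / 4 * ∑ i, a i * a i := by
    have : ∀ i k l, C k i l * C l i k = (1 / 4) * ((if l = k then a i * a i else 0) -
        (if i = k then a l * a l else 0) + 2 * (if i = k then (if i = l then a l * a k else 0) else 0) -
        (if i = l then a k * a k else 0)) := by
      intro i k l
      rw [hC, hC]
      by_cases h2 : i = k
      · subst h2
        by_cases h1 : l = i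
        · subst h1; simp; ring
        · simp [h1, Ne.symm h1]; ring
      · by_cases h1 : l = k
        · subst h1; simp [h2, Ne.symm h2]; ring
        · by_cases h3 : i = l
          · subst h3; simp [h2, Ne.symm h2]; ring
          · simp [h1, h2, h3, Ne.symm h1, Ne.symm h2, Ne.symm h3]
    simp only [this, ← Finset.mul_sum, Finset.sum_add_distrib, Finset.sum_sub_distrib]
    simp [← Finset.mul_sum]
    ring
  simp only [Finset.sum_sub_distrib]
  rw [t1, t2]
  simp only [c1, c2]
  rw [show ∀ f : Fin n → ℝ, ∑ i, f i = ∑ i, f i from fun _ => rfl, Finset.mul_sum, Finset.mul_sum,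
    ← Finset.sum_sub_distrib]
  exact Finset.sum_congr rfl fun l _ => by ring

namespace NormalAt

variable {G K : Eu n → Matrix (Fin n) (Fin n) ℝ} {p : Eu n} {φ : Eu n → ℝ}

/-- The index is lowered with `G` instead of `K`: the factor `e^φ` then cancels, and
`pderiv_sum_mul` for `G` applies to the result. -/
lemma conformal_sum_christoffel (h : NormalAt G p) (hK : MetricAt K p) (hφ : Smooth φ p)
    (hGK : ∀ᶠ z in 𝓝[HS n] p, K z = Real.exp (φ z) • G z) (m i j : Fin n) :
    ∀ᶠ z in 𝓝[HS n] p, ∑ k, G z m k * christoffel K k i j z =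
      (1 / 2) * (pderiv i (fun z => G z j m) z + pderiv j (fun z => G z i m) z -
        pderiv m (fun z => G z i j) z + (pderiv i φ z * G z j m + pderiv j φ z * G z i m -
          pderiv m φ z * G z i j)) := by
  filter_upwards [h.metric.eventually, hK.eventually, hφ.eventually_diff h.mem,
    eventually_eventually_nhdsWithin.2 hGK, self_mem_nhdsWithin] with z hz1 hz2 hz3 hz4 hz5
  have hz6 := hz4.self_of_nhdsWithin hz5
  have hd : ∀ i a b, pderiv i (fun z => K z a b) z =
      Real.exp (φ z) * (pderiv i φ z * G z a b + pderiv i (fun z => G z a b) z) := by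
    intro i a b
    have e : (fun z => K z a b) =ᶠ[𝓝[HS n] z] fun z => Real.exp (φ z) * G z a b :=
      hz4.mono fun w hw => congrFun (congrFun hw a) b
    have e2 : pderiv i (fun z => Real.exp (φ z)) z = Real.exp (φ z) * pderiv i φ z := by
      unfold pderiv
      rw [fderivWithin_exp hz3 (uniqueDiffOn_HS z hz5)]
      rfl
    rw [pderiv_congr hz5 e, pderiv_mul hz5 hz3.exp (hz1.smooth a b).diff, e2]
    ring
  have k := hz2.sum_mul_christoffel m i j
  simp only [hd, hz6, Matrix.smul_apply, smul_eq_mul, mul_assoc] at k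
  rw [← Finset.mul_sum] at k
  have he := (Real.exp_pos (φ z)).ne'
  apply mul_left_cancel₀ he
  rw [k]
  ring

lemma conformal_scal (h : NormalAt G p) (hK : MetricAt K p) (hφ : Smooth φ p)
    (hGK : ∀ᶠ z in 𝓝[HS n] p, K z = Real.exp (φ z) • G z) :
    Real.exp (φ p) * scalCoord K p = scalCoord G p - (n - 1) * lapCoord G φ p -
      (n - 1) * (n - 2) / 4 * gradSqCoord G φ p := by
  have hGp := hGK.self_of_nhdsWithin h.mem
  have hc : ∀ m i j, christoffel K m i j p = (1 / 2) *
      ((if j = m then 1 else 0) * pderiv i φ p + (if i = m then 1 else 0) * pderiv j φ p -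
        (if i = j then 1 else 0) * pderiv m φ p) := by
    intro m i j
    have := (h.conformal_sum_christoffel hK hφ hGK m i j).self_of_nhdsWithin h.mem
    rw [h.one, h.deriv, h.deriv, h.deriv] at this
    simp only [Matrix.one_apply, ite_mul, one_mul, zero_mul, Finset.sum_ite_eq,
      Finset.mem_univ, if_true] at this
    rw [this]
    ring
  have hφ1 := fun i => hφ.pderiv h.mem i
  have hG := h.metric.smooth
  have hG1 := fun i j t => (hG i j).pderiv h.mem t
  have hdc : ∀ s m i j, pderiv s (christoffel K m i j) p =
      pderiv s (christoffel G m i j) p + (1 / 2) *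
      (pderiv s (pderiv i φ) p * (if j = m then 1 else 0) +
        pderiv s (pderiv j φ) p * (if i = m then 1 else 0) -
        pderiv s (pderiv m φ) p * (if i = j then 1 else 0)) := by
    intro s m i j
    rw [← h.pderiv_sum_mul (X := fun k z => christoffel K k i j z)
      (fun k => hK.christoffel_smooth k i j),
      pderiv_congr h.mem (h.conformal_sum_christoffel hK hφ hGK m i j)]
    have s1 := ((hG1 j m i).add (hG1 i m j)).sub (hG1 i j m)
    have s2 := (((hφ1 i).mul (hG j m)).add ((hφ1 j).mul (hG i m)))
    have s3 := (hφ1 m).mul (hG i j)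
    rw [pderiv_const_mul h.mem _ (s1.add (s2.sub s3)).diff,
      pderiv_add h.mem s1.diff (s2.sub s3).diff, pderiv_sub h.mem s2.diff s3.diff,
      pderiv_add h.mem ((hφ1 i).mul (hG j m)).diff ((hφ1 j).mul (hG i m)).diff,
      pderiv_sub h.mem ((hG1 j m i).add (hG1 i m j)).diff (hG1 i j m).diff,
      pderiv_add h.mem (hG1 j m i).diff (hG1 i m j).diff,
      pderiv_mul h.mem (hφ1 i).diff (hG j m).diff, pderiv_mul h.mem (hφ1 j).diff (hG i m).diff,
      pderiv_mul h.mem (hφ1 m).diff (hG i j).diff, h.deriv, h.deriv, h.deriv, h.one,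
      h.pderiv_christoffel]
    simp only [Matrix.one_apply]
    ring
  -- At the centre `K = e^φ · 1`, so the trace with respect to `K` is `e^{-φ}` times the Euclidean
  -- one.
  have hR : Real.exp (φ p) * scalCoord K p = ∑ i, ricciCoord K i i p := by
    have he := (Real.exp_pos (φ p)).ne'
    have hinv : (Real.exp (φ p) • (1 : Matrix (Fin n) (Fin n) ℝ))⁻¹ =
        (Real.exp (φ p))⁻¹ • 1 := by
      apply Matrix.inv_eq_right_inv
      rw [smul_mul_smul_comm, mul_inv_cancel₀ he, one_smul, one_mul]
    unfold scalCoord trG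
    rw [hGp, h.one, hinv, Finset.mul_sum]
    refine Finset.sum_congr rfl fun i _ => ?_
    rw [Finset.mul_sum]
    simp only [Matrix.smul_apply, smul_eq_mul, ← mul_assoc, mul_inv_cancel₀ he]
    simp [Matrix.one_apply]
  have hL : lapCoord G φ p = ∑ i, pderiv i (pderiv i φ) p := by
    unfold lapCoord
    rw [h.trG_eq]
    refine Finset.sum_congr rfl fun i _ => ?_
    simp [hessianCoord, h.christoffel_eq_zero]
  have hS : gradSqCoord G φ p = ∑ i, pderiv i φ p * pderiv i φ p := h.trG_eq _
  have hRG : scalCoord G p = ∑ i, ricciCoord G i i p := h.trG_eq _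
  rw [hR, hRG, hS, hL]
  have hq := sum_ite_quadratic (fun i => pderiv i φ p) (fun m i j => christoffel K m i j p) hc
  have hl : ∑ i, ∑ k, (pderiv k (christoffel K k i i) p - pderiv i (christoffel K k i k) p) =
      ∑ i, ricciCoord G i i p - (n - 1) * ∑ i, pderiv i (pderiv i φ) p := by
    simp only [h.ricci_eq, hdc]
    simp only [mul_ite, mul_one, mul_zero, Finset.sum_sub_distrib, Finset.sum_add_distrib,
      ← Finset.mul_sum]
    simp [← Finset.mul_sum]
    ring
  unfold ricciCoord at hl ⊢
  rw [Finset.sum_add_distrib, hl, hq]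
  ring

end NormalAt

variable {G K : Eu n → Matrix (Fin n) (Fin n) ℝ} {p : Eu n} {φ F : Eu n → ℝ}

lemma bil_matrix_ext {A B : Matrix (Fin n) (Fin n) ℝ} (h : ∀ u v, bil A u v = bil B u v) :
    A = B := by
  ext i j
  rw [← bil_bv A, h, bil_bv]

/-- The behaviour of the scalar curvature under a conformal change of the metric. -/
lemma conformal_scalCoord (hG : MetricAt G p) (hp : p ∈ interior (HS n)) (hK : MetricAt K p)
    (hφ : Smooth φ p) (hGK : ∀ᶠ z in 𝓝 p, K z = Real.exp (φ z) • G z) :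
    Real.exp (φ p) * scalCoord K p = scalCoord G p - (n - 1) * lapCoord G φ p -
      (n - 1) * (n - 2) / 4 * gradSqCoord G φ p := by
  obtain ⟨T, G', hTp, hT, hpb, h1, h2⟩ := exists_normal_coordinates hG hp
  have hN : NormalAt G' p := ⟨hpb.metric, h1, h2⟩
  -- The normal coordinates of `G` are used for both metrics. The pulled-back metrics are conformal
  -- with factor `e^{φ ∘ T}`, and all terms of the formula are scalar invariants.
  have hpk : Pullback T (pullMetric T K) K p :=
    pullback_pullMetric hp (by rwa [hTp]) (by rwa [hTp]) hT hpb.injective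
  have hφT : Smooth φ (T p) := by rwa [hTp]
  have hcomp : Smooth (φ ∘ T) p := hpb.smooth_comp hφT (EventuallyEq.refl _ _)
  have hc : ∀ᶠ z in 𝓝 p, pullMetric T K z = Real.exp ((φ ∘ T) z) • G' z := by
    have h3 : ∀ᶠ z in 𝓝 p, K (T z) = Real.exp (φ (T z)) • G (T z) := by
      have hTc : ContinuousAt T p := hT.continuous.continuousAt
      exact hTc.eventually (p := fun w => K w = Real.exp (φ w) • G w) (by rwa [hTp])
    filter_upwards [h3, hpb.eventually] with z hz hz'
    refine bil_matrix_ext fun u v => ?_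
    have : bil (Real.exp ((φ ∘ T) z) • G' z) u v = Real.exp (φ (T z)) * bil (G' z) u v := by
      simp [bil_apply, Finset.mul_sum, mul_assoc]
    rw [this, bil_pullMetric, hz, hz'.eq]
    simp [bil_apply, Finset.mul_sum, mul_assoc]
  have key := hN.conformal_scal hpk.metric hcomp (by rwa [nhdsWithin_HS hp])
  rw [hpk.scal_law, hpb.scal_law, hpb.lap_law hφT (EventuallyEq.refl _ _),
    hpb.gradSq_law hφT (EventuallyEq.refl _ _), hTp, Function.comp_apply, hTp] at key
  exact key

lemma bil_static (a c : ℝ) (R H B : Fin n → Fin n → ℝ) (u v : Eu n) :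
    bil (Matrix.of fun i j => a * R i j - H i j + c * B i j) u v =
      a * bil (Matrix.of R) u v - bil (Matrix.of H) u v + c * bil (Matrix.of B) u v := by
  simp only [bil_apply, Matrix.of_apply, Finset.mul_sum, ← Finset.sum_add_distrib,
    ← Finset.sum_sub_distrib]
  exact Finset.sum_congr rfl fun i _ => Finset.sum_congr rfl fun j _ => by ring

/-- The static equation in coordinates. -/
def StaticAt (G : Eu n → Matrix (Fin n) (Fin n) ℝ) (F : Eu n → ℝ) (z : Eu n) : Prop :=
  ∀ i j, F z * ricciCoord G i j z - hessianCoord G F i j z + lapCoord G F z * G z i j = 0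

lemma staticAt_iff {z : Eu n} : StaticAt G F z ↔ ∀ u v : Eu n,
    F z * bil (Matrix.of fun i j => ricciCoord G i j z) u v -
      bil (Matrix.of fun i j => hessianCoord G F i j z) u v + lapCoord G F z * bil (G z) u v = 0 := by
  have hb := fun u v => bil_static (F z) (lapCoord G F z) (fun i j => ricciCoord G i j z)
    (fun i j => hessianCoord G F i j z) (G z) u v
  constructor
  · intro h u v
    refine (hb u v).symm.trans ?_
    have : (Matrix.of fun i j => F z * ricciCoord G i j z - hessianCoord G F i j z +
        lapCoord G F z * G z i j) = 0 := by ext i j; exact h i j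
    rw [this]
    simp [bil_apply]
  · intro h i j
    have := (hb (bv i) (bv j)).trans (h _ _)
    rwa [bil_bv] at this

lemma Pullback.static_law {T : Eu n → Eu n} {G' : Eu n → Matrix (Fin n) (Fin n) ℝ}
    {F' : Eu n → ℝ} {y : Eu n} (h : Pullback T G G' y) (hF' : Smooth F' (T y))
    (hF : F =ᶠ[𝓝 y] F' ∘ T) (hst : StaticAt G' F' (T y)) : StaticAt G F y := by
  rw [staticAt_iff] at hst ⊢
  intro u v
  have := hst (fderiv ℝ T y u) (fderiv ℝ T y v)
  rwa [← h.ricci_law, ← h.hessian_law hF' hF, ← h.lap_law hF' hF, ← h.eq,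
    show F' (T y) = F y from hF.self_of_nhds.symm] at this

/-- The scalar curvature of a static metric has vanishing differential. -/
lemma fderiv_scalCoord_eq_zero (hG : MetricAt G p) (hp : p ∈ interior (HS n))
    (hF : ∀ᶠ z in 𝓝 p, Smooth F z) (hFp : F p ≠ 0) (hst : ∀ᶠ z in 𝓝 p, StaticAt G F z) :
    fderiv ℝ (scalCoord G) p = 0 := by
  obtain ⟨T, G', hTp, hT, hpb, h1, h2⟩ := exists_normal_coordinates hG hp
  have hN : NormalAt G' p := ⟨hpb.metric, h1, h2⟩
  have hTc : Tendsto T (𝓝 p) (𝓝 p) := by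
    have := hT.continuous.tendsto p
    rwa [hTp] at this
  have hst' : ∀ᶠ z in 𝓝 p, StaticAt G' (F ∘ T) z := by
    filter_upwards [hpb.eventually, hTc.eventually hst, hTc.eventually hF] with z hz hz' hz''
    exact hz.static_law hz'' (EventuallyEq.refl _ _) hz'
  have hFT : Smooth F (T p) := by rw [hTp]; exact hF.self_of_nhds
  have h0 := hN.pderiv_scalCoord_eq_zero (hpb.smooth_comp hFT (EventuallyEq.refl _ _))
    (by simpa [hTp] using hFp) (by rw [nhdsWithin_HS hp]; exact hst')
  have hs : scalCoord G' =ᶠ[𝓝 p] scalCoord G ∘ T :=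
    hpb.eventually.mono fun z hz => hz.scal_law
  have hsm : Smooth (scalCoord G) (T p) := by rw [hTp]; exact hG.scalCoord_smooth
  ext u
  -- The vanishing proved in normal coordinates transfers because the differential of `T` at `p` is
  -- onto.
  obtain ⟨w, rfl⟩ := hpb.surjective u
  have h3 := hpb.fderiv_comp hsm hs w
  rw [hTp] at h3
  rw [← h3]
  refine linear_ext (f := fun w => fderiv ℝ (scalCoord G') p w) (g := fun w => (0 : ℝ)) ?_ ?_ ?_ w
  · constructor <;> intros <;> simp
  · constructor <;> intros <;> simp
  intro j
  rw [← pderiv_eq_fderiv hp]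
  exact h0 j

/-- The trace of the static equation. -/
lemma StaticAt.trace (h : StaticAt G F p) (hG : MetricAt G p) :
    (n - 1) * lapCoord G F p = - (F p * scalCoord G p) := by
  have hu : IsUnit (G p).det := hG.posDef.det_pos.ne'.isUnit
  have h1 : ∑ i, ∑ j, (G p)⁻¹ i j * (F p * ricciCoord G i j p - hessianCoord G F i j p +
      lapCoord G F p * G p i j) = 0 :=
    Finset.sum_eq_zero fun i _ => Finset.sum_eq_zero fun j _ => by rw [h i j, mul_zero]
  have h2 : ∑ i, ∑ j, (G p)⁻¹ i j * G p i j = n := by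
    have : ∀ i, ∑ j, (G p)⁻¹ i j * G p i j = 1 := by
      intro i
      have e : ∑ j, (G p)⁻¹ i j * G p i j = ((G p)⁻¹ * G p) i i := by
        rw [Matrix.mul_apply]
        exact Finset.sum_congr rfl fun j _ => by rw [hG.symm i j]
      rw [e, Matrix.nonsing_inv_mul _ hu, Matrix.one_apply_eq]
    simp [this]
  have h3 : ∑ i, ∑ j, (G p)⁻¹ i j * (F p * ricciCoord G i j p - hessianCoord G F i j p +
      lapCoord G F p * G p i j) = F p * scalCoord G p - lapCoord G F p +
      lapCoord G F p * ∑ i, ∑ j, (G p)⁻¹ i j * G p i j := by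
    nth_rewrite 2 [lapCoord]
    unfold scalCoord trG
    simp only [Finset.mul_sum, ← Finset.sum_add_distrib, ← Finset.sum_sub_distrib]
    exact Finset.sum_congr rfl fun i _ => Finset.sum_congr rfl fun j _ => by ring
  rw [h3, h2] at h1
  linarith

end Conformal
end ConformalStatic
end

open scoped Manifold ContDiff
noncomputable section
namespace ConformalStatic
open Filter Topology

/-! ### From coordinate expressions to the manifold -/

variable {n : ℕ} [NeZero n] {M : Type*} [TopologicalSpace M]
  [ChartedSpace (EuclideanHalfSpace n) M] [IsManifold (𝓡∂ n) ∞ M]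

/-- The metric at `p` as a bilinear form on the model space. -/
def innerE (g : Metric n M) (p : M) : Eu n →L[ℝ] Eu n →L[ℝ] ℝ := g.inner p

/-- The derivative of the inverse chart around `x₀` as an endomorphism of the model space. -/
def chartD (x₀ : M) (y : Eu n) : Eu n →L[ℝ] Eu n :=
  mfderivWithin 𝓘(ℝ, Eu n) (𝓡∂ n) (extChartAt (𝓡∂ n) x₀).symm (HS n) y

lemma metricCoord_apply (g : Metric n M) (x₀ : M) (y : Eu n) (i j : Fin n) :
    metricCoord g x₀ y i j = innerE g ((extChartAt (𝓡∂ n) x₀).symm y)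
      (chartD x₀ y (bv i)) (chartD x₀ y (bv j)) := rfl

lemma innerE_symm (g : Metric n M) (p : M) (u v : Eu n) : innerE g p u v = innerE g p v u :=
  g.symm p u v

lemma innerE_pos (g : Metric n M) (p : M) {u : Eu n} (hu : u ≠ 0) : 0 < innerE g p u u :=
  g.pos p u hu

lemma bil_metricCoord (g : Metric n M) (x₀ : M) (y u v : Eu n) :
    bil (metricCoord g x₀ y) u v = innerE g ((extChartAt (𝓡∂ n) x₀).symm y)
      (chartD x₀ y u) (chartD x₀ y v) := by
  have key : ∀ i, bil (metricCoord g x₀ y) (bv i) v =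
      innerE g ((extChartAt (𝓡∂ n) x₀).symm y) (chartD x₀ y (bv i)) (chartD x₀ y v) := fun i =>
    linear_ext (f := fun v => bil (metricCoord g x₀ y) (bv i) v)
      (g := fun v => innerE g ((extChartAt (𝓡∂ n) x₀).symm y) (chartD x₀ y (bv i))
        (chartD x₀ y v))
      (by constructor <;> intros <;> simp) (by constructor <;> intros <;> simp)
      (fun j => by rw [bil_bv, metricCoord_apply]) v
  exact linear_ext (f := fun u => bil (metricCoord g x₀ y) u v)
    (g := fun u => innerE g ((extChartAt (𝓡∂ n) x₀).symm y) (chartD x₀ y u) (chartD x₀ y v))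
    (by constructor <;> intros <;> simp) (by constructor <;> intros <;> simp) key u

lemma target_subset_HS (x₀ : M) : (extChartAt (𝓡∂ n) x₀).target ⊆ HS n :=
  extChartAt_target_subset_range x₀

lemma smooth_chart_symm (x₀ : M) {y : Eu n} (hy : y ∈ (extChartAt (𝓡∂ n) x₀).target) :
    ContMDiffWithinAt 𝓘(ℝ, Eu n) (𝓡∂ n) ∞ (extChartAt (𝓡∂ n) x₀).symm (HS n) y :=
  contMDiffWithinAt_extChartAt_symm_range x₀ hy

lemma chartD_injective (x₀ : M) {y : Eu n} (hy : y ∈ (extChartAt (𝓡∂ n) x₀).target) :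
    Function.Injective (chartD x₀ y) :=
  (isInvertible_mfderivWithin_extChartAt_symm (I := 𝓡∂ n) hy).injective

/-- Tangent vectors at a point are expressed in the preferred chart of that point, so the
differential of an inverse chart is the derivative of a transition map. -/
lemma chartD_eq_fderivWithin (x₀ : M) {y : Eu n} (hy : y ∈ (extChartAt (𝓡∂ n) x₀).target) :
    chartD x₀ y = fderivWithin ℝ (extChartAt (𝓡∂ n) ((extChartAt (𝓡∂ n) x₀).symm y) ∘
      (extChartAt (𝓡∂ n) x₀).symm) (HS n) y := by
  have h := ((smooth_chart_symm x₀ hy).mdifferentiableWithinAt (by simp))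
  refine h.mfderivWithin.trans ?_
  simp only [writtenInExtChartAt, extChartAt_model_space_eq_id, PartialEquiv.refl_symm,
    PartialEquiv.refl_coe, Set.preimage_id, modelWithCornersSelf_coe, Set.range_id,
    Set.inter_univ, id_eq, Function.comp_id]
  rfl

lemma smooth_comp_chart_symm {f : M → ℝ} (hf : ContMDiff (𝓡∂ n) 𝓘(ℝ, ℝ) ∞ f) (x₀ : M) {y : Eu n}
    (hy : y ∈ (extChartAt (𝓡∂ n) x₀).target) : Smooth (f ∘ (extChartAt (𝓡∂ n) x₀).symm) y :=
  (hf.contMDiffAt.comp_contMDiffWithinAt y (smooth_chart_symm x₀ hy)).contDiffWithinAt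

/-- Smoothness of `g` is a statement about sections of a bundle. The coordinate vector fields are
the local frame of the tangent bundle trivialization at `x₀`, whose sections are smooth. -/
lemma smooth_metricCoord (g : Metric n M) (x₀ : M) {y : Eu n}
    (hy : y ∈ (extChartAt (𝓡∂ n) x₀).target) (i j : Fin n) :
    Smooth (fun z => metricCoord g x₀ z i j) y := by
  set e := trivializationAt (Eu n) (fun x : M => TangentSpace (𝓡∂ n) x) x₀ with he
  set b := (EuclideanSpace.basisFun (Fin n) ℝ).toBasis
  have hmem : ∀ z ∈ (extChartAt (𝓡∂ n) x₀).target, (extChartAt (𝓡∂ n) x₀).symm z ∈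
      (chartAt (EuclideanHalfSpace n) x₀).source := fun z hz => by
    simpa only [extChartAt_source] using (extChartAt (𝓡∂ n) x₀).map_target hz
  have hp : (extChartAt (𝓡∂ n) x₀).symm y ∈ e.baseSet := by
    rw [he, TangentBundle.trivializationAt_baseSet]; exact hmem y hy
  have hl : ∀ i, ContMDiffAt (𝓡∂ n) ((𝓡∂ n).prod 𝓘(ℝ, Eu n)) ∞
      (fun p => (⟨p, e.localFrame b i p⟩ : Bundle.TotalSpace (Eu n) (fun x : M => TangentSpace (𝓡∂ n) x)))
      ((extChartAt (𝓡∂ n) x₀).symm y) := fun i => contMDiffAt_localFrame_of_mem _ e b i hp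
  have hs : ContMDiffAt (𝓡∂ n) 𝓘(ℝ, ℝ) ∞
      (fun p => g.inner p (e.localFrame b i p) (e.localFrame b j p))
      ((extChartAt (𝓡∂ n) x₀).symm y) := by
    have : ContMDiffAt (𝓡∂ n) ((𝓡∂ n).prod 𝓘(ℝ, ℝ)) ∞
        (fun m ↦ Bundle.TotalSpace.mk' ℝ (E := Bundle.Trivial M ℝ) m
          (g.inner m (e.localFrame b i m) (e.localFrame b j m)))
        ((extChartAt (𝓡∂ n) x₀).symm y) :=
      ContMDiffAt.clm_bundle_apply₂ (F₁ := Eu n) (F₂ := Eu n) g.contMDiff.contMDiffAt (hl i) (hl j)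
    simp only [Bundle.contMDiffAt_totalSpace] at this
    exact this.2
  have hc := (hs.comp_contMDiffWithinAt y (smooth_chart_symm x₀ hy)).contDiffWithinAt
  have hev : ∀ z ∈ (extChartAt (𝓡∂ n) x₀).target, ∀ i,
      e.localFrame b i ((extChartAt (𝓡∂ n) x₀).symm z) = chartD x₀ z (bv i) := by
    intro z hz i
    have hz' : (extChartAt (𝓡∂ n) x₀).symm z ∈ e.baseSet := by
      rw [he, TangentBundle.trivializationAt_baseSet]; exact hmem z hz
    rw [e.localFrame_apply_of_mem_baseSet b hz']
    have h1 := TangentBundle.symmL_trivializationAt (I := 𝓡∂ n) (hmem z hz)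
    rw [(extChartAt (𝓡∂ n) x₀).right_inv hz] at h1
    unfold chartD
    rw [← h1]
    have hb : bv i = b i := by simp [b]
    rw [hb, Bundle.Trivialization.basisAt, Module.Basis.map_apply]
    exact (Bundle.Trivialization.symmL_apply (R := ℝ) e hz' _).symm
  refine hc.congr_of_eventuallyEq ?_ ?_
  · filter_upwards [extChartAt_target_mem_nhdsWithin_of_mem hy] with z hz
    simp only [Function.comp_apply]
    rw [hev z hz, hev z hz]; rfl
  · simp only [Function.comp_apply]
    rw [hev y hy, hev y hy]; rfl

lemma metricAt_metricCoord (g : Metric n M) (x₀ : M) {y : Eu n}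
    (hy : y ∈ (extChartAt (𝓡∂ n) x₀).target) : MetricAt (metricCoord g x₀) y := by
  refine ⟨target_subset_HS x₀ hy, ?_⟩
  filter_upwards [extChartAt_target_mem_nhdsWithin_of_mem hy] with z hz
  refine ⟨fun i j => smooth_metricCoord g x₀ hz i j, ?_⟩
  refine Matrix.PosDef.of_dotProduct_mulVec_pos ?_ fun x hx => ?_
  · ext i j
    simp only [Matrix.conjTranspose_apply, star_trivial, metricCoord_apply]
    exact innerE_symm _ _ _ _
  · have := innerE_pos g ((extChartAt (𝓡∂ n) x₀).symm z)
      (u := chartD x₀ z (WithLp.toLp 2 x)) (by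
        intro h0
        have := chartD_injective x₀ hz (h0.trans (map_zero _).symm)
        exact hx (by simpa using this))
    rw [← bil_metricCoord] at this
    rw [star_trivial]
    rw [bil_dotProduct] at this
    exact this

lemma symm_mem_source (x₀ : M) {y : Eu n} (hy : y ∈ (extChartAt (𝓡∂ n) x₀).target) :
    (extChartAt (𝓡∂ n) x₀).symm y ∈ (extChartAt (𝓡∂ n) x₀).source :=
  (extChartAt (𝓡∂ n) x₀).map_target hy

lemma target_mem_nhds (x₀ : M) {y : Eu n} (hy : y ∈ (extChartAt (𝓡∂ n) x₀).target)
    (hi : y ∈ interior (HS n)) : (extChartAt (𝓡∂ n) x₀).target ∈ 𝓝 y := by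
  rw [← nhdsWithin_HS hi]; exact extChartAt_target_mem_nhdsWithin_of_mem hy

lemma chart_symm_mem_interior_iff (x₀ : M) {y : Eu n}
    (hy : y ∈ (extChartAt (𝓡∂ n) x₀).target) :
    (extChartAt (𝓡∂ n) x₀).symm y ∈ (𝓡∂ n).interior M ↔ y ∈ interior (HS n) := by
  have h := (𝓡∂ n).isInteriorPoint_iff_of_mem_atlas (n := ∞) (by simp)
    (chart_mem_atlas (EuclideanHalfSpace n) x₀)
    (x := (extChartAt (𝓡∂ n) x₀).symm y) (by simpa only [extChartAt_source] using symm_mem_source x₀ hy)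
  change (𝓡∂ n).IsInteriorPoint _ ↔ _
  rw [h]
  change (extChartAt (𝓡∂ n) x₀) ((extChartAt (𝓡∂ n) x₀).symm y) ∈
    interior (extChartAt (𝓡∂ n) x₀).target ↔ _
  rw [(extChartAt (𝓡∂ n) x₀).right_inv hy]
  exact ⟨fun h => interior_mono (target_subset_HS x₀) h,
    fun h => mem_interior_iff_mem_nhds.2 (target_mem_nhds x₀ hy h)⟩

lemma chart_mem_interior_iff {x₀ x : M} (hx : x ∈ (extChartAt (𝓡∂ n) x₀).source) :
    extChartAt (𝓡∂ n) x₀ x ∈ interior (HS n) ↔ x ∈ (𝓡∂ n).interior M := by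
  rw [← chart_symm_mem_interior_iff x₀ ((extChartAt (𝓡∂ n) x₀).map_source hx),
    (extChartAt (𝓡∂ n) x₀).left_inv hx]

section change

variable (x₀ x : M) {y : Eu n} (hy : y ∈ (extChartAt (𝓡∂ n) x₀).target)
  (hx : (extChartAt (𝓡∂ n) x₀).symm y ∈ (extChartAt (𝓡∂ n) x).source)
include hy hx

lemma smooth_chart_change :
    Smooth (extChartAt (𝓡∂ n) x ∘ (extChartAt (𝓡∂ n) x₀).symm) y :=
  contDiffWithinAt_ext_coord_change x x₀ ⟨hy, hx⟩

lemma eventually_chart_change : ∀ᶠ z in 𝓝[HS n] y, z ∈ (extChartAt (𝓡∂ n) x₀).target ∧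
    (extChartAt (𝓡∂ n) x₀).symm z ∈ (extChartAt (𝓡∂ n) x).source := by
  refine Filter.Eventually.and (extChartAt_target_mem_nhdsWithin_of_mem hy) ?_
  exact (smooth_chart_symm x₀ hy).continuousWithinAt.tendsto.eventually
    ((isOpen_extChartAt_source x).mem_nhds hx)

lemma chartD_change : chartD x₀ y =
    (chartD x ((extChartAt (𝓡∂ n) x) ((extChartAt (𝓡∂ n) x₀).symm y))).comp
      (fderivWithin ℝ (extChartAt (𝓡∂ n) x ∘ (extChartAt (𝓡∂ n) x₀).symm) (HS n) y) := by
  set p := (extChartAt (𝓡∂ n) x₀).symm y with hp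
  have hT : (extChartAt (𝓡∂ n) x) p ∈ (extChartAt (𝓡∂ n) x).target :=
    (extChartAt (𝓡∂ n) x).map_source hx
  rw [chartD_eq_fderivWithin x₀ hy, chartD_eq_fderivWithin x hT,
    (extChartAt (𝓡∂ n) x).left_inv hx, ← hp]
  have hd2 := (smooth_chart_change x p hT
    (by rw [(extChartAt (𝓡∂ n) x).left_inv hx]; exact mem_extChartAt_source p)).diff
  have hd1 := (smooth_chart_change x₀ x hy hx).diff
  have hmaps : Set.MapsTo (extChartAt (𝓡∂ n) x ∘ (extChartAt (𝓡∂ n) x₀).symm) (HS n) (HS n) :=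
    fun z _ => Set.mem_range_self _
  refine Eq.trans ?_ (fderivWithin_comp y hd2 hd1 hmaps
    (uniqueDiffOn_HS y (target_subset_HS x₀ hy)))
  refine Filter.EventuallyEq.fderivWithin_eq ?_ ?_
  · filter_upwards [eventually_chart_change x₀ x hy hx] with z hz
    simp only [Function.comp_apply]
    rw [(extChartAt (𝓡∂ n) x).left_inv hz.2]
  · simp only [Function.comp_apply]
    rw [(extChartAt (𝓡∂ n) x).left_inv hx]

lemma bil_metricCoord_change (g : Metric n M) (u v : Eu n) :
    bil (metricCoord g x₀ y) u v =
      bil (metricCoord g x ((extChartAt (𝓡∂ n) x) ((extChartAt (𝓡∂ n) x₀).symm y)))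
        (fderivWithin ℝ (extChartAt (𝓡∂ n) x ∘ (extChartAt (𝓡∂ n) x₀).symm) (HS n) y u)
        (fderivWithin ℝ (extChartAt (𝓡∂ n) x ∘ (extChartAt (𝓡∂ n) x₀).symm) (HS n) y v) := by
  rw [bil_metricCoord, bil_metricCoord, chartD_change x₀ x hy hx,
    (extChartAt (𝓡∂ n) x).left_inv hx]
  rfl

lemma pullback_chart_change (g : Metric n M) (hi : y ∈ interior (HS n)) :
    Pullback (extChartAt (𝓡∂ n) x ∘ (extChartAt (𝓡∂ n) x₀).symm)
      (metricCoord g x₀) (metricCoord g x) y := by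
  have h := eventually_chart_change x₀ x hy hx
  rw [nhdsWithin_HS hi] at h
  filter_upwards [h, isOpen_interior.mem_nhds hi] with z hz hzi
  have hT := (extChartAt (𝓡∂ n) x).map_source hz.2
  refine ⟨hzi, ?_, (smooth_chart_change x₀ x hz.1 hz.2).contDiffAt hzi,
    metricAt_metricCoord g x₀ hz.1, metricAt_metricCoord g x hT, fun u v => ?_⟩
  · exact (chart_mem_interior_iff hz.2).2 ((chart_symm_mem_interior_iff x₀ hz.1).2 hzi)
  · rw [bil_metricCoord_change x₀ x hz.1 hz.2,
      fderivWithin_of_mem_nhds (mem_interior_iff_mem_nhds.1 hzi)]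
    rfl

lemma comp_chart_change {α : Type*} (f : M → α) (hi : y ∈ interior (HS n)) :
    f ∘ (extChartAt (𝓡∂ n) x₀).symm =ᶠ[𝓝 y] (f ∘ (extChartAt (𝓡∂ n) x).symm) ∘
      (extChartAt (𝓡∂ n) x ∘ (extChartAt (𝓡∂ n) x₀).symm) := by
  have h := eventually_chart_change x₀ x hy hx
  rw [nhdsWithin_HS hi] at h
  filter_upwards [h] with z hz
  simp only [Function.comp_apply]
  rw [(extChartAt (𝓡∂ n) x).left_inv hz.2]

end change

section invariance

variable (x₀ : M) {y : Eu n} (hy : y ∈ (extChartAt (𝓡∂ n) x₀).target)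
  (hi : y ∈ interior (HS n))
include hy hi

/-- Scalar curvature is defined pointwise, each point using its own chart. Invariance allows one
chart to serve a whole neighbourhood, as is necessary before differentiating. -/
lemma scalarCurvature_eq_scalCoord (g : Metric n M) :
    scalarCurvature g ((extChartAt (𝓡∂ n) x₀).symm y) = scalCoord (metricCoord g x₀) y :=
  (pullback_chart_change x₀ _ hy (mem_extChartAt_source _) g hi).scal_law.symm

lemma laplacian_eq_lapCoord (g : Metric n M) {f : M → ℝ}
    (hf : ContMDiff (𝓡∂ n) 𝓘(ℝ, ℝ) ∞ f) :
    laplacian g f ((extChartAt (𝓡∂ n) x₀).symm y) =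
      lapCoord (metricCoord g x₀) (f ∘ (extChartAt (𝓡∂ n) x₀).symm) y :=
  ((pullback_chart_change x₀ _ hy (mem_extChartAt_source _) g hi).lap_law
    (smooth_comp_chart_symm hf _ (mem_extChartAt_target _))
    (comp_chart_change x₀ _ hy (mem_extChartAt_source _) f hi)).symm

lemma staticAt_chart (g : Metric n M) {f : M → ℝ} (hf : ContMDiff (𝓡∂ n) 𝓘(ℝ, ℝ) ∞ f)
    (hst : ∀ v w : TangentSpace (𝓡∂ n) ((extChartAt (𝓡∂ n) x₀).symm y),
      f ((extChartAt (𝓡∂ n) x₀).symm y) * ricci g _ v w - hessian g f _ v w +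
        laplacian g f ((extChartAt (𝓡∂ n) x₀).symm y) * g.inner _ v w = 0) :
    StaticAt (metricCoord g x₀) (f ∘ (extChartAt (𝓡∂ n) x₀).symm) y := by
  set p := (extChartAt (𝓡∂ n) x₀).symm y with hp
  refine (pullback_chart_change x₀ p hy (mem_extChartAt_source _) g hi).static_law
    (smooth_comp_chart_symm hf p (mem_extChartAt_target _))
    (comp_chart_change x₀ p hy (mem_extChartAt_source _) f hi) ?_
  have hTy : (extChartAt (𝓡∂ n) p ∘ (extChartAt (𝓡∂ n) x₀).symm) y = extChartAt (𝓡∂ n) p p := rfl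
  rw [hTy]
  intro i j
  have h := hst (bv i : Eu n) (bv j : Eu n)
  have hcomp : ∀ k l : Fin n, comp (x := p) (bv k : Eu n) l = if l = k then 1 else 0 := by
    intro k l
    change (bv k : Eu n) l = _
    simp
  -- In its own preferred chart the coordinate frame at `p` is the standard basis, so testing the
  -- static equation on basis vectors gives its components.
  have hid : chartD p (extChartAt (𝓡∂ n) p p) = ContinuousLinearMap.id ℝ _ := by
    rw [chartD_eq_fderivWithin p (mem_extChartAt_target p),
      (extChartAt (𝓡∂ n) p).left_inv (mem_extChartAt_source p)]
    exact fderivWithin_extChartAt_comp_extChartAt_symm_range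
  have hm : metricCoord g p (extChartAt (𝓡∂ n) p p) i j = innerE g p (bv i) (bv j) := by
    rw [metricCoord_apply, hid, (extChartAt (𝓡∂ n) p).left_inv (mem_extChartAt_source p)]
    rfl
  have hm' : g.inner p (bv i : Eu n) (bv j : Eu n) = innerE g p (bv i) (bv j) := rfl
  rw [hm', ← hm] at h
  simp only [ricci, hessian, hcomp, mul_ite, mul_one, mul_zero, Finset.sum_ite_eq',
    Finset.sum_ite_eq, Finset.mem_univ, if_true] at h
  simp only [Function.comp_apply]
  rw [(extChartAt (𝓡∂ n) p).left_inv (mem_extChartAt_source p)]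
  exact h

end invariance

end ConformalStatic
end

open scoped Manifold ContDiff
noncomputable section
namespace ConformalStatic
open Filter Topology

/-! ### Calculus of the coordinate Laplacian and maximum principles -/

section LaplaceCalculus

variable {n : ℕ} [NeZero n] {G : Eu n → Matrix (Fin n) (Fin n) ℝ} {F K : Eu n → ℝ} {y : Eu n}

lemma trG_add (A : Matrix (Fin n) (Fin n) ℝ) (B C : Fin n → Fin n → ℝ) :
    trG A (fun i j => B i j + C i j) = trG A B + trG A C := by
  simp only [trG, mul_add, Finset.sum_add_distrib]

lemma trG_const_mul (A : Matrix (Fin n) (Fin n) ℝ) (c : ℝ) (B : Fin n → Fin n → ℝ) :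
    trG A (fun i j => c * B i j) = c * trG A B := by
  simp only [trG, Finset.mul_sum]
  exact Finset.sum_congr rfl fun i _ => Finset.sum_congr rfl fun j _ => by ring

lemma pderiv_comp_real {h : ℝ → ℝ} {i : Fin n} (hy : y ∈ HS n)
    (hF : DifferentiableWithinAt ℝ F (HS n) y) (hh : DifferentiableAt ℝ h (F y)) :
    pderiv i (fun z => h (F z)) y = deriv h (F y) * pderiv i F y := by
  have := (hh.hasDerivAt.comp_hasFDerivWithinAt y hF.hasFDerivWithinAt).fderivWithin
    (uniqueDiffOn_HS y hy)
  unfold pderiv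
  change fderivWithin ℝ (h ∘ F) (HS n) y _ = _
  rw [this]; rfl

lemma Smooth.comp_real {h : ℝ → ℝ} (hh : ContDiff ℝ ∞ h) (hF : Smooth F y) :
    Smooth (fun z => h (F z)) y :=
  hh.contDiffAt.comp_contDiffWithinAt y hF

lemma hessianCoord_comp {h : ℝ → ℝ} (hh : ContDiff ℝ ∞ h) (hy : y ∈ HS n) (hF : Smooth F y)
    (i j : Fin n) : hessianCoord G (fun z => h (F z)) i j y =
      deriv h (F y) * hessianCoord G F i j y +
        deriv (deriv h) (F y) * (pderiv i F y * pderiv j F y) := by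
  have hh' : ContDiff ℝ ∞ (deriv h) := (contDiff_infty_iff_deriv.1 hh).2
  have hd : ∀ x, DifferentiableAt ℝ h x := fun x => hh.differentiable (by simp) x
  have hd' : ∀ x, DifferentiableAt ℝ (deriv h) x := fun x => hh'.differentiable (by simp) x
  have e : pderiv j (fun z => h (F z)) =ᶠ[𝓝[HS n] y] fun z => deriv h (F z) * pderiv j F z := by
    filter_upwards [hF.eventually_diff hy, self_mem_nhdsWithin] with z hz hz'
    exact pderiv_comp_real hz' hz (hd _)
  unfold hessianCoord
  rw [pderiv_congr hy e, pderiv_mul hy (hF.comp_real hh').diff (hF.pderiv hy j).diff,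
    pderiv_comp_real hy hF.diff (hd' _)]
  have : ∀ k, pderiv k (fun z => h (F z)) y = deriv h (F y) * pderiv k F y := fun k =>
    pderiv_comp_real hy hF.diff (hd _)
  simp only [this, mul_sub, Finset.mul_sum]
  have e2 : ∑ k, christoffel G k i j y * (deriv h (F y) * pderiv k F y) =
      ∑ k, deriv h (F y) * (christoffel G k i j y * pderiv k F y) :=
    Finset.sum_congr rfl fun k _ => by ring
  rw [e2]; ring

lemma lapCoord_comp {h : ℝ → ℝ} (hh : ContDiff ℝ ∞ h) (hy : y ∈ HS n) (hF : Smooth F y) :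
    lapCoord G (fun z => h (F z)) y =
      deriv h (F y) * lapCoord G F y + deriv (deriv h) (F y) * gradSqCoord G F y := by
  unfold lapCoord gradSqCoord
  rw [← trG_const_mul, ← trG_const_mul, ← trG_add]
  simp only [hessianCoord_comp hh hy hF]

lemma hessianCoord_add (hy : y ∈ HS n) (hF : Smooth F y) (hK : Smooth K y) (i j : Fin n) :
    hessianCoord G (fun z => F z + K z) i j y = hessianCoord G F i j y + hessianCoord G K i j y := by
  have e : pderiv j (fun z => F z + K z) =ᶠ[𝓝[HS n] y] fun z => pderiv j F z + pderiv j K z := by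
    filter_upwards [hF.eventually_diff hy, hK.eventually_diff hy, self_mem_nhdsWithin]
      with z hz hz' hz''
    exact pderiv_add hz'' hz hz'
  unfold hessianCoord
  rw [pderiv_congr hy e, pderiv_add hy (hF.pderiv hy j).diff (hK.pderiv hy j).diff]
  simp only [pderiv_add hy hF.diff hK.diff, mul_add, Finset.sum_add_distrib]
  ring

lemma lapCoord_add (hy : y ∈ HS n) (hF : Smooth F y) (hK : Smooth K y) :
    lapCoord G (fun z => F z + K z) y = lapCoord G F y + lapCoord G K y := by
  unfold lapCoord
  rw [← trG_add]
  simp only [hessianCoord_add hy hF hK]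

lemma lapCoord_const_mul (hy : y ∈ HS n) (hF : Smooth F y) (c : ℝ) :
    lapCoord G (fun z => c * F z) y = c * lapCoord G F y := by
  have hc : ContDiff ℝ ∞ (fun x : ℝ => c * x) := by fun_prop
  have h1 : deriv (fun x : ℝ => c * x) = fun _ => c := by
    ext x; simp
  rw [lapCoord_comp hc hy hF, h1]
  simp

lemma lapCoord_sub (hy : y ∈ HS n) (hF : Smooth F y) (hK : Smooth K y) :
    lapCoord G (fun z => F z - K z) y = lapCoord G F y - lapCoord G K y := by
  have h := lapCoord_add (G := G) hy hF ((Smooth.const (-1)).mul hK)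
  rw [lapCoord_const_mul hy hK] at h
  have e : (fun z => F z - K z) = fun z => F z + -1 * K z := by ext z; ring
  rw [e, h]; ring

lemma lapCoord_const (c : ℝ) : lapCoord G (fun _ => c) y = 0 := by
  have h1 : ∀ j : Fin n, (fun z => pderiv j (fun _ : Eu n => c) z) = fun _ => 0 := fun j => by
    ext z; exact pderiv_const c
  have h2 : ∀ i j : Fin n, hessianCoord G (fun _ => c) i j y = 0 := by
    intro i j
    unfold hessianCoord
    have : pderiv j (fun _ : Eu n => c) = fun _ => 0 := h1 j
    rw [this, pderiv_const]
    simp [pderiv_const]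
  simp [lapCoord, trG, h2]

lemma gradSqCoord_pos (hA : (G y).PosDef) {i : Fin n} (hi : pderiv i F y ≠ 0) :
    0 < gradSqCoord G F y := by
  have h := hA.inv.dotProduct_mulVec_pos (x := fun i => pderiv i F y)
    (fun h0 => hi (congrFun h0 i))
  rw [star_trivial] at h
  have e : gradSqCoord G F y =
      (fun i => pderiv i F y) ⬝ᵥ (G y)⁻¹.mulVec (fun i => pderiv i F y) := by
    simp only [gradSqCoord, trG, dotProduct, Matrix.mulVec, Finset.mul_sum]
    exact Finset.sum_congr rfl fun i _ => Finset.sum_congr rfl fun j _ => by ring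
  rw [e]; exact h

lemma gradSqCoord_nonneg (hA : (G y).PosDef) : 0 ≤ gradSqCoord G F y := by
  by_cases h : ∃ i, pderiv i F y ≠ 0
  · exact (gradSqCoord_pos hA h.choose_spec).le
  · push Not at h
    simp [gradSqCoord, trG, h]

/-- If `f''(0) < 0`, adding `c t²` with `c = -f''(0)/4` leaves the second derivative equal to
`f''(0)/2 < 0`. The perturbed function then has a local maximum at `0`, whereas it grows strictly
away from the local minimum of `f`. -/
lemma deriv_deriv_nonneg_of_isLocalMin {f : ℝ → ℝ} (hf : ∀ᶠ t in 𝓝 (0 : ℝ), DifferentiableAt ℝ f t)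
    (hf' : DifferentiableAt ℝ (deriv f) 0) (hm : IsLocalMin f 0) : 0 ≤ deriv (deriv f) 0 := by
  by_contra! hneg
  set c := - deriv (deriv f) 0 / 4 with hc
  have hcpos : 0 < c := by rw [hc]; linarith
  have hd : deriv (fun t => f t + c * t ^ 2) =ᶠ[𝓝 0] fun t => deriv f t + 2 * c * t := by
    filter_upwards [hf] with t ht
    have h2 : HasDerivAt (fun t : ℝ => f t + c * t ^ 2) (deriv f t + c * (2 * t)) t := by
      have := (hasDerivAt_pow 2 t).const_mul c
      simp only [Nat.cast_ofNat, Nat.add_one_sub_one, pow_one] at this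
      exact ht.hasDerivAt.fun_add this
    rw [h2.deriv]; ring
  have h0 : deriv f 0 = 0 := hm.deriv_eq_zero
  have hd2 : deriv (deriv (fun t => f t + c * t ^ 2)) 0 = deriv (deriv f) 0 + 2 * c := by
    rw [hd.deriv_eq]
    have h3 : HasDerivAt (fun t : ℝ => deriv f t + 2 * c * t) (deriv (deriv f) 0 + 2 * c * 1) 0 :=
      hf'.hasDerivAt.add ((hasDerivAt_id (0 : ℝ)).const_mul (2 * c))
    rw [h3.deriv]; ring
  have hmax : IsLocalMax (fun t => f t + c * t ^ 2) 0 := by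
    refine isLocalMax_of_deriv_deriv_neg (by rw [hd2, hc]; linarith) ?_ ?_
    · rw [hd.self_of_nhds]; simp only [h0]; ring
    · exact hf.self_of_nhds.continuousAt.add (by fun_prop)
  have hev : ∀ᶠ t in 𝓝[≠] (0 : ℝ), False := by
    filter_upwards [nhdsWithin_le_nhds hm, nhdsWithin_le_nhds hmax, self_mem_nhdsWithin]
      with t h1 h2 h3
    have h3' : t ≠ 0 := h3
    have : 0 < c * t ^ 2 := by positivity
    simp only [mul_zero, ne_eq, OfNat.ofNat_ne_zero, not_false_eq_true, zero_pow,
      add_zero] at h1 h2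
    linarith
  exact hev.exists.elim fun _ h => h

lemma fderiv_fderiv_nonneg_of_isLocalMin (hF : ContDiffAt ℝ ∞ F y) (hm : IsLocalMin F y)
    (u : Eu n) : 0 ≤ fderiv ℝ (fderiv ℝ F) y u u := by
  have hF1 : ContDiffAt ℝ 1 F y := hF.of_le (by norm_cast)
  have hdF : ∀ᶠ z in 𝓝 y, DifferentiableAt ℝ F z :=
    (hF1.eventually (by simp)).mono fun z hz => hz.differentiableAt (by simp)
  have hF2 : DifferentiableAt ℝ (fderiv ℝ F) y :=
    ContDiffAt.diffAt (hF.fderiv_right (by simp))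
  have hl : ∀ t : ℝ, HasDerivAt (fun t : ℝ => y + t • u) u t := fun t => by
    simpa using ((hasDerivAt_id t).smul_const u).const_add y
  have hlc : Tendsto (fun t : ℝ => y + t • u) (𝓝 0) (𝓝 y) := by
    have := (hl 0).continuousAt.tendsto
    simpa using this
  have hd : ∀ᶠ t in 𝓝 (0 : ℝ), HasDerivAt (fun t : ℝ => F (y + t • u)) (fderiv ℝ F (y + t • u) u) t := by
    filter_upwards [hlc.eventually hdF] with t ht
    exact ht.hasFDerivAt.comp_hasDerivAt t (hl t)
  have e : deriv (fun t : ℝ => F (y + t • u)) =ᶠ[𝓝 0] fun t => fderiv ℝ F (y + t • u) u :=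
    hd.mono fun t ht => ht.deriv
  have h2 : HasDerivAt (fun t : ℝ => fderiv ℝ F (y + t • u) u) (fderiv ℝ (fderiv ℝ F) y u u) 0 := by
    have h3 : HasFDerivAt (fun z => fderiv ℝ F z u) ((fderiv ℝ (fderiv ℝ F) y).flip u) y := by
      refine (hF2.hasFDerivAt.clm_apply (hasFDerivAt_const u y)).congr_fderiv ?_
      ext v
      simp
    exact h3.comp_hasDerivAt_of_eq (0 : ℝ) (hl 0) (by simp)
  have := deriv_deriv_nonneg_of_isLocalMin (hd.mono fun t ht => ht.differentiableAt)
    (e.differentiableAt_iff.2 h2.differentiableAt) (by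
      filter_upwards [hlc.eventually hm] with t ht
      simpa using ht)
  rwa [e.deriv_eq, h2.deriv] at this

lemma lapCoord_nonneg_of_isLocalMin (hG : MetricAt G y) (hy : y ∈ interior (HS n))
    (hF : Smooth F y) (hm : IsLocalMin F y) : 0 ≤ lapCoord G F y := by
  refine trG_nonneg hG.posDef fun u => ?_
  rw [bil_hessian hF hy, hm.fderiv_eq_zero]
  simpa using fderiv_fderiv_nonneg_of_isLocalMin (hF.contDiffAt hy) hm u

lemma pderiv_norm_sub_sq (c : Eu n) (hy : y ∈ HS n) (i : Fin n) :
    pderiv i (fun z => ‖z - c‖ ^ 2) y = 2 * (y - c) i := by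
  have h : HasFDerivWithinAt (fun z : Eu n => ‖z - c‖ ^ 2) _ (HS n) y :=
    (((hasFDerivAt_id y).sub_const c).norm_sq).hasFDerivWithinAt
  unfold pderiv
  rw [h.fderivWithin (uniqueDiffOn_HS y hy)]
  simp [EuclideanSpace.inner_single_right]

/-- Barrier functions for the Laplacian. -/
lemma exists_exp_barrier (hy : y ∈ HS n) (hF : Smooth F y)
    (hgrad : 0 < gradSqCoord G F y) :
    ∃ α : ℝ, 0 < α ∧ 0 < lapCoord G (fun z => Real.exp (-α * F z)) y := by
  set g := gradSqCoord G F y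
  set l := lapCoord G F y
  -- The Laplacian of `e^{-αF}` is `α e^{-αF} (α |∇F|² - ΔF)`; this choice makes `α |∇F|² = |ΔF| +
  -- 1`.
  refine ⟨(|l| + 1) / g, by positivity, ?_⟩
  set α := (|l| + 1) / g with hα
  have hαpos : 0 < α := by positivity
  have hαg : α * g = |l| + 1 := by rw [hα]; field_simp
  have hh : ContDiff ℝ ∞ (fun x : ℝ => Real.exp (-α * x)) := by fun_prop
  have h1 : deriv (fun x : ℝ => Real.exp (-α * x)) = fun x => -α * Real.exp (-α * x) := by
    ext x
    have := ((hasDerivAt_id x).const_mul (-α)).exp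
    simp only [id] at this
    rw [this.deriv]; ring
  have h2 : deriv (fun x : ℝ => -α * Real.exp (-α * x)) = fun x => α ^ 2 * Real.exp (-α * x) := by
    ext x
    have := (((hasDerivAt_id x).const_mul (-α)).exp).const_mul (-α)
    simp only [id] at this
    rw [this.deriv]; ring
  rw [lapCoord_comp hh hy hF, h1, h2]
  have : -α * Real.exp (-α * F y) * l + α ^ 2 * Real.exp (-α * F y) * g =
      Real.exp (-α * F y) * α * (α * g - l) := by ring
  rw [this, hαg]
  have := le_abs_self l
  have : 0 < |l| + 1 - l := by linarith
  positivity

/-- The strong maximum principle. -/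
lemma eventually_eq_zero_of_lapCoord_nonpos {v : Eu n → ℝ} (hG : MetricAt G y)
    (hy : y ∈ interior (HS n)) (hv : ∀ᶠ z in 𝓝 y, Smooth v z) (h0 : ∀ᶠ z in 𝓝 y, 0 ≤ v z)
    (hΔ : ∀ᶠ z in 𝓝 y, lapCoord G v z ≤ 0) (hvy : v y = 0) : ∀ᶠ z in 𝓝 y, v z = 0 := by
  have hGe := hG.eventually
  rw [nhdsWithin_HS hy] at hGe
  have hyi : ∀ᶠ z in 𝓝 y, z ∈ interior (HS n) := isOpen_interior.mem_nhds hy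
  obtain ⟨ρ, hρ, hball⟩ := Metric.eventually_nhds_iff_ball.1
    (hGe.and (hyi.and (hv.and (h0.and hΔ))))
  refine Metric.eventually_nhds_iff_ball.2 ⟨ρ / 4, by positivity, fun y1 hy1 => ?_⟩
  by_contra hv1
  have hvc : ∀ z ∈ Metric.ball y ρ, ContinuousAt v z := fun z hz =>
    ((hball z hz).2.2.1.contDiffAt (hball z hz).2.1).continuousAt
  rw [Metric.mem_ball] at hy1
  have hsub : Metric.closedBall y1 (ρ / 4) ⊆ Metric.ball y ρ := fun z hz => by
    rw [Metric.mem_closedBall] at hz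
    rw [Metric.mem_ball]
    linarith [dist_triangle z y1 y]
  have hK : IsCompact (Metric.closedBall y1 (ρ / 4) ∩ v ⁻¹' {0}) := by
    refine (isCompact_closedBall y1 (ρ / 4)).of_isClosed_subset ?_ Set.inter_subset_left
    exact ContinuousOn.preimage_isClosed_of_isClosed
      (fun z hz => (hvc z (hsub hz)).continuousWithinAt) Metric.isClosed_closedBall
      isClosed_singleton
  -- Hopf's argument: `p` is a zero of `v` nearest to the point `y1`, where `v` is not zero. The
  -- open ball about `y1` through `p` contains no zero.
  obtain ⟨p, hpK, hpmin⟩ := hK.exists_isMinOn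
    ⟨y, by rw [Metric.mem_closedBall, dist_comm]; exact hy1.le, hvy⟩
    (f := fun z => dist z y1) (by fun_prop)
  have hpball := hsub hpK.1
  have hpv : v p = 0 := hpK.2
  set r := dist p y1 with hr
  have hrpos : 0 < r := dist_pos.2 fun h => hv1 (h ▸ hpv)
  have hrρ : r ≤ ρ / 4 := hpK.1
  have hvpos : ∀ z, dist z y1 < r → 0 < v z := by
    intro z hz
    have hzc : z ∈ Metric.closedBall y1 (ρ / 4) := (hz.trans_le hrρ).le
    refine lt_of_le_of_ne (hball z (hsub hzc)).2.2.2.1 fun h => ?_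
    exact absurd (hpmin ⟨hzc, h.symm⟩) (not_le.2 hz)
  -- The ball of half the radius, centred at the midpoint `c` of `y1` and `p`, touches the large
  -- sphere only at `p`. The parallelogram law proves this in `hin`.
  set b : Eu n := (1 / 2 : ℝ) • (p - y1) with hb
  set c : Eu n := y1 + b with hc
  have hpc : p - c = b := by
    rw [hc, hb]; module
  have hbr : ‖b‖ = r / 2 := by
    rw [hb, norm_smul, hr, dist_eq_norm, Real.norm_eq_abs, abs_of_pos (by norm_num)]; ring
  have hin : ∀ z, ‖z - c‖ ^ 2 ≤ (r / 2) ^ 2 → z ≠ p → dist z y1 < r := by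
    intro z hz hzp
    have h1 := parallelogram_law_with_norm ℝ (z - c) b
    have e1 : z - c + b = z - y1 := by rw [hc]; abel
    have e2 : z - c - b = z - p := by rw [← hpc]; abel
    rw [e1, e2, hbr] at h1
    have h2 : 0 < ‖z - p‖ := norm_pos_iff.2 (sub_ne_zero.2 hzp)
    rw [dist_eq_norm]
    refine lt_of_pow_lt_pow_left₀ 2 hrpos.le ?_
    nlinarith
  set S : Eu n → ℝ := fun z => ‖z - c‖ ^ 2 with hS
  have hSs : ∀ z, Smooth S z := fun z =>
    (((contDiff_id.sub contDiff_const).norm_sq ℝ).contDiffAt).contDiffWithinAt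
  obtain ⟨hGp, hpi, -⟩ := hball p hpball
  have hpH := interior_subset hpi
  have hgrad : 0 < gradSqCoord G S p := by
    have : ∃ i, b i ≠ 0 := by
      by_contra! h
      have : b = 0 := by ext i; simpa using h i
      rw [this, norm_zero] at hbr; linarith
    obtain ⟨i, hi⟩ := this
    refine gradSqCoord_pos hGp.posDef (i := i) ?_
    rw [hS, pderiv_norm_sub_sq c hpH, hpc]
    exact mul_ne_zero two_ne_zero hi
  obtain ⟨α, hα, hlap⟩ := exists_exp_barrier hpH (hSs p) hgrad
  set w0 : Eu n → ℝ := fun z => Real.exp (-α * S z) with hw0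
  have hw0s : ∀ z, Smooth w0 z := fun z =>
    (hSs z).comp_real (h := fun x => Real.exp (-α * x)) (by fun_prop)
  have hlc : ContinuousAt (lapCoord G w0) p :=
    ((hGp.lapCoord_smooth (hw0s p)).contDiffAt hpi).continuousAt
  have hpb : ∀ᶠ z in 𝓝 p, z ∈ Metric.ball y ρ := Metric.isOpen_ball.mem_nhds hpball
  obtain ⟨s', hs', hball'⟩ := Metric.eventually_nhds_iff_ball.1
    ((hlc.eventually (lt_mem_nhds hlap)).and hpb)
  set s := s' / 2 with hs
  have hspos : 0 < s := by positivity
  have hcb : Metric.closedBall p s ⊆ Metric.ball p s' :=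
    Metric.closedBall_subset_ball (by rw [hs]; linarith)
  have hcont : ContinuousOn v (Metric.closedBall p s) := fun z hz =>
    (hvc z (hball' z (hcb hz)).2).continuousWithinAt
  have hQ : IsCompact (Metric.sphere p s ∩ {z | S z ≤ (r / 2) ^ 2}) :=
    (isCompact_sphere p s).inter_right (isClosed_le (by fun_prop) continuous_const)
  -- A positive lower bound for `v` on the part of the small sphere about `p` inside the tangent
  -- ball; it is available even if that part is empty.
  obtain ⟨m, hm, hmQ⟩ := hQ.exists_forall_le' (f := v) (a := 0)
    (hcont.mono (Set.inter_subset_left.trans Metric.sphere_subset_closedBall)) (by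
      rintro z ⟨hz1, hz2⟩
      refine hvpos z (hin z hz2 ?_)
      rintro rfl
      rw [Metric.mem_sphere, dist_self] at hz1
      exact hspos.ne hz1)
  set k := Real.exp (-α * (r / 2) ^ 2) with hk
  -- The barrier exceeds `k` only inside the tangent ball, by less than `1`; so `u > 0` on the
  -- sphere about `p`, while `u p = 0`. Its minimum over the closed ball is therefore interior,
  -- contradicting `Δu < 0`.
  set u : Eu n → ℝ := fun z => v z - m / 2 * (w0 z - k) with hu
  have hup : u p = 0 := by
    simp only [hu, hw0, hS, hpc, hbr, hk, hpv]; ring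
  have husphere : ∀ z ∈ Metric.sphere p s, 0 < u z := by
    intro z hz
    have hvz : 0 ≤ v z := (hball z (hball' z (hcb (Metric.sphere_subset_closedBall hz))).2).2.2.2.1
    by_cases hzS : S z ≤ (r / 2) ^ 2
    · have h1 := hmQ z ⟨hz, hzS⟩
      have h2 : w0 z ≤ 1 := by
        rw [hw0]; refine Real.exp_le_one_iff.2 ?_
        have : 0 ≤ S z := by positivity
        nlinarith
      have h3 : 0 < k := Real.exp_pos _
      simp only [hu]
      nlinarith
    · push Not at hzS
      have h1 : w0 z < k := Real.exp_lt_exp.2 (by nlinarith)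
      simp only [hu]
      nlinarith
  obtain ⟨q, hq, hqmin⟩ := (isCompact_closedBall p s).exists_isMinOn
    ⟨p, Metric.mem_closedBall_self hspos.le⟩ (f := u)
    (hcont.sub (continuousOn_const.mul ((Continuous.continuousOn (by fun_prop)).sub
      continuousOn_const)))
  have huq : u q ≤ 0 := hup ▸ hqmin (Metric.mem_closedBall_self hspos.le)
  have hqb : q ∈ Metric.ball p s := by
    rcases (Metric.mem_closedBall.1 hq).lt_or_eq with h | h
    · exact h
    · exact absurd huq (not_le.2 (husphere q h))
  have hqball := hball q (hball' q (hcb hq)).2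
  have hqloc : IsLocalMin u q := hqmin.isLocalMin
    (Filter.mem_of_superset (Metric.isOpen_ball.mem_nhds hqb) Metric.ball_subset_closedBall)
  have hqH := interior_subset hqball.2.1
  have hws : Smooth (fun z => w0 z - k) q := (hw0s q).sub (Smooth.const k)
  have h1 := lapCoord_nonneg_of_isLocalMin hqball.1 hqball.2.1
    (hqball.2.2.1.sub ((Smooth.const (m / 2)).mul hws)) hqloc
  rw [lapCoord_sub hqH hqball.2.2.1 ((Smooth.const (m / 2)).mul hws),
    lapCoord_const_mul hqH hws, lapCoord_sub hqH (hw0s q) (Smooth.const k), lapCoord_const] at h1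
  have h2 := hqball.2.2.2.2
  have h3 : 0 < lapCoord G w0 q := (hball' q (hcb hq)).1
  nlinarith

end LaplaceCalculus

end ConformalStatic
end

open scoped Manifold ContDiff
noncomputable section
namespace ConformalStatic
open Filter Topology

/-! ### Analysis on the manifold -/

section ManifoldAnalysis

variable {n : ℕ} [NeZero n] {M : Type*} [TopologicalSpace M]
  [ChartedSpace (EuclideanHalfSpace n) M] [IsManifold (𝓡∂ n) ∞ M]

/-- Smooth real functions on `M`. -/
abbrev SmoothFun (f : M → ℝ) : Prop := ContMDiff (𝓡∂ n) 𝓘(ℝ, ℝ) ∞ f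

/-- The squared length of the gradient. -/
def gradSq (g : Metric n M) (f : M → ℝ) (p : M) : ℝ :=
  gradSqCoord (metricCoord g p) (f ∘ (extChartAt (𝓡∂ n) p).symm) (extChartAt (𝓡∂ n) p p)

section

variable (g : Metric n M) {f k : M → ℝ} (hf : SmoothFun (n := n) f)
  (hk : SmoothFun (n := n) k) (p : M)

lemma ext_mem_HS : extChartAt (𝓡∂ n) p p ∈ HS n := Set.mem_range_self _

include hf in
lemma SmoothFun.smooth_chart : Smooth (f ∘ (extChartAt (𝓡∂ n) p).symm) (extChartAt (𝓡∂ n) p p) :=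
  smooth_comp_chart_symm hf p (mem_extChartAt_target p)

include hf hk in
lemma laplacian_add : laplacian g (fun x => f x + k x) p = laplacian g f p + laplacian g k p :=
  lapCoord_add (ext_mem_HS p) (hf.smooth_chart p) (hk.smooth_chart p)

include hf hk in
lemma laplacian_sub : laplacian g (fun x => f x - k x) p = laplacian g f p - laplacian g k p :=
  lapCoord_sub (ext_mem_HS p) (hf.smooth_chart p) (hk.smooth_chart p)

include hf in
lemma laplacian_const_mul (c : ℝ) : laplacian g (fun x => c * f x) p = c * laplacian g f p :=
  lapCoord_const_mul (ext_mem_HS p) (hf.smooth_chart p) c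

lemma laplacian_const (c : ℝ) : laplacian g (fun _ => c) p = 0 := lapCoord_const c

include hf in
lemma laplacian_comp {h : ℝ → ℝ} (hh : ContDiff ℝ ∞ h) : laplacian g (fun x => h (f x)) p =
    deriv h (f p) * laplacian g f p + deriv (deriv h) (f p) * gradSq g f p := by
  have := lapCoord_comp (G := metricCoord g p) hh (ext_mem_HS p) (hf.smooth_chart p)
  simp only [Function.comp_apply, extChartAt_to_inv] at this
  exact this

lemma gradSq_nonneg : 0 ≤ gradSq g f p :=
  gradSqCoord_nonneg (metricAt_metricCoord g p (mem_extChartAt_target p)).posDef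

end

lemma tendsto_chart_symm (x₀ : M) {y : Eu n} (hy : y ∈ (extChartAt (𝓡∂ n) x₀).target)
    (hi : y ∈ interior (HS n)) :
    Tendsto (extChartAt (𝓡∂ n) x₀).symm (𝓝 y) (𝓝 ((extChartAt (𝓡∂ n) x₀).symm y)) := by
  rw [← nhdsWithin_HS hi]
  exact (smooth_chart_symm x₀ hy).continuousWithinAt

lemma ext_mem_interior {p : M} (hp : p ∈ (𝓡∂ n).interior M) :
    extChartAt (𝓡∂ n) p p ∈ interior (HS n) :=
  (chart_mem_interior_iff (mem_extChartAt_source p)).2 hp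

lemma tendsto_chart_symm_self {p : M} (hp : p ∈ (𝓡∂ n).interior M) :
    Tendsto (extChartAt (𝓡∂ n) p).symm (𝓝 (extChartAt (𝓡∂ n) p p)) (𝓝 p) := by
  have := tendsto_chart_symm p (mem_extChartAt_target p) (ext_mem_interior hp)
  rwa [extChartAt_to_inv] at this

lemma eventually_of_chart {p : M} {P : M → Prop}
    (h : ∀ᶠ y in 𝓝 (extChartAt (𝓡∂ n) p p), P ((extChartAt (𝓡∂ n) p).symm y)) :
    ∀ᶠ x in 𝓝 p, P x := by
  filter_upwards [(continuousAt_extChartAt p).eventually h,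
    extChartAt_source_mem_nhds (I := 𝓡∂ n) p] with x hx hx'
  rwa [(extChartAt (𝓡∂ n) p).left_inv hx'] at hx

lemma eventually_chart_target {p : M} (hp : p ∈ (𝓡∂ n).interior M) :
    ∀ᶠ y in 𝓝 (extChartAt (𝓡∂ n) p p), y ∈ (extChartAt (𝓡∂ n) p).target ∧
      y ∈ interior (HS n) :=
  Filter.inter_mem (target_mem_nhds p (mem_extChartAt_target p) (ext_mem_interior hp))
    (isOpen_interior.mem_nhds (ext_mem_interior hp))

lemma laplacian_nonneg_of_isLocalMin (g : Metric n M) {f : M → ℝ} (hf : SmoothFun (n := n) f)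
    {p : M} (hp : p ∈ (𝓡∂ n).interior M) (hm : IsLocalMin f p) : 0 ≤ laplacian g f p := by
  refine lapCoord_nonneg_of_isLocalMin (metricAt_metricCoord g p (mem_extChartAt_target p))
    (ext_mem_interior hp) (hf.smooth_chart p) ?_
  filter_upwards [(tendsto_chart_symm_self hp).eventually hm] with y hy
  simp only [Function.comp_apply]
  rwa [extChartAt_to_inv]

lemma eventually_eq_zero_of_laplacian_nonpos (g : Metric n M) {v : M → ℝ}
    (hv : SmoothFun (n := n) v) {p : M} (hp : p ∈ (𝓡∂ n).interior M)
    (h0 : ∀ᶠ x in 𝓝 p, 0 ≤ v x) (hΔ : ∀ᶠ x in 𝓝 p, laplacian g v x ≤ 0) (hvp : v p = 0) :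
    ∀ᶠ x in 𝓝 p, v x = 0 := by
  refine eventually_of_chart (n := n) ?_
  refine eventually_eq_zero_of_lapCoord_nonpos (G := metricCoord g p)
    (v := v ∘ (extChartAt (𝓡∂ n) p).symm)
    (metricAt_metricCoord g p (mem_extChartAt_target p)) (ext_mem_interior hp) ?_
    ((tendsto_chart_symm_self hp).eventually h0) ?_ ?_
  · filter_upwards [eventually_chart_target hp] with y hy
    exact smooth_comp_chart_symm hv p hy.1
  · filter_upwards [eventually_chart_target hp, (tendsto_chart_symm_self hp).eventually hΔ]
      with y hy hy'
    rwa [laplacian_eq_lapCoord p hy.1 hy.2 g hv] at hy'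
  · simp only [Function.comp_apply]
    rwa [extChartAt_to_inv]

lemma isOpen_interior_manifold : IsOpen ((𝓡∂ n).interior M) :=
  (𝓡∂ n).isOpen_interior (n := ∞) (by simp)

lemma mem_boundary_iff {x : M} : x ∈ (𝓡∂ n).boundary M ↔ x ∉ (𝓡∂ n).interior M := by
  rw [← (𝓡∂ n).compl_interior]; rfl

/-- Every point has arbitrarily small neighbourhoods whose interior part is connected and dense:
a subset which is open and relatively closed in the interior has open closure. -/
lemma isClopen_closure_of_subset_interior {A : Set M} (hA : IsOpen A)
    (hAi : A ⊆ (𝓡∂ n).interior M) (hcl : closure A ∩ (𝓡∂ n).interior M ⊆ A) :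
    IsClopen (closure A) := by
  refine ⟨isClosed_closure, isOpen_iff_mem_nhds.2 fun x hx => ?_⟩
  by_cases hxi : x ∈ (𝓡∂ n).interior M
  · exact Filter.mem_of_superset (hA.mem_nhds (hcl ⟨hx, hxi⟩)) subset_closure
  set e := extChartAt (𝓡∂ n) x with he
  obtain ⟨r, hr, hball⟩ := Metric.mem_nhdsWithin_iff.1
    (extChartAt_target_mem_nhdsWithin (I := 𝓡∂ n) x)
  set V := Metric.ball (e x) r ∩ interior (HS n) with hV
  have hVt : V ⊆ e.target := fun y hy => hball ⟨hy.1, interior_subset hy.2⟩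
  -- In a boundary chart, the interior part of a small half-ball is convex. Its connected image
  -- meets `A`, which is clopen relative to the interior, and is therefore contained in `A`.
  have hVp : IsPreconnected (e.symm '' V) := by
    refine (((convex_ball _ _).inter (𝓡∂ n).convex_range.interior).isPreconnected).image _ ?_
    exact (continuousOn_extChartAt_symm x).mono hVt
  have hVi : e.symm '' V ⊆ (𝓡∂ n).interior M := by
    rintro _ ⟨y, hy, rfl⟩
    exact (chart_symm_mem_interior_iff x (hVt hy)).2 hy.2
  have hU : ∀ᶠ z in 𝓝 x, z ∈ e.source ∧ e z ∈ Metric.ball (e x) r :=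
    Filter.inter_mem (extChartAt_source_mem_nhds (I := 𝓡∂ n) x)
      ((continuousAt_extChartAt x).eventually (Metric.isOpen_ball.mem_nhds
        (Metric.mem_ball_self hr)))
  obtain ⟨a, haU, haA⟩ := mem_closure_iff_nhds.1 hx _ hU
  have haV : a ∈ e.symm '' V :=
    ⟨e a, ⟨haU.2, (chart_mem_interior_iff haU.1).2 (hAi haA)⟩, e.left_inv haU.1⟩
  have hVA : e.symm '' V ⊆ A := by
    refine hVp.subset_left_of_subset_union hA (isClosed_closure (s := A)).isOpen_compl
      (Set.disjoint_left.2 fun z hz hz' => hz' (subset_closure hz)) (fun z hz => ?_) ⟨a, haV, haA⟩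
    by_cases h : z ∈ closure A
    · exact Or.inl (hcl ⟨h, hVi hz⟩)
    · exact Or.inr h
  filter_upwards [hU] with z hz
  have hzH : e z ∈ closure (interior (HS n)) := by
    rw [(𝓡∂ n).convex_range.closure_interior_eq_closure_of_nonempty_interior
      (𝓡∂ n).nonempty_interior]
    exact subset_closure (Set.mem_range_self _)
  have hzV : e z ∈ closure V := Metric.isOpen_ball.inter_closure ⟨hz.2, hzH⟩
  have hc : ContinuousWithinAt e.symm V (e z) :=
    (continuousOn_extChartAt_symm x (e z) (e.map_source hz.1)).mono hVt
  have := hc.mem_closure_image hzV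
  rw [e.left_inv hz.1] at this
  exact closure_mono hVA this

/-- A static potential of `g`. -/
structure IsPotential (g : Metric n M) (f : M → ℝ) : Prop where
  smooth : SmoothFun (n := n) f
  pos : ∀ x ∈ (𝓡∂ n).interior M, 0 < f x
  zero : ∀ x ∈ (𝓡∂ n).boundary M, f x = 0
  static : ∀ x ∈ (𝓡∂ n).interior M, ∀ v w : TangentSpace (𝓡∂ n) x,
      f x * ricci g x v w - hessian g f x v w + laplacian g f x * g.inner x v w = 0

namespace IsPotential

variable {g : Metric n M} {f : M → ℝ} (h : IsPotential g f)
include h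

lemma nonneg (x : M) : 0 ≤ f x := by
  by_cases hx : x ∈ (𝓡∂ n).interior M
  · exact (h.pos x hx).le
  · exact (h.zero x (mem_boundary_iff.2 hx)).ge

lemma mem_interior_iff {x : M} : x ∈ (𝓡∂ n).interior M ↔ 0 < f x := by
  refine ⟨h.pos x, fun hx => ?_⟩
  by_contra hx'
  exact hx.ne' (h.zero x (mem_boundary_iff.2 hx'))

lemma staticAt (x₀ : M) {y : Eu n} (hy : y ∈ (extChartAt (𝓡∂ n) x₀).target)
    (hi : y ∈ interior (HS n)) :
    StaticAt (metricCoord g x₀) (f ∘ (extChartAt (𝓡∂ n) x₀).symm) y :=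
  staticAt_chart x₀ hy hi g h.smooth
    (h.static _ ((chart_symm_mem_interior_iff x₀ hy).2 hi))

lemma trace {p : M} (hp : p ∈ (𝓡∂ n).interior M) :
    (n - 1) * laplacian g f p = -(f p * scalarCurvature g p) := by
  have := (h.staticAt p (mem_extChartAt_target p) (ext_mem_interior hp)).trace
    (metricAt_metricCoord g p (mem_extChartAt_target p))
  simp only [Function.comp_apply, extChartAt_to_inv] at this
  exact this

/-- A static metric has locally constant scalar curvature. -/
lemma eventually_scalarCurvature_eq {p : M} (hp : p ∈ (𝓡∂ n).interior M) :
    ∀ᶠ x in 𝓝 p, scalarCurvature g x = scalarCurvature g p := by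
  refine eventually_of_chart (n := n) ?_
  obtain ⟨r, hr, hball⟩ := Metric.eventually_nhds_iff_ball.1 (eventually_chart_target hp)
  refine Metric.eventually_nhds_iff_ball.2 ⟨r, hr, fun y hy => ?_⟩
  have hd : ∀ z ∈ Metric.ball (extChartAt (𝓡∂ n) p p) r,
      DifferentiableAt ℝ (scalCoord (metricCoord g p)) z := fun z hz =>
    ContDiffAt.diffAt ((metricAt_metricCoord g p (hball z hz).1).scalCoord_smooth.contDiffAt
      (hball z hz).2)
  have hd0 : ∀ z ∈ Metric.ball (extChartAt (𝓡∂ n) p p) r,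
      fderiv ℝ (scalCoord (metricCoord g p)) z = 0 := fun z hz => by
    have hz' := hball z hz
    have hev : ∀ᶠ y in 𝓝 z, y ∈ (extChartAt (𝓡∂ n) p).target ∧ y ∈ interior (HS n) :=
      Filter.mem_of_superset (Metric.isOpen_ball.mem_nhds hz) hball
    refine fderiv_scalCoord_eq_zero (F := f ∘ (extChartAt (𝓡∂ n) p).symm)
      (metricAt_metricCoord g p hz'.1) hz'.2
      (hev.mono fun y hy => smooth_comp_chart_symm h.smooth p hy.1)
      (h.pos _ ((chart_symm_mem_interior_iff p hz'.1).2 hz'.2)).ne'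
      (hev.mono fun y hy => h.staticAt p hy.1 hy.2)
  have := Metric.isOpen_ball.is_const_of_fderiv_eq_zero (convex_ball _ _).isPreconnected
    (fun z hz => (hd z hz).differentiableWithinAt) (fun z hz => hd0 z hz) hy
    (Metric.mem_ball_self hr)
  rw [scalarCurvature_eq_scalCoord p (hball y hy).1 (hball y hy).2, this]
  rfl

lemma isOpen_scalarCurvature (P : ℝ → Prop) :
    IsOpen {x | x ∈ (𝓡∂ n).interior M ∧ P (scalarCurvature g x)} := by
  refine isOpen_iff_mem_nhds.2 fun x hx => ?_
  filter_upwards [isOpen_interior_manifold.mem_nhds hx.1,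
    h.eventually_scalarCurvature_eq hx.1] with z hz hz'
  exact ⟨hz, by rw [hz']; exact hx.2⟩

/-- Static metrics have positive scalar curvature as soon as every component of the manifold has
a boundary. -/
lemma scalarCurvature_pos [CompactSpace M] (hn : 2 ≤ n)
    (hM : ∀ x : M, (connectedComponent x ∩ (𝓡∂ n).boundary M).Nonempty)
    {p : M} (hp : p ∈ (𝓡∂ n).interior M) : 0 < scalarCurvature g p := by
  by_contra! hneg
  have hn1 : (0 : ℝ) < n - 1 := by
    have : (2 : ℝ) ≤ n := by exact_mod_cast hn
    linarith
  have hfc := h.smooth.continuous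
  set A := {x | x ∈ (𝓡∂ n).interior M ∧ scalarCurvature g x ≤ 0} with hA
  have hAo : IsOpen A := h.isOpen_scalarCurvature (· ≤ 0)
  have hAcl : closure A ∩ (𝓡∂ n).interior M ⊆ A := by
    rintro x ⟨hx, hxi⟩
    obtain ⟨a, ha, haA⟩ := mem_closure_iff_nhds.1 hx _ (h.eventually_scalarCurvature_eq hxi)
    exact ⟨hxi, by rw [← show scalarCurvature g a = _ from ha]; exact haA.2⟩
  -- On `A` the potential is subharmonic. Its maximum over `closure A` is positive, hence attained
  -- at an interior point, which lies in `A`.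
  obtain ⟨z, hz, hzmax⟩ := (isClosed_closure (s := A)).isCompact.exists_isMaxOn
    ⟨p, subset_closure ⟨hp, hneg⟩⟩ hfc.continuousOn
  have hfz : 0 < f z := (h.pos p hp).trans_le (hzmax (subset_closure ⟨hp, hneg⟩))
  have hzA : z ∈ A := hAcl ⟨hz, h.mem_interior_iff.2 hfz⟩
  -- By the strong maximum principle `Z` is open. Its closure is clopen, so it contains the
  -- component of `z` and in particular a boundary point, where `f = 0`.
  set Z := {x | x ∈ A ∧ f x = f z} with hZ
  have hv : SmoothFun (n := n) fun x => f z - f x := contMDiff_const.sub h.smooth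
  have hZo : IsOpen Z := by
    refine isOpen_iff_mem_nhds.2 fun x hx => ?_
    have hxA := hAo.mem_nhds hx.1
    have := eventually_eq_zero_of_laplacian_nonpos g hv hx.1.1
      (by filter_upwards [hxA] with y hy using sub_nonneg.2 (hzmax (subset_closure hy)))
      (by
        filter_upwards [hxA] with y hy
        rw [laplacian_sub g contMDiff_const h.smooth, laplacian_const]
        have h1 := h.trace hy.1
        have h2 := h.pos y hy.1
        have h3 := hy.2
        have h4 : 0 ≤ (n - 1 : ℝ) * laplacian g f y := by rw [h1]; nlinarith
        have := nonneg_of_mul_nonneg_right h4 hn1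
        linarith)
      (by rw [hx.2, sub_self])
    filter_upwards [hxA, this] with y hy hy'
    exact ⟨hy, (sub_eq_zero.1 hy').symm⟩
  have hZf : closure Z ⊆ {x | f x = f z} :=
    closure_minimal (fun x hx => hx.2) (isClosed_eq hfc continuous_const)
  have hZcl : IsClopen (closure Z) := by
    refine isClopen_closure_of_subset_interior hZo (fun x hx => hx.1.1) ?_
    rintro x ⟨hx, hxi⟩
    exact ⟨hAcl ⟨closure_mono (fun y hy => hy.1) hx, hxi⟩, hZf hx⟩
  obtain ⟨b, hb, hbb⟩ := hM z
  have hbZ : b ∈ closure Z := hZcl.connectedComponent_subset (subset_closure ⟨hzA, rfl⟩) hb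
  have h1 : f b = f z := hZf hbZ
  rw [h.zero b hbb] at h1
  exact hfz.ne h1

end IsPotential

end ManifoldAnalysis

end ConformalStatic
end

open scoped Manifold ContDiff
noncomputable section
namespace ConformalStatic
open Filter Topology

/-! ### Non-degeneracy of a static potential at the boundary -/

section Boundary

variable {n : ℕ} [NeZero n]

section coordinates

variable {G : Eu n → Matrix (Fin n) (Fin n) ℝ} {F : Eu n → ℝ} {y : Eu n}

/-- A static potential solves a linear second order system. -/
lemma StaticAt.pderiv_pderiv (hn : 2 ≤ n) (h : StaticAt G F y) (hG : MetricAt G y) (i j : Fin n) :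
    pderiv i (pderiv j F) y = (∑ k, christoffel G k i j y * pderiv k F y) +
      (ricciCoord G i j y - scalCoord G y / (n - 1) * G y i j) * F y := by
  have hn1 : (n : ℝ) - 1 ≠ 0 := by
    have : (2 : ℝ) ≤ n := by exact_mod_cast hn
    intro h0; linarith
  have h1 := h i j
  have h2 := h.trace hG
  have h3 : lapCoord G F y = - (F y * scalCoord G y) / (n - 1) := by
    rw [← h2]; field_simp
  rw [h3] at h1
  unfold hessianCoord at h1
  linear_combination (-1) * h1

/-- Along a segment entering the interior, the vector `(F, ∂F)` solves a linear system with bounded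
coefficients, by `StaticAt.pderiv_pderiv`. If it tended to zero at `y`, Grönwall's inequality would
make it vanish, against `F ≠ 0` inside. -/
lemma exists_pderiv_ne_zero (hn : 2 ≤ n) (hG : MetricAt G y)
    (hF : ∀ᶠ z in 𝓝[HS n] y, Smooth F z)
    (hst : ∀ᶠ z in 𝓝[HS n] y, z ∈ interior (HS n) → StaticAt G F z ∧ F z ≠ 0)
    (h0 : F y = 0) : ∃ i, pderiv i F y ≠ 0 := by
  by_contra! hp
  have hyH : y ∈ HS n := hG.1
  set C : Fin n → Eu n → ℝ := fun j z =>
    ricciCoord G 0 j z - scalCoord G z / (n - 1) * G z 0 j with hC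
  set b : Fin n → Eu n → ℝ := fun j z => (∑ k, |christoffel G k 0 j z|) + |C j z| with hb
  have hbc : ∀ j, ContinuousWithinAt (b j) (HS n) y := by
    intro j
    have h1 : ∀ k, ContinuousWithinAt (christoffel G k 0 j) (HS n) y := fun k =>
      (hG.christoffel_smooth k 0 j).continuousWithinAt
    have h2 : ContinuousWithinAt (C j) (HS n) y :=
      (hG.ricciCoord_smooth 0 j).continuousWithinAt.sub
        ((hG.scalCoord_smooth.continuousWithinAt.div_const _).mul
          (hG.smooth 0 j).continuousWithinAt)
    exact (tendsto_finsetSum _ fun k _ => (h1 k).abs).add h2.abs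
  set K : ℝ := 1 + ∑ j, b j y with hK
  have hbnn : ∀ j z, 0 ≤ b j z := fun j z => by positivity
  have hK1 : 1 ≤ K := by
    have : 0 ≤ ∑ j, b j y := Finset.sum_nonneg fun j _ => hbnn j y
    linarith
  have hbK : ∀ᶠ z in 𝓝[HS n] y, ∀ j, b j z < K := by
    refine Filter.eventually_all.2 fun j => (hbc j).eventually (gt_mem_nhds ?_)
    have := Finset.single_le_sum (f := fun j => b j y) (fun j _ => hbnn j y) (Finset.mem_univ j)
    linarith
  obtain ⟨r, hr, hball⟩ := Metric.mem_nhdsWithin_iff.1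
    (hF.and (hst.and (hbK.and hG.eventually)))
  -- Coordinate `0` is the one bounding the half-space, so `γ t` is interior for every `t > 0`, even
  -- if `y` is on the boundary.
  set γ : ℝ → Eu n := fun t => y + t • bv 0 with hγ
  have hγint : ∀ t, 0 < t → γ t ∈ interior (HS n) := fun t ht => by
    rw [mem_interior_HS]
    have := mem_HS.1 hyH
    simp [hγ]
    linarith
  have hγball : ∀ t, 0 < t → t < r → γ t ∈ Metric.ball y r ∩ HS n := fun t ht htr => by
    refine ⟨?_, interior_subset (hγint t ht)⟩
    rw [Metric.mem_ball, dist_eq_norm, hγ]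
    simp [norm_smul, abs_of_pos ht, htr]
  have hγd : ∀ t, HasDerivAt γ (bv 0) t := fun t => by
    have h1 : HasDerivAt (fun t : ℝ => t • bv (0 : Fin n)) (bv 0) t := by
      simpa using (hasDerivAt_id t).smul_const (bv (0 : Fin n))
    exact h1.const_add y
  set N : ℝ → ℝ × (Fin n → ℝ) := fun t => (F (γ t), fun j => pderiv j F (γ t)) with hN
  set N' : ℝ → ℝ × (Fin n → ℝ) :=
    fun t => (pderiv 0 F (γ t), fun j => pderiv 0 (pderiv j F) (γ t)) with hN'
  have hcomp : ∀ {K : Eu n → ℝ} t, 0 < t → Smooth K (γ t) →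
      HasDerivAt (fun t => K (γ t)) (pderiv 0 K (γ t)) t := by
    intro K t ht hK
    rw [pderiv_eq_fderiv (hγint t ht)]
    exact (ContDiffAt.diffAt (hK.contDiffAt (hγint t ht))).hasFDerivAt.comp_hasDerivAt t (hγd t)
  have hd : ∀ t, 0 < t → t < r → HasDerivAt N (N' t) t := by
    intro t ht htr
    have hs := (hball (hγball t ht htr)).1
    exact (hcomp t ht hs).prodMk (hasDerivAt_pi.2 fun j =>
      hcomp t ht (hs.pderiv (interior_subset (hγint t ht)) j))
  have hbound : ∀ t, 0 < t → t < r → ‖N' t‖ ≤ K * ‖N t‖ + 0 := by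
    intro t ht htr
    obtain ⟨-, hst', hb', hG'⟩ := hball (hγball t ht htr)
    have hst' := (hst' (hγint t ht)).1
    have h1 : |F (γ t)| ≤ ‖N t‖ := norm_fst_le (N t)
    have h2 : ∀ k, |pderiv k F (γ t)| ≤ ‖N t‖ := fun k =>
      (norm_le_pi_norm (N t).2 k).trans (norm_snd_le (N t))
    have hNn : 0 ≤ ‖N t‖ := norm_nonneg _
    rw [add_zero]
    refine norm_prod_le_iff.2 ⟨?_, (pi_norm_le_iff_of_nonneg (by positivity)).2 fun j => ?_⟩
    · refine (h2 0).trans ?_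
      nlinarith
    · change |pderiv 0 (pderiv j F) (γ t)| ≤ _
      rw [hst'.pderiv_pderiv hn hG']
      refine (abs_add_le _ _).trans ?_
      have e1 : |∑ k, christoffel G k 0 j (γ t) * pderiv k F (γ t)| ≤
          (∑ k, |christoffel G k 0 j (γ t)|) * ‖N t‖ := by
        rw [Finset.sum_mul]
        refine (Finset.abs_sum_le_sum_abs _ _).trans (Finset.sum_le_sum fun k _ => ?_)
        rw [abs_mul]
        exact mul_le_mul_of_nonneg_left (h2 k) (abs_nonneg _)
      have e2 : |C j (γ t) * F (γ t)| ≤ |C j (γ t)| * ‖N t‖ := by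
        rw [abs_mul]
        exact mul_le_mul_of_nonneg_left h1 (abs_nonneg _)
      have e3 := mul_le_mul_of_nonneg_right (hb' j).le hNn
      simp only [hb, add_mul] at e3
      exact (add_le_add e1 e2).trans e3
  have hlim : Tendsto N (𝓝[>] 0) (𝓝 0) := by
    have hs : Smooth F y := hF.self_of_nhdsWithin hyH
    have hγt : Tendsto γ (𝓝[>] 0) (𝓝[HS n] y) := by
      refine tendsto_nhdsWithin_iff.2 ⟨?_, ?_⟩
      · have : Tendsto γ (𝓝 0) (𝓝 y) := by simpa [hγ] using (hγd 0).continuousAt.tendsto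
        exact this.mono_left nhdsWithin_le_nhds
      · filter_upwards [self_mem_nhdsWithin] with t ht
        exact interior_subset (hγint t ht)
    have e0 : (0 : ℝ × (Fin n → ℝ)) = (F y, fun j => pderiv j F y) := by
      rw [h0]; simp only [hp]; rfl
    rw [e0]
    exact (hs.continuousWithinAt.tendsto.comp hγt).prodMk_nhds (tendsto_pi_nhds.2 fun j =>
      (hs.pderiv hyH j).continuousWithinAt.tendsto.comp hγt)
  have hr2 : 0 < r / 2 := by positivity
  -- Grönwall is applied from `s > 0`, where ordinary derivatives exist, and then `s` tends to `0`.
  have hgr : ∀ s, 0 < s → s ≤ r / 2 → ‖N (r / 2)‖ ≤ ‖N s‖ * Real.exp (K * (r / 2)) := by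
    intro s hs hsr
    have := norm_le_gronwallBound_of_norm_deriv_right_le (f := N) (f' := N') (δ := ‖N s‖) (K := K)
      (ε := 0) (a := s) (b := r / 2)
      (fun t ht => (hd t (hs.trans_le ht.1) (by linarith [ht.2])).continuousAt.continuousWithinAt)
      (fun t ht => (hd t (hs.trans_le ht.1) (by linarith [ht.2])).hasDerivWithinAt) le_rfl
      (fun t ht => hbound t (hs.trans_le ht.1) (by linarith [ht.2])) (r / 2) ⟨hsr, le_rfl⟩
    rw [gronwallBound_ε0] at this
    refine this.trans (mul_le_mul_of_nonneg_left (Real.exp_le_exp.2 ?_) (norm_nonneg _))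
    nlinarith
  have hzero : ‖N (r / 2)‖ ≤ 0 := by
    have ht : Tendsto (fun s => ‖N s‖ * Real.exp (K * (r / 2))) (𝓝[>] 0) (𝓝 0) := by
      simpa using hlim.norm.mul_const (Real.exp (K * (r / 2)))
    refine ge_of_tendsto ht ?_
    filter_upwards [Ioc_mem_nhdsGT hr2] with s hs
    exact hgr s hs.1 hs.2
  have h1 : |F (γ (r / 2))| ≤ ‖N (r / 2)‖ := norm_fst_le (N (r / 2))
  have h2 := ((hball (hγball (r / 2) hr2 (by linarith))).2.1 (hγint _ hr2)).2
  exact h2 (abs_eq_zero.1 (le_antisymm (h1.trans hzero) (abs_nonneg _)))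

end coordinates

variable {M : Type*} [TopologicalSpace M]
  [ChartedSpace (EuclideanHalfSpace n) M] [IsManifold (𝓡∂ n) ∞ M] {g : Metric n M} {f : M → ℝ}

lemma gradSq_eq_gradSqCoord (g : Metric n M) (hf : SmoothFun (n := n) f) (x₀ : M) {y : Eu n}
    (hy : y ∈ (extChartAt (𝓡∂ n) x₀).target) (hi : y ∈ interior (HS n)) :
    gradSq g f ((extChartAt (𝓡∂ n) x₀).symm y) =
      gradSqCoord (metricCoord g x₀) (f ∘ (extChartAt (𝓡∂ n) x₀).symm) y :=
  ((pullback_chart_change x₀ _ hy (mem_extChartAt_source _) g hi).gradSq_law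
    (smooth_comp_chart_symm hf _ (mem_extChartAt_target _))
    (comp_chart_change x₀ _ hy (mem_extChartAt_source _) f hi)).symm

/-- Near the boundary, the gradient of a static potential is bounded below and the scalar
curvature is bounded above. -/
lemma IsPotential.eventually_boundary (h : IsPotential g f) (hn : 2 ≤ n) {x : M}
    (hx : x ∈ (𝓡∂ n).boundary M) : ∃ a > 0, ∃ C, ∀ᶠ z in 𝓝 x, z ∈ (𝓡∂ n).interior M →
      a ≤ gradSq g f z ∧ scalarCurvature g z ≤ C := by
  set e := extChartAt (𝓡∂ n) x with he
  have hG := metricAt_metricCoord g x (mem_extChartAt_target x)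
  have ht : ∀ᶠ y in 𝓝[HS n] (e x), y ∈ e.target := extChartAt_target_mem_nhdsWithin x
  have hs := h.smooth.smooth_chart x
  obtain ⟨i, hi⟩ := exists_pderiv_ne_zero (F := f ∘ e.symm) hn hG
    (ht.mono fun y hy => smooth_comp_chart_symm h.smooth x hy)
    (ht.mono fun y hy hyi => ⟨h.staticAt x hy hyi,
      (h.pos _ ((chart_symm_mem_interior_iff x hy).2 hyi)).ne'⟩)
    (by simp only [Function.comp_apply, he]; rw [extChartAt_to_inv]; exact h.zero x hx)
  have hpos : 0 < gradSqCoord (metricCoord g x) (f ∘ e.symm) (e x) := gradSqCoord_pos hG.posDef hi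
  refine ⟨gradSqCoord (metricCoord g x) (f ∘ e.symm) (e x) / 2, by positivity,
    scalCoord (metricCoord g x) (e x) + 1, ?_⟩
  have h1 := (hG.gradSqCoord_smooth hs).continuousWithinAt.eventually
    (lt_mem_nhds (half_lt_self hpos))
  have h2 := hG.scalCoord_smooth.continuousWithinAt.eventually
    (gt_mem_nhds (lt_add_one (scalCoord (metricCoord g x) (e x))))
  have he' : Tendsto e (𝓝 x) (𝓝[HS n] (e x)) :=
    tendsto_nhdsWithin_iff.2 ⟨continuousAt_extChartAt x,
      Filter.Eventually.of_forall fun z => Set.mem_range_self _⟩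
  filter_upwards [he'.eventually h1, he'.eventually h2, extChartAt_source_mem_nhds (I := 𝓡∂ n) x]
    with z hz1 hz2 hz hzi
  have hzi' := (chart_mem_interior_iff hz).2 hzi
  have hzt := e.map_source hz
  have e1 := gradSq_eq_gradSqCoord g h.smooth x hzt hzi'
  have e2 := scalarCurvature_eq_scalCoord x hzt hzi' g
  rw [(extChartAt (𝓡∂ n) x).left_inv hz] at e1 e2
  rw [e1, e2]
  exact ⟨hz1.le, hz2.le⟩

end Boundary

end ConformalStatic
end

open scoped Manifold ContDiff
noncomputable section
namespace ConformalStatic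
open Filter Topology

/-! ### Comparison with a static potential -/

section Comparison

variable {n : ℕ} [NeZero n] {M : Type*} [TopologicalSpace M]
  [ChartedSpace (EuclideanHalfSpace n) M] [IsManifold (𝓡∂ n) ∞ M] {g : Metric n M} {f : M → ℝ}

lemma IsPotential.laplacian_eq (h : IsPotential g f) (hn : 2 ≤ n) {p : M}
    (hp : p ∈ (𝓡∂ n).interior M) :
    laplacian g f p = - (scalarCurvature g p / (n - 1) * f p) := by
  have hn1 : (n : ℝ) - 1 ≠ 0 := by
    have : (2 : ℝ) ≤ n := by exact_mod_cast hn
    intro h0; linarith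
  have := h.trace hp
  field_simp
  linarith

/-- The bounds of `IsPotential.eventually_boundary` hold uniformly where the potential is small. -/
lemma IsPotential.exists_uniform_bounds [CompactSpace M] (h : IsPotential g f) (hn : 2 ≤ n) :
    ∃ a > 0, ∃ C, ∃ δ > 0, ∀ z ∈ (𝓡∂ n).interior M, f z ≤ δ →
      a ≤ gradSq g f z ∧ scalarCurvature g z ≤ C := by
  have key := isCompact_univ.induction_on (X := M)
    (p := fun s => ∃ a > 0, ∃ C, ∃ δ > 0, ∀ z ∈ s, z ∈ (𝓡∂ n).interior M → f z ≤ δ →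
      a ≤ gradSq g f z ∧ scalarCurvature g z ≤ C) ?_ ?_ ?_ ?_
  · obtain ⟨a, ha, C, δ, hδ, H⟩ := key
    exact ⟨a, ha, C, δ, hδ, fun z => H z trivial⟩
  · exact ⟨1, one_pos, 0, 1, one_pos, fun z hz => hz.elim⟩
  · rintro s t hst ⟨a, ha, C, δ, hδ, H⟩
    exact ⟨a, ha, C, δ, hδ, fun z hz => H z (hst hz)⟩
  · rintro s t ⟨a, ha, C, δ, hδ, H⟩ ⟨a', ha', C', δ', hδ', H'⟩
    refine ⟨min a a', lt_min ha ha', max C C', min δ δ', lt_min hδ hδ', fun z hz hzi hzδ => ?_⟩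
    rcases hz with hz | hz
    · have := H z hz hzi (hzδ.trans (min_le_left _ _))
      exact ⟨(min_le_left _ _).trans this.1, this.2.trans (le_max_left _ _)⟩
    · have := H' z hz hzi (hzδ.trans (min_le_right _ _))
      exact ⟨(min_le_right _ _).trans this.1, this.2.trans (le_max_right _ _)⟩
  · intro x _
    rw [nhdsWithin_univ]
    by_cases hx : x ∈ (𝓡∂ n).interior M
    · have hfx := h.pos x hx
      -- Near an interior point `f` exceeds `f x / 2`, so with `δ = f x / 2` the claim is vacuous.
      refine ⟨_, h.smooth.continuous.continuousAt.eventually (lt_mem_nhds (half_lt_self hfx)),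
        1, one_pos, 0, f x / 2, by positivity, fun z hz _ hzf => ?_⟩
      exact absurd hzf (not_le.2 hz)
    · obtain ⟨a, ha, C, H⟩ := h.eventually_boundary hn (mem_boundary_iff.2 hx)
      exact ⟨_, H, a, ha, C, 1, one_pos, fun z hz hzi _ => hz hzi⟩

/-- Near the boundary, `1 - B f ^ 2` is a strict supersolution of `Δ + R / (n - 1)`. -/
lemma IsPotential.exists_barrier [CompactSpace M] (h : IsPotential g f) (hn : 2 ≤ n)
    (hR : ∀ p ∈ (𝓡∂ n).interior M, 0 < scalarCurvature g p) :
    ∃ B δ₀, 0 < B ∧ 0 < δ₀ ∧ ∀ δ, 0 < δ → δ ≤ δ₀ → B * δ ^ 2 ≤ 1 / 2 ∧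
      ∀ z ∈ (𝓡∂ n).interior M, f z ≤ δ → laplacian g (fun x => 1 - B * f x ^ 2) z +
        scalarCurvature g z / (n - 1) * (1 - B * f z ^ 2) < 0 := by
  have hn1 : (1 : ℝ) ≤ n - 1 := by
    have : (2 : ℝ) ≤ n := by exact_mod_cast hn
    linarith
  obtain ⟨a, ha, C, δ₁, hδ₁, H⟩ := h.exists_uniform_bounds hn
  set D := |C| + 1 with hD
  have hDpos : 0 < D := by positivity
  -- With `L = R/(n-1)`, applying `Δ + L` to `1 - B f²` gives `L + L B f² - 2 B |∇f|²`. Here `L ≤ D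
  -- - 1`, `B f² ≤ 1/2` and `B |∇f|² ≥ D`, so the value is at most `3L/2 - 2D < 0`.
  refine ⟨D / a, min δ₁ (min 1 (a / (2 * D))), by positivity, by positivity, fun δ hδ hδ' => ?_⟩
  have h1 : δ ≤ δ₁ := hδ'.trans (min_le_left _ _)
  have h2 : δ ≤ 1 := hδ'.trans ((min_le_right _ _).trans (min_le_left _ _))
  have h3 : δ ≤ a / (2 * D) := hδ'.trans ((min_le_right _ _).trans (min_le_right _ _))
  rw [le_div_iff₀ (by positivity)] at h3
  have h4 : δ ^ 2 ≤ δ := by nlinarith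
  have h5 : D * δ ^ 2 ≤ a / 2 := by nlinarith
  have hB : D / a * δ ^ 2 ≤ 1 / 2 := by
    rw [div_mul_eq_mul_div, div_le_iff₀ ha]; linarith
  refine ⟨hB, fun z hz hzδ => ?_⟩
  obtain ⟨hga, hRC⟩ := H z hz (hzδ.trans h1)
  set B := D / a with hBdef
  have hBpos : 0 < B := by positivity
  have hBa : B * a = D := by rw [hBdef]; field_simp
  set L := scalarCurvature g z / (n - 1) with hL
  have hL0 : 0 < L := div_pos (hR z hz) (by linarith)
  have hLD : L ≤ D - 1 := by
    have : L ≤ scalarCurvature g z := div_le_self (hR z hz).le hn1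
    rw [hD]; linarith [le_abs_self C]
  have hh : ContDiff ℝ ∞ (fun x : ℝ => 1 - B * x ^ 2) := by fun_prop
  have hd1 : deriv (fun x : ℝ => 1 - B * x ^ 2) = fun x => -(2 * B) * x := by
    ext x
    have := (((hasDerivAt_pow 2 x).const_mul B).const_sub 1).deriv
    rw [this]; simp; ring
  have hd2 : deriv (fun x : ℝ => -(2 * B) * x) = fun _ => -(2 * B) := by
    ext x; simp
  rw [laplacian_comp g h.smooth z (h := fun x => 1 - B * x ^ 2) hh, hd1, hd2, h.laplacian_eq hn hz]
  have hf0 := h.pos z hz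
  have h6 : f z ^ 2 ≤ δ ^ 2 := by nlinarith
  have h7 : B * f z ^ 2 ≤ 1 / 2 := by nlinarith
  have h8 : D ≤ B * gradSq g f z := by rw [← hBa]; nlinarith
  have h9 : L * (B * f z ^ 2) ≤ L * (1 / 2) := mul_le_mul_of_nonneg_left h7 hL0.le
  nlinarith

/-- A supersolution of `Δ + R / (n - 1)` vanishing on the boundary is touched from below, in the
interior, by a multiple of the potential. -/
lemma IsPotential.exists_touching [CompactSpace M] (h : IsPotential g f) (hn : 2 ≤ n)
    (hR : ∀ p ∈ (𝓡∂ n).interior M, 0 < scalarCurvature g p) {φ : M → ℝ}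
    (hφ : SmoothFun (n := n) φ) (hφ0 : ∀ x ∈ (𝓡∂ n).boundary M, φ x = 0)
    (hsup : ∀ x ∈ (𝓡∂ n).interior M,
      laplacian g φ x + scalarCurvature g x / (n - 1) * φ x ≤ 0)
    {S : Set M} (hS : IsClopen S) (hSi : (S ∩ (𝓡∂ n).interior M).Nonempty) :
    ∃ z ∈ S ∩ (𝓡∂ n).interior M, ∀ x ∈ S, φ z / f z * f x ≤ φ x := by
  obtain ⟨B, δ₀, hB, hδ₀, H⟩ := h.exists_barrier hn hR
  obtain ⟨x₁, hx₁S, hx₁⟩ := hSi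
  have hfx₁ := h.pos x₁ hx₁
  set δ := min δ₀ (f x₁) with hδdef
  have hδ : 0 < δ := lt_min hδ₀ hfx₁
  obtain ⟨hBδ, hbar⟩ := H δ hδ (min_le_left _ _)
  have hfc := h.smooth.continuous
  have hφc := hφ.continuous
  have hint : ∀ x, 0 < f x → x ∈ (𝓡∂ n).interior M := fun x hx => h.mem_interior_iff.2 hx
  -- The touching point is sought where `f ≥ δ`, away from the boundary. It remains to show that `φ
  -- ≥ m f` persists in the collar `f < δ`.
  obtain ⟨z₁, hz₁, hz₁min⟩ := (hS.isClosed.inter (isClosed_le continuous_const hfc)).isCompact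
    |>.exists_isMinOn (s := S ∩ {x | δ ≤ f x}) (f := fun x => φ x / f x)
    ⟨x₁, hx₁S, show δ ≤ f x₁ from min_le_right _ _⟩
    (hφc.continuousOn.div hfc.continuousOn fun x hx => (hδ.trans_le hx.2).ne')
  set m := φ z₁ / f z₁ with hm
  have hmin : ∀ x ∈ S, δ ≤ f x → m * f x ≤ φ x := fun x hx hxδ => by
    have h1 : m ≤ φ x / f x := hz₁min ⟨hx, hxδ⟩
    rwa [le_div_iff₀ (hδ.trans_le hxδ)] at h1
  refine ⟨z₁, ⟨hz₁.1, hint _ (hδ.trans_le hz₁.2)⟩, ?_⟩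
  by_contra! hneg
  obtain ⟨x₂, hx₂S, hx₂⟩ := hneg
  have hx₂δ : f x₂ < δ := by
    by_contra! hge
    exact absurd (hmin x₂ hx₂S hge) (not_le.2 hx₂)
  have hx₂i : x₂ ∈ (𝓡∂ n).interior M := by
    by_contra hb
    rw [hφ0 x₂ (mem_boundary_iff.2 hb), h.zero x₂ (mem_boundary_iff.2 hb)] at hx₂
    simp at hx₂
  set ε := (m * f x₂ - φ x₂) / 2 with hε
  have hεpos : 0 < ε := by rw [hε]; linarith
  set b : M → ℝ := fun x => 1 - B * f x ^ 2 with hb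
  have hbs : SmoothFun (n := n) b :=
    (show ContDiff ℝ ∞ (fun x : ℝ => 1 - B * x ^ 2) by fun_prop).contMDiff.comp h.smooth
  -- A small multiple of the barrier makes `ψ` positive both on the boundary and on `f = δ`, while
  -- `ε` keeps it negative at `x₂`. Minimising the quotient `ψ / f`, instead of `ψ`, copes with the
  -- zero order term of positive sign.
  set ψ : M → ℝ := fun x => φ x - m * f x + ε * b x with hψ
  have hmf : SmoothFun (n := n) fun x => m * f x := contMDiff_const.mul h.smooth
  have hεb : SmoothFun (n := n) fun x => ε * b x := contMDiff_const.mul hbs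
  have hψs : SmoothFun (n := n) ψ := (hφ.sub hmf).add hεb
  have hψc := hψs.continuous
  have hψx₂ : ψ x₂ < 0 := by
    have : 0 ≤ B * f x₂ ^ 2 := by positivity
    simp only [hψ, hb]
    nlinarith
  have hbhalf : ∀ x, f x ≤ δ → 1 / 2 ≤ b x := fun x hx => by
    have h1 := h.nonneg x
    have h2 : f x ^ 2 ≤ δ ^ 2 := by nlinarith
    simp only [hb]
    nlinarith
  have hK2f : ∀ x, ψ x ≤ 0 → 0 < f x := by
    intro x hx
    refine lt_of_le_of_ne (h.nonneg x) fun h0 => ?_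
    have hxb : x ∈ (𝓡∂ n).boundary M := mem_boundary_iff.2 fun hi => (h.pos x hi).ne h0
    have : ψ x = ε := by
      simp only [hψ, hb, hφ0 x hxb, ← h0]; ring
    linarith
  obtain ⟨z, hz, hzmin⟩ := ((hS.isClosed.inter (isClosed_le hfc continuous_const)).inter
    (isClosed_le hψc continuous_const)).isCompact
    |>.exists_isMinOn (s := (S ∩ {x | f x ≤ δ}) ∩ {x | ψ x ≤ 0}) (f := fun x => ψ x / f x)
    ⟨x₂, ⟨hx₂S, hx₂δ.le⟩, hψx₂.le⟩
    (hψc.continuousOn.div hfc.continuousOn fun x hx => (hK2f x hx.2).ne')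
  obtain ⟨⟨hzS, hzδ⟩, hzψ⟩ := hz
  have hfz : 0 < f z := hK2f z hzψ
  have hzi := hint z hfz
  set c := ψ z / f z with hc
  have hcneg : c < 0 := by
    have h1 : c ≤ ψ x₂ / f x₂ := hzmin ⟨⟨hx₂S, hx₂δ.le⟩, hψx₂.le⟩
    exact h1.trans_lt (div_neg_of_neg_of_pos hψx₂ (h.pos x₂ hx₂i))
  have hcz : c * f z = ψ z := by rw [hc]; field_simp
  have hψz : ψ z < 0 := by rw [← hcz]; exact mul_neg_of_neg_of_pos hcneg hfz
  have hzδ' : f z < δ := by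
    refine lt_of_le_of_ne hzδ fun he => ?_
    have h1 := hmin z hzS he.ge
    have h2 := hbhalf z hzδ
    simp only [hψ] at hψz
    nlinarith
  have hcf : SmoothFun (n := n) fun x => c * f x := contMDiff_const.mul h.smooth
  -- This function vanishes at `z`, so its Laplacian there equals its image under `Δ + L`. That
  -- image is negative, since `φ` is a supersolution, `b` a strict one and `f` a solution.
  have hloc : IsLocalMin (fun x => ψ x - c * f x) z := by
    filter_upwards [hS.isOpen.mem_nhds hzS, hfc.continuousAt.eventually (gt_mem_nhds hzδ'),
      hψc.continuousAt.eventually (gt_mem_nhds hψz)] with x hxS hxδ hxψ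
    have h1 : c ≤ ψ x / f x := hzmin ⟨⟨hxS, hxδ.le⟩, hxψ.le⟩
    rw [le_div_iff₀ (hK2f x hxψ.le)] at h1
    rw [hcz, sub_self]
    linarith
  have hlap := laplacian_nonneg_of_isLocalMin g (hψs.sub hcf) hzi hloc
  have e1 : laplacian g (fun x => ψ x - c * f x) z = laplacian g φ z - m * laplacian g f z +
      ε * laplacian g b z - c * laplacian g f z := by
    rw [laplacian_sub g hψs hcf, laplacian_const_mul g h.smooth]
    congr 1
    rw [hψ, laplacian_add g (hφ.sub hmf) hεb, laplacian_sub g hφ hmf,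
      laplacian_const_mul g h.smooth, laplacian_const_mul g hbs]
  have hlap' : 0 ≤ laplacian g (fun x => ψ x - c * f x) z := hlap
  rw [e1, h.laplacian_eq hn hzi] at hlap'
  have h1 := hbar z hzi hzδ
  have h2 := hsup z hzi
  have h3 := mul_neg_of_pos_of_neg hεpos h1
  set L := scalarCurvature g z / (n - 1) with hL
  have h4 : L * (c * f z) = L * (φ z - m * f z + ε * b z) := by rw [hcz]
  have h5 : ε * (laplacian g b z + L * b z) < 0 := h3
  nlinarith

variable (h : IsPotential g f) (hn : 2 ≤ n)
  (hR : ∀ p ∈ (𝓡∂ n).interior M, 0 < scalarCurvature g p) {φ : M → ℝ}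
  (hφ : SmoothFun (n := n) φ) (hφ0 : ∀ x ∈ (𝓡∂ n).boundary M, φ x = 0)
  (hsup : ∀ x ∈ (𝓡∂ n).interior M,
    laplacian g φ x ≤ scalarCurvature g x / (n - 1) * (1 - Real.exp (φ x)))
include h hn hR hφ hφ0 hsup

/-- At the touching point the second derivative test gives `L (1 - e^φ + φ) ≥ 0`. Strict convexity
of the exponential leaves only `φ = 0` there, so the touching multiple of `f` is zero. -/
lemma IsPotential.nonneg_of_supersolution [CompactSpace M] {S : Set M} (hS : IsClopen S)
    (hSi : (S ∩ (𝓡∂ n).interior M).Nonempty) :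
    (∃ z ∈ S ∩ (𝓡∂ n).interior M, φ z = 0) ∧ ∀ x ∈ S, 0 ≤ φ x := by
  have hn1 : (0 : ℝ) < n - 1 := by
    have : (2 : ℝ) ≤ n := by exact_mod_cast hn
    linarith
  have hL : ∀ x ∈ (𝓡∂ n).interior M, 0 < scalarCurvature g x / (n - 1) :=
    fun x hx => div_pos (hR x hx) hn1
  obtain ⟨z, hz, hzmin⟩ := h.exists_touching hn hR hφ hφ0 (fun x hx => by
    have h1 := hsup x hx
    have h2 := hL x hx
    have h3 := Real.add_one_le_exp (φ x)
    nlinarith) hS hSi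
  have hfz := h.pos z hz.2
  set q := φ z / f z with hq
  have hqz : q * f z = φ z := by rw [hq]; field_simp
  have hqf : SmoothFun (n := n) fun x => q * f x := contMDiff_const.mul h.smooth
  have hloc : IsLocalMin (fun x => φ x - q * f x) z := by
    filter_upwards [hS.isOpen.mem_nhds hz.1] with x hx
    rw [hqz, sub_self]
    exact sub_nonneg.2 (hzmin x hx)
  have hlap : 0 ≤ laplacian g (fun x => φ x - q * f x) z :=
    laplacian_nonneg_of_isLocalMin g (hφ.sub hqf) hz.2 hloc
  rw [laplacian_sub g hφ hqf, laplacian_const_mul g h.smooth, h.laplacian_eq hn hz.2] at hlap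
  have hφz : φ z = 0 := by
    by_contra hne
    have h1 := hsup z hz.2
    have h2 := hL z hz.2
    have h3 := Real.add_one_lt_exp hne
    set L := scalarCurvature g z / (n - 1)
    have h4 : q * (L * f z) = L * φ z := by rw [← hqz]; ring
    nlinarith
  refine ⟨⟨z, hz, hφz⟩, fun x hx => ?_⟩
  have := hzmin x hx
  rwa [hq, hφz, zero_div, zero_mul] at this

lemma IsPotential.eq_zero_of_supersolution [CompactSpace M] (p : M) : φ p = 0 := by
  by_cases hp : p ∈ (𝓡∂ n).interior M
  swap
  · exact hφ0 p (mem_boundary_iff.2 hp)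
  have hn1 : (0 : ℝ) < n - 1 := by
    have : (2 : ℝ) ≤ n := by exact_mod_cast hn
    linarith
  have hnn : ∀ x, 0 ≤ φ x := fun x =>
    (h.nonneg_of_supersolution hn hR hφ hφ0 hsup isClopen_univ ⟨p, trivial, hp⟩).2 x trivial
  have hφc := hφ.continuous
  have hMP : ∀ x ∈ (𝓡∂ n).interior M, φ x = 0 → ∀ᶠ z in 𝓝 x, φ z = 0 := fun x hx hx0 =>
    eventually_eq_zero_of_laplacian_nonpos g hφ hx (Filter.Eventually.of_forall hnn) (by
      filter_upwards [isOpen_interior_manifold.mem_nhds hx] with z hz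
      have h1 := hsup z hz
      have h2 := div_pos (hR z hz) hn1
      have h3 := Real.one_le_exp (hnn z)
      nlinarith) hx0
  set Z := {x | x ∈ (𝓡∂ n).interior M ∧ φ x = 0} with hZ
  have hZo : IsOpen Z := isOpen_iff_mem_nhds.2 fun x hx =>
    Filter.inter_mem (isOpen_interior_manifold.mem_nhds hx.1) (hMP x hx.1 hx.2)
  have hZ0 : closure Z ⊆ {x | φ x = 0} :=
    closure_minimal (fun x hx => hx.2) (isClosed_eq hφc continuous_const)
  have hZcl : IsClopen (closure Z) :=
    isClopen_closure_of_subset_interior hZo (fun x hx => hx.1) fun x hx => ⟨hx.2, hZ0 hx.1⟩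
  by_contra hne
  -- Arbitrary clopen sets were allowed for this use: the complement of `closure Z` would contain an
  -- interior zero of `φ`, which belongs to `Z`.
  obtain ⟨⟨z, hz, hz0⟩, -⟩ := h.nonneg_of_supersolution hn hR hφ hφ0 hsup hZcl.compl
    ⟨p, fun hpZ => hne (hZ0 hpZ), hp⟩
  exact hz.1 (subset_closure ⟨hz.2, hz0⟩)

end Comparison

/-! ### Conformal change of the scalar curvature on the manifold -/

section Conformal

variable {n : ℕ} [NeZero n] {M : Type*} [TopologicalSpace M]
  [ChartedSpace (EuclideanHalfSpace n) M] [IsManifold (𝓡∂ n) ∞ M] {g₀ g : Metric n M}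

/-- The formula for the scalar curvature of the conformal metric `e ^ φ • g₀`. -/
lemma conformal_scalarCurvature {φ : M → ℝ} (hφ : SmoothFun (n := n) φ)
    (hg : ∀ x, g.inner x = Real.exp (φ x) • g₀.inner x) {p : M} (hp : p ∈ (𝓡∂ n).interior M) :
    Real.exp (φ p) * scalarCurvature g p = scalarCurvature g₀ p - (n - 1) * laplacian g₀ φ p -
      (n - 1) * (n - 2) / 4 * gradSq g₀ φ p := by
  have := conformal_scalCoord (φ := φ ∘ (extChartAt (𝓡∂ n) p).symm)
    (metricAt_metricCoord g₀ p (mem_extChartAt_target p)) (ext_mem_interior hp)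
    (metricAt_metricCoord g p (mem_extChartAt_target p)) (hφ.smooth_chart p)
    (Filter.Eventually.of_forall fun z => by
      ext i j
      rw [Matrix.smul_apply, smul_eq_mul]
      simp only [metricCoord, Matrix.of_apply, Function.comp_apply]
      rw [hg]; rfl)
  simp only [Function.comp_apply, extChartAt_to_inv] at this
  exact this

end Conformal

end ConformalStatic
end

/-! ### Rigidity in the conformal class -/

theorem mainTheorem4 {n : ℕ} [NeZero n] (hn : 2 ≤ n)
    {M : Type*} [TopologicalSpace M] [T2Space M] [CompactSpace M]
    [ChartedSpace (EuclideanHalfSpace n) M] [IsManifold (𝓡∂ n) ∞ M]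
    (hM : ∀ x : M, (connectedComponent x ∩ (𝓡∂ n).boundary M).Nonempty)
    (g₀ g : ConformalStatic.Metric n M)
    (hstatic : ConformalStatic.IsStatic g₀)
    (hconf : g ∈ ConformalStatic.conformalClass g₀)
    (hbdry : ∀ x ∈ (𝓡∂ n).boundary M, g.inner x = g₀.inner x)
    (hR : ∀ x : M, ConformalStatic.scalarCurvature g₀ x ≤ ConformalStatic.scalarCurvature g x) :
    g = g₀ := by
  obtain ⟨f, hf, hpos, hzero, hst⟩ := hstatic
  have h : ConformalStatic.IsPotential g₀ f := ⟨hf, hpos, hzero, hst⟩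
  obtain ⟨μ, hμ, hμpos, hμg⟩ := hconf
  have hn2 : (2 : ℝ) ≤ n := by exact_mod_cast hn
  have hφ : ConformalStatic.SmoothFun (n := n) fun x => Real.log (μ x) := fun x =>
    ((Real.contDiffAt_log.2 (hμpos x).ne').contMDiffAt).comp x (hμ x)
  have hexp : ∀ x, Real.exp (Real.log (μ x)) = μ x := fun x => Real.exp_log (hμpos x)
  have hRpos : ∀ p ∈ (𝓡∂ n).interior M, 0 < ConformalStatic.scalarCurvature g₀ p :=
    fun p hp => h.scalarCurvature_pos hn hM hp
  have hφ0 : ∀ x ∈ (𝓡∂ n).boundary M, Real.log (μ x) = 0 := by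
    intro x hx
    have h1 : ConformalStatic.innerE g x = μ x • ConformalStatic.innerE g₀ x := hμg x
    have h2 : ConformalStatic.innerE g x = ConformalStatic.innerE g₀ x := hbdry x hx
    have hv : ConformalStatic.bv (0 : Fin n) ≠ 0 := by simp
    have h3 := ConformalStatic.innerE_pos g₀ x hv
    rw [h2] at h1
    have h4 := DFunLike.congr_fun (DFunLike.congr_fun h1 (ConformalStatic.bv 0))
      (ConformalStatic.bv 0)
    simp only [smul_apply, smul_eq_mul] at h4
    have h5 : μ x = 1 := by
      have : (μ x - 1) * ConformalStatic.innerE g₀ x (ConformalStatic.bv 0)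
          (ConformalStatic.bv 0) = 0 := by linarith
      rcases mul_eq_zero.1 this with h | h
      · linarith
      · exact absurd h h3.ne'
    rw [h5, Real.log_one]
  -- The gradient term of the conformal formula has the favourable sign because `n ≥ 2`, and is
  -- dropped.
  have hlog := h.eq_zero_of_supersolution hn hRpos hφ hφ0 fun x hx => by
    have h1 := ConformalStatic.conformal_scalarCurvature (g := g) (g₀ := g₀) hφ
      (fun x => by rw [hexp]; exact hμg x) hx
    have h2 := ConformalStatic.gradSq_nonneg g₀ (f := fun x => Real.log (μ x)) x
    have h3 := mul_le_mul_of_nonneg_left (hR x) (Real.exp_pos (Real.log (μ x))).le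
    have h4 : 0 ≤ ((n : ℝ) - 1) * (n - 2) / 4 := by
      have := mul_nonneg (by linarith : (0 : ℝ) ≤ (n : ℝ) - 1) (by linarith : (0 : ℝ) ≤ (n : ℝ) - 2)
      linarith
    have h5 := mul_nonneg h4 h2
    rw [div_mul_eq_mul_div, le_div_iff₀ (by linarith)]
    linarith
  have hμ1 : ∀ x, μ x = 1 := fun x => by rw [← hexp, hlog, Real.exp_zero]
  have hinner : g.inner = g₀.inner := by
    funext x
    rw [hμg x, hμ1 x, one_smul]
  cases g
  cases g₀
  simpa using hinner
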